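/- **Setup.** Let $q_1,q_2$ be indeterminates, $q_3=\frac{1}{q_1q_2}$, and $$\zeta(x)=\frac{(1-xq_1)(1-xq_2)\left(1-\frac{q_1q_2}{x}\right)}{1-x}.$$ $\mathrm{Sym}$ denotes the sum over all permutations of the variables. For symmetric $R(z_1,\dots,z_n)$ and $R'(z_1,\dots,z_{n'})$, with coefficients in $\mathbb{Q}(q_1,q_2)$, the shuffle product is $$R*R'=\mathrm{Sym}\left[\frac{R(z_1,\dots,z_n)\,R'(z_{n+1},\dots,z_{n+n'})}{n!\,n'!}\prod_{1\le i\le n<j\le n+n'}\zeta\left(\frac{z_i}{z_j}\right)\right].$$ *The integral shuffle algebra.* $\mathcal{S}=\bigoplus_{n\ge 0}\mathcal{S}_n$, where $\mathcal{S}_n$ is the set of symmetric Laurent polynomials $R\in\mathbb{Z}[q_1^{\pm1},q_2^{\pm1}][z_1^{\pm1},\dots,z_n^{\pm1}]^{\mathrm{sym}}$ such that for every partition $(n_1\ge\dots\ge n_k)\vdash n$ the specialization $$R(x_1,x_1q_2,\dots,x_1q_2^{n_1-1},\dots,x_k,x_kq_2,\dots,x_kq_2^{n_k-1})$$ is divisible,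 in $\mathbb{Z}[q_1^{\pm1},q_2^{\pm1}][x_1^{\pm1},\dots,x_k^{\pm1}]$, by $$\prod_{i=1}^k\left[(1-q_2)^{n_i}\prod_{s=1}^{n_i-1}\zeta(q_2^s)^{n_i-s}\right]\prod_{1\le i<j\le k}\ \prod_{a=1}^{n_i-1}\prod_{b=0}^{n_j-1}(x_iq_1-x_jq_2^{b-a})(x_jq_1-x_iq_2^{a-b-1}).$$ *The elements $\bar H_{n,d}$.* For integers $n\ge1$ and $d$, let $t=\gcd(n,d)$, $a=n/t$, and put $$P_{n,d}=\mathrm{Sym}\left[\frac{\prod_{i=1}^n z_i^{\lfloor\frac{id}{n}\rfloor-\lfloor\frac{(i-1)d}{n}\rfloor}\ \sum_{s=0}^{t-1}q_2^{-s}\prod_{r=1}^{s}\frac{z_{a(t-r)+1}}{z_{a(t-r)}}}{\prod_{i=1}^{n-1}\left(1-\frac{z_{i+1}}{z_iq_2}\right)}\prod_{1\le i<j\le n}\zeta\left(\frac{z_i}{z_j}\right)\right],$$ $$\bar P_{n,d}=\frac{q_2^t-1}{(q_1^t-1)(q_3^t-1)}(q_1-1)^n(q_3-1)^n\cdot P_{n,d}.$$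 For coprime $(n,d)$ with $n\ge1$, define $\bar H_{nt,dt}$ for all $t\ge1$ by the power series identity $$1+\sum_{t=1}^\infty\frac{\bar H_{nt,dt}}{x^t}=\exp\left(\sum_{t=1}^\infty\frac{\bar P_{nt,dt}}{t\,x^t}\right),$$ the exponential being taken with respect to the shuffle product. This defines $\bar H_{n,d}$ for all integers $n\ge1$ and $d$. **Proposition 4.3.** For all integers $n\ge1$ and $d$, one has $\bar H_{n,d}\in\mathcal{S}$. -/

import Mathlib

namespace ShuffleKHA

open Finset

open scoped DirectSum

noncomputable section

/-! ### Laurent polynomials and rational functions -/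

/-- The Laurent polynomial ring `R[x_i^{±1} : i ∈ σ]` in finitely many variables: the group algebra
of the group of integer exponent vectors. -/
abbrev Laurent (R : Type*) [CommRing R] (σ : Type*) : Type _ := AddMonoidAlgebra R (σ → ℤ)

/-- The homomorphism out of a Laurent polynomial ring that is given by `f` on the coefficients and
sends the variable `x_i` to the unit `u i`. -/
def laurentHom {R S : Type*} [CommRing R] [CommRing S] {σ : Type*} [Fintype σ]
    (f : R →+* S) (u : σ → Sˣ) : Laurent R σ →+* S :=
  AddMonoidAlgebra.liftNCRingHom f
    ({ toFun := fun e => ((∏ i, u i ^ (Multiplicative.toAdd e i) : Sˣ) : S)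
       map_one' := by simp
       map_mul' := fun a b => by
        rw [← Units.val_mul, ← Finset.prod_mul_distrib]
        simp [zpow_add] } : Multiplicative (σ → ℤ) →* S)
    (fun _ _ => Commute.all _ _)

/-- The coefficient ring `ℤ[q₁^{±1}, q₂^{±1}]`. -/
abbrev Zq : Type := Laurent ℤ (Fin 2)

/-- The coefficient field `ℚ(q₁, q₂)`. -/
abbrev Kq : Type := FractionRing (MvPolynomial (Fin 2) ℤ)

/-- The parameter `q₁`. -/
def q1 : Kq := algebraMap (MvPolynomial (Fin 2) ℤ) Kq (MvPolynomial.X 0)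

/-- The parameter `q₂`. -/
def q2 : Kq := algebraMap (MvPolynomial (Fin 2) ℤ) Kq (MvPolynomial.X 1)

/-- The parameter `q₃ = 1 / (q₁ q₂)`. -/
def q3 : Kq := 1 / (q1 * q2)

lemma q1_ne_zero : q1 ≠ 0 :=
  (map_ne_zero_iff _ (IsFractionRing.injective (MvPolynomial (Fin 2) ℤ) Kq)).2
    (MvPolynomial.X_ne_zero 0)

lemma q2_ne_zero : q2 ≠ 0 :=
  (map_ne_zero_iff _ (IsFractionRing.injective (MvPolynomial (Fin 2) ℤ) Kq)).2
    (MvPolynomial.X_ne_zero 1)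

/-- The inclusion `ℤ[q₁^{±1}, q₂^{±1}] ⊂ ℚ(q₁, q₂)`. -/
def qHom : Zq →+* Kq :=
  laurentHom (Int.castRingHom Kq) ![Units.mk0 q1 q1_ne_zero, Units.mk0 q2 q2_ne_zero]

/-- The field of rational functions `ℚ(q₁, q₂)(z_1, …, z_n)`. -/
abbrev RatFun (n : ℕ) : Type := FractionRing (MvPolynomial (Fin n) Kq)

/-- A variable of `ℚ(q₁, q₂)(z_1, …, z_n)`, with indices in `Fin n` (starting at `0`). -/
def var (n : ℕ) (i : Fin n) : RatFun n :=
  algebraMap (MvPolynomial (Fin n) Kq) (RatFun n) (MvPolynomial.X i)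

lemma var_ne_zero (n : ℕ) (i : Fin n) : var n i ≠ 0 :=
  (map_ne_zero_iff _ (IsFractionRing.injective (MvPolynomial (Fin n) Kq) (RatFun n))).2
    (MvPolynomial.X_ne_zero i)

/-- The variable `z_i` of `ℚ(q₁, q₂)(z_1, …, z_n)`, with indices `1 ≤ i ≤ n` as on paper. (The value
for other `i` is never used.) -/
def z (n i : ℕ) : RatFun n :=
  if h : 1 ≤ i ∧ i ≤ n then var n ⟨i - 1, by omega⟩ else 1

/-- The parameter `q₁` in the field of rational functions. -/
abbrev Q1 (n : ℕ) : RatFun n := algebraMap Kq (RatFun n) q1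

/-- The parameter `q₂` in the field of rational functions. -/
abbrev Q2 (n : ℕ) : RatFun n := algebraMap Kq (RatFun n) q2

lemma Q2_ne_zero (n : ℕ) : Q2 n ≠ 0 :=
  (map_ne_zero_iff _ (algebraMap Kq (RatFun n)).injective).2 q2_ne_zero

/-- The inclusion `ℤ[q₁^{±1}, q₂^{±1}][z_1^{±1}, …, z_n^{±1}] ⊂ ℚ(q₁, q₂)(z_1, …, z_n)`. -/
def toRat (n : ℕ) : Laurent Zq (Fin n) →+* RatFun n :=
  laurentHom ((algebraMap Kq (RatFun n)).comp qHom) (fun i => Units.mk0 (var n i) (var_ne_zero n i))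

/-- The map `MvPolynomial (Fin m) Kq → RatFun n` renaming variables along `f`. -/
def polyRelabel {m n : ℕ} (f : Fin m → Fin n) : MvPolynomial (Fin m) Kq →ₐ[Kq] RatFun n :=
  (IsScalarTower.toAlgHom Kq (MvPolynomial (Fin n) Kq) (RatFun n)).comp (MvPolynomial.rename f)

lemma polyRelabel_injective {m n : ℕ} (f : Fin m → Fin n) (hf : Function.Injective f) :
    Function.Injective (polyRelabel f) := by
  intro a b h
  exact MvPolynomial.rename_injective f hf
    (IsFractionRing.injective (MvPolynomial (Fin n) Kq) (RatFun n) h)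

/-- The embedding of fields `ℚ(q₁, q₂)(z_1, …, z_m) → ℚ(q₁, q₂)(z_1, …, z_n)` which sends the
variable with index `i` to the variable with index `f i`, for an injective `f`. -/
def relabel {m n : ℕ} (f : Fin m → Fin n) (hf : Function.Injective f) : RatFun m →ₐ[Kq] RatFun n :=
  IsFractionRing.liftAlgHom (polyRelabel_injective f hf)

lemma relabel_var {m n : ℕ} (f : Fin m → Fin n) (hf : Function.Injective f) (i : Fin m) :
    relabel f hf (var m i) = var n (f i) := by
  rw [relabel, var, IsFractionRing.liftAlgHom_apply, IsFractionRing.lift_algebraMap]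
  simp [polyRelabel, var]

/-- `Sym`: the sum over all permutations of the variables. -/
def symmetrize (n : ℕ) (f : RatFun n) : RatFun n :=
  ∑ σ : Equiv.Perm (Fin n), relabel σ σ.injective f

/-! ### The shuffle product -/

/-- `ζ(x) = (1 - x q₁)(1 - x q₂)(1 - q₁ q₂ / x) / (1 - x)`. -/
def zeta {L : Type*} [Field L] [Algebra Kq L] (x : L) : L :=
  (1 - x * algebraMap Kq L q1) * (1 - x * algebraMap Kq L q2) *
    (1 - algebraMap Kq L (q1 * q2) / x) / (1 - x)

/-- The shuffle product of `R(z_1, …, z_n)` and `R'(z_1, …, z_m)`. -/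
def shuffle {n m : ℕ} (R : RatFun n) (R' : RatFun m) : RatFun (n + m) :=
  symmetrize (n + m)
    (relabel (Fin.castAdd m) (Fin.castAdd_injective n m) R *
      relabel (Fin.natAdd n) (Fin.natAdd_injective m n) R' / ((n.factorial : RatFun (n + m)) *
        (m.factorial : RatFun (n + m))) *
      ∏ i : Fin n, ∏ j : Fin m,
        zeta (var (n + m) (Fin.castAdd m i) / var (n + m) (Fin.natAdd n j)))

instance : DirectSum.GNonUnitalNonAssocSemiring RatFun where
  mul := shuffle
  mul_zero := fun a => by
    change shuffle a 0 = 0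
    simp [shuffle, symmetrize]
  zero_mul := fun a => by
    change shuffle 0 a = 0
    simp [shuffle, symmetrize]
  mul_add := fun a b c => by
    change shuffle a (b + c) = shuffle a b + shuffle a c
    simp only [shuffle, symmetrize, map_add, mul_add, add_div, add_mul, Finset.sum_add_distrib]
  add_mul := fun a b c => by
    change shuffle (a + b) c = shuffle a c + shuffle b c
    simp only [shuffle, symmetrize, map_add, add_div, add_mul, Finset.sum_add_distrib]

/-- The ambient graded vector space `⨁ₙ ℚ(q₁, q₂)(z_1, …, z_n)` over `ℚ(q₁, q₂)`, whose
multiplication `*` is the shuffle product. The shuffle algebras (over `ℤ[q₁^{±1}, q₂^{±1}]` and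
localized) live inside it as spaces of symmetric Laurent polynomials. -/
abbrev Ambient : Type := ⨁ n, RatFun n

/-! ### The integral shuffle algebra -/

/-- The specialization
`R ↦ R(x_1, x_1 q₂, …, x_1 q₂^{n_1-1}, …, x_k, x_k q₂, …, x_k q₂^{n_k-1})`
attached to `n = n_1 + … + n_k`; the result is a Laurent polynomial in `x_1, …, x_k`, regarded as a
rational function. -/
def specialize {n : ℕ} (c : Composition n) : Laurent Zq (Fin n) →+* RatFun c.length :=
  laurentHom ((algebraMap Kq (RatFun c.length)).comp qHom) (fun j =>
    Units.mk0 (var c.length (c.index j)) (var_ne_zero _ _) *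
      Units.mk0 (Q2 c.length) (Q2_ne_zero _) ^ (c.invEmbedding j : ℕ))

/-- The expression by which the specialization attached to `n = n_1 + … + n_k` has to be divisible:
`∏_i [(1-q₂)^{n_i} ∏_{s=1}^{n_i-1} ζ(q₂^s)^{n_i-s}]` times
`∏_{i<j} ∏_{a=1}^{n_i-1} ∏_{b=0}^{n_j-1} (x_i q₁ - x_j q₂^{b-a}) (x_j q₁ - x_i q₂^{a-b-1})`. -/
def divisor {n : ℕ} (c : Composition n) : RatFun c.length :=
  (∏ i : Fin c.length, ((1 - Q2 c.length) ^ c.blocksFun i *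
    ∏ s ∈ Icc 1 (c.blocksFun i - 1), zeta (Q2 c.length ^ s) ^ (c.blocksFun i - s))) *
  ∏ i : Fin c.length, ∏ j ∈ Ioi i,
    ((∏ a ∈ Icc 1 (c.blocksFun i - 1), ∏ b ∈ range (c.blocksFun j),
        (var c.length i * Q1 c.length - var c.length j * Q2 c.length ^ ((b : ℤ) - (a : ℤ)))) *
      (∏ a ∈ Icc 1 (c.blocksFun i - 1), ∏ b ∈ range (c.blocksFun j),
        (var c.length j * Q1 c.length - var c.length i * Q2 c.length ^ ((a : ℤ) - (b : ℤ) - 1))))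

/-- The degree `n` part of the integral shuffle algebra: symmetric Laurent polynomials in
`z_1, …, z_n` over `ℤ[q₁^{±1}, q₂^{±1}]` such that, for every partition `(n_1 ≥ … ≥ n_k)` of `n`
(a composition of `n` with weakly decreasing positive parts), the specialization is divisible by
`divisor` in `ℤ[q₁^{±1}, q₂^{±1}][x_1^{±1}, …, x_k^{±1}]`. -/
def shufflePart (n : ℕ) : Set (Laurent Zq (Fin n)) :=
  {R | (∀ (σ : Equiv.Perm (Fin n)) (e : Fin n → ℤ), R.coeff (e ∘ σ) = R.coeff e) ∧
    ∀ c : Composition n, Antitone c.blocksFun →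
      ∃ T : Laurent Zq (Fin c.length), specialize c R = divisor c * toRat c.length T}

/-- The integral shuffle algebra `𝒮`, as a subset of the ambient algebra: every homogeneous
component has to be (the rational function given by) an element of the corresponding graded part. -/
def integralShuffleAlgebra : Set Ambient :=
  {w | ∀ n : ℕ, ∃ R ∈ shufflePart n, toRat n R = w n}

/-! ### The elements `P`, rescaled `P` and rescaled `H` -/

/-- The element
`P_{n,d} = Sym [ (∏_i z_i^{⌊id/n⌋ - ⌊(i-1)d/n⌋} ∑_{s=0}^{t-1} q₂^{-s} ∏_{r=1}^s z_{a(t-r)+1}/z_{a(t-r)})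
  / ∏_{i=1}^{n-1} (1 - z_{i+1}/(z_i q₂)) · ∏_{i<j} ζ(z_i/z_j) ]`,
where `t = gcd(n,d)` and `a = n/t`. -/
def P (n : ℕ) (d : ℤ) : RatFun n :=
  let t : ℕ := Int.gcd n d
  let a : ℕ := n / t
  symmetrize n
    ((∏ i ∈ Icc 1 n, z n i ^ (⌊(i : ℚ) * d / n⌋ - ⌊((i : ℚ) - 1) * d / n⌋)) *
      (∑ s ∈ range t,
        (∏ r ∈ Icc 1 s, z n (a * (t - r) + 1) / z n (a * (t - r))) / Q2 n ^ s) /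
      (∏ i ∈ Icc 1 (n - 1), (1 - z n (i + 1) / (z n i * Q2 n))) *
      ∏ i ∈ Icc 1 n, ∏ j ∈ Ioc i n, zeta (z n i / z n j))

/-- The scalar
`γ_{n,d} = (q₂^t - 1) / ((q₁^t - 1)(q₃^t - 1)) · (q₁ - 1)^n (q₃ - 1)^n`, where `t = gcd(n,d)`. -/
def gamma (n : ℕ) (d : ℤ) : Kq :=
  let t : ℕ := Int.gcd n d
  (q2 ^ t - 1) / ((q1 ^ t - 1) * (q3 ^ t - 1)) * ((q1 - 1) ^ n * (q3 - 1) ^ n)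

/-- The rescaled element `P̄_{n,d} = γ_{n,d} P_{n,d}`, in degree `n` of the ambient algebra. -/
def Pbar (n : ℕ) (d : ℤ) : Ambient :=
  DirectSum.of RatFun n (gamma n d • P n d)

/-- Product of formal power series (in `1/x`) with coefficients in the ambient algebra; a series is
given by its sequence of coefficients. -/
def seriesMul (A B : ℕ → Ambient) : ℕ → Ambient :=
  fun t => ∑ p ∈ antidiagonal t, A p.1 * B p.2

/-- Powers of a formal power series. -/
def seriesPow (A : ℕ → Ambient) : ℕ → (ℕ → Ambient)
  | 0 => fun t => if t = 0 then DirectSum.of RatFun 0 1 else 0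
  | k + 1 => seriesMul (seriesPow A k) A

/-- The exponential `∑_k A^k / k!` of a formal power series `A` with zero constant term; powers
`A^k` with `k > t` do not contribute to the coefficient with index `t`. -/
def seriesExp (A : ℕ → Ambient) : ℕ → Ambient :=
  fun t => ∑ k ∈ range (t + 1), (1 / (k.factorial : Kq)) • seriesPow A k t

/-- For coprime `(n, d)`, the series `1 + ∑_{t ≥ 1} H̄_{nt,dt} / x^t`, that is, the exponential of
`∑_{t ≥ 1} P̄_{nt,dt} / (t x^t)`. -/
def HbarSeries (n : ℕ) (d : ℤ) : ℕ → Ambient :=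
  seriesExp (fun t => if t = 0 then 0 else (1 / (t : Kq)) • Pbar (n * t) (d * t))

/-- The element `H̄_{n,d}`: with `t = gcd(n,d)`, the coefficient of `x^{-t}` in the series attached to
the coprime pair `(n/t, d/t)`. -/
def Hbar (n : ℕ) (d : ℤ) : Ambient :=
  HbarSeries (n / Int.gcd n d) (d / (Int.gcd n d : ℤ)) (Int.gcd n d)

end

end ShuffleKHA

/-!
A symmetric rational function `R(z_1, …, z_m)` gives, for every family `v` of points of a field over
`ℚ(q₁, q₂)`, the set function `S ↦ R(v_i : i ∈ S)`, and the shuffle product becomes a convolution of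
set functions, twisted by the kernel `ζ(v_i / v_j)` (`Tw`, `setFun_shuffle`). In these terms all
elements of interest are combinations of the sums over orderings `M c m d`, the set functions of
`Sym [z^d / ∏ (1 - z_{i+1}/(z_i q_c)) · ∏_{i<j} ζ(z_i/z_j)]` for a colour `c`, that is, for one of the
three parameters. They are integral Laurent polynomials (`exists_rep`), satisfy the wheel conditions
(`M_wheel`), and the product of two of them is an integral combination of two others (`M_mul_M`).

*The elements of a fixed slope.* Fix coprime `a`, `b`. Let `X` be the sum of the `M c (at)` with the
exponents of slope `b/a`, without the extra sum in the definition of `P`, and let `PP c a b t` be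
`P_{at,bt}` with `q₂` replaced by `q_c`. A telescoping sum shows that `∑ a PP_t` is the logarithmic
derivative of `X` (`dlog_mul_X`). If some of the variables tend to infinity, then the leading
coefficients of `X` factor (`rel_X`), so those of the logarithmic derivative, and of commutators of its
parts, vanish (`lead_part_dlog`, `lead_commutator_dlog`). A Laurent polynomial with the wheel
conditions and such vanishing leading coefficients is determined by its values at the geometric
progressions with ratio `q_γ` (`eq_zero_of_vanishing`). Comparing these values shows that the `PP_t`
commute (`PP_comm`), and that the elements for two colours are proportional (`PP_color`).

*Integrality up to denominators.* Let `q_c` and `q_δ` be the parameters `q₁` and `q₃`, in one of the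
two orders. By `PP_color`, the logarithm of the series of the elements `H̄` is
`∑ κ^t PP_t / (t (q_δ^t - 1))` in the colour `c`, where `κ = ((q₂ - 1)(q_δ - 1))^a`
(`total_logSeries`). As the `PP_t` commute and `X = exp(∑ PP_t / t)`,
its exponential `G(x)` satisfies `G(q_δ x) = X(κ x) G(x)`. This is a recursion for the coefficients
(`part_exp_recursion`), by which `∏_{i ≤ t} (q_δ^i - 1)` times the coefficient of degree `t` is `κ^t`
times an integral combination of sums over orderings (`exists_isComb_exp`, `exists_isComb_Hbar`).

*Divisibility.* If a sum over orderings is specialized to a union of strings with ratio `q₂`, the only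
orderings that survive meet each string in decreasing order. Each of them contributes the divisor in
the definition of the integral shuffle algebra, once it is multiplied by the power of
`(1 - q₂)(1 - q_δ)` that `κ^t` provides (`exists_wt_eq`). The differences between the points of
different strings in the denominators are prime to the divisor, and cancel (`exists_M_eq`).

*Removing the denominators.* The above holds for `q_δ = q₃` and for `q_δ = q₁`, and `∏ (q₃^i - 1)`
is prime to `∏ (q₁^i - 1)` (`prod_col_dvd_of_dvd_mul`). So `H̄` itself is integral, and its specializations are
divisible (`exists_mem_shufflePart`).
-/

namespace ShuffleKHA

open Finset

open scoped DirectSum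

noncomputable section

set_option linter.unusedSectionVars false

/-! ### Laurent polynomial rings -/

section Laurent

variable {R S : Type*} [CommRing R] [CommRing S] {σ : Type*} [Fintype σ]

lemma laurentHom_single (f : R →+* S) (u : σ → Sˣ) (e : σ → ℤ) (r : R) :
    laurentHom f u (AddMonoidAlgebra.single e r) = f r * ((∏ i, u i ^ e i : Sˣ) : S) := by
  simp only [laurentHom]
  exact AddMonoidAlgebra.liftNC_single _ _ _ _

/-- The inclusion of the constants in a Laurent polynomial ring. -/
def lC : R →+* Laurent R σ := AddMonoidAlgebra.singleZeroRingHom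

lemma lC_apply (r : R) : (lC r : Laurent R σ) = AddMonoidAlgebra.single 0 r := rfl

/-- The monomials of a Laurent polynomial ring, as units. -/
def lmon (e : σ → ℤ) : (Laurent R σ)ˣ where
  val := AddMonoidAlgebra.single e 1
  inv := AddMonoidAlgebra.single (-e) 1
  val_inv := by rw [AddMonoidAlgebra.single_mul_single]; simp [AddMonoidAlgebra.one_def]
  inv_val := by rw [AddMonoidAlgebra.single_mul_single]; simp [AddMonoidAlgebra.one_def]

lemma lmon_add (e e' : σ → ℤ) : (lmon (e + e') : (Laurent R σ)ˣ) = lmon e * lmon e' := by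
  ext1
  simp [lmon, AddMonoidAlgebra.single_mul_single]

/-- The variables of a Laurent polynomial ring, as units. -/
def lvar [DecidableEq σ] (i : σ) : (Laurent R σ)ˣ := lmon (Pi.single i 1)

lemma laurentHom_lC (f : R →+* S) (u : σ → Sˣ) (r : R) : laurentHom f u (lC r) = f r := by
  rw [lC_apply, laurentHom_single]; simp

lemma laurentHom_lmon (f : R →+* S) (u : σ → Sˣ) (e : σ → ℤ) :
    laurentHom f u (lmon e : (Laurent R σ)ˣ) = ((∏ i, u i ^ e i : Sˣ) : S) := by
  change laurentHom f u (AddMonoidAlgebra.single e 1) = _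
  rw [laurentHom_single]; simp

lemma laurentHom_lvar [DecidableEq σ] (f : R →+* S) (u : σ → Sˣ) (i : σ) :
    laurentHom f u (lvar i : (Laurent R σ)ˣ) = u i := by
  rw [lvar, laurentHom_lmon]
  congr 1
  rw [Finset.prod_eq_single i]
  · simp
  · intro j _ hj; simp [hj]
  · simp

lemma lmon_eq_prod [DecidableEq σ] (e : σ → ℤ) :
    (lmon e : (Laurent R σ)ˣ) = ∏ i, lvar i ^ e i := by
  let φ : Multiplicative (σ → ℤ) →* (Laurent R σ)ˣ :=
    { toFun := fun e => lmon (Multiplicative.toAdd e)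
      map_one' := by ext1; simp [lmon, AddMonoidAlgebra.one_def]
      map_mul' := fun a b => lmon_add _ _ }
  have h : Multiplicative.ofAdd e = ∏ i, Multiplicative.ofAdd (Pi.single i (1 : ℤ)) ^ e i := by
    apply Multiplicative.toAdd.injective
    rw [toAdd_prod]
    funext j
    simp [Finset.sum_apply, Pi.single_apply]
  have := congrArg φ h
  rw [map_prod] at this
  simp only [map_zpow] at this
  exact this

lemma laurent_hom_ext [DecidableEq σ] {φ ψ : Laurent R σ →+* S} (hC : ∀ r, φ (lC r) = ψ (lC r))
    (hv : ∀ i, φ (lvar i : (Laurent R σ)ˣ) = ψ (lvar i : (Laurent R σ)ˣ)) : φ = ψ := by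
  refine AddMonoidAlgebra.ringHom_ext hC fun m => ?_
  change φ (lmon m : (Laurent R σ)ˣ) = ψ (lmon m : (Laurent R σ)ˣ)
  have : ∀ (θ : Laurent R σ →+* S), θ (lmon m : (Laurent R σ)ˣ) =
      ((∏ i, (Units.map (θ : Laurent R σ →* S) (lvar i)) ^ m i : Sˣ) : S) := by
    intro θ
    rw [lmon_eq_prod]
    change ((Units.map (θ : Laurent R σ →* S) _ : Sˣ) : S) = _
    rw [map_prod]
    simp only [map_zpow]
  rw [this, this]
  congr 1
  refine Finset.prod_congr rfl fun i _ => ?_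
  congr 1
  ext1
  exact hv i

lemma comp_laurentHom {T : Type*} [CommRing T] (g : S →+* T) (f : R →+* S) (u : σ → Sˣ) (x) :
    g (laurentHom f u x) = laurentHom (g.comp f) (fun i => Units.map (g : S →* T) (u i)) x := by
  classical
  have : g.comp (laurentHom f u) =
      laurentHom (g.comp f) (fun i => Units.map (g : S →* T) (u i)) := by
    apply laurent_hom_ext
    · intro r; simp [laurentHom_lC]
    · intro i; simp [laurentHom_lvar]
  exact congrArg (fun θ => θ x) this

/-- Evaluation of Laurent polynomials at algebraically independent variables is injective. -/
lemma laurentHom_injective {A : Type*} [CommRing A] [IsDomain A] (f : R →+* A)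
    (hf : Function.Injective f) (g : R →+* FractionRing (MvPolynomial σ A))
    (hg : ∀ r, g r = algebraMap (MvPolynomial σ A) _ (MvPolynomial.C (f r)))
    (u : σ → (FractionRing (MvPolynomial σ A))ˣ)
    (hu : ∀ i, (u i : FractionRing (MvPolynomial σ A)) =
      algebraMap (MvPolynomial σ A) _ (MvPolynomial.X i)) :
    Function.Injective (laurentHom g u) := by
  classical
  rw [injective_iff_map_eq_zero]
  intro x hx
  -- Multiplication by the monomial with exponents `N` clears the negative exponents of `x`, and
  -- turns it into the polynomial `p`.
  let N : σ → ℕ := fun i => ∑ e ∈ x.coeff.support, (e i).natAbs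
  have hN : ∀ e ∈ x.coeff.support, ∀ i, 0 ≤ e i + N i := by
    intro e he i
    have : (e i).natAbs ≤ N i :=
      Finset.single_le_sum (f := fun e : σ → ℤ => (e i).natAbs) (fun _ _ => Nat.zero_le _) he
    omega
  let s : (σ → ℤ) → (σ →₀ ℕ) := fun e => Finsupp.equivFunOnFinite.symm fun i => (e i + N i).toNat
  let p : MvPolynomial σ A := ∑ e ∈ x.coeff.support, MvPolynomial.monomial (s e) (f (x.coeff e))
  have key : algebraMap (MvPolynomial σ A) (FractionRing (MvPolynomial σ A)) p =
      laurentHom g u x * ((∏ i, u i ^ N i : (FractionRing (MvPolynomial σ A))ˣ) :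
        FractionRing (MvPolynomial σ A)) := by
    conv_rhs => rw [← AddMonoidAlgebra.sum_coeff_single x]
    rw [Finsupp.sum, map_sum, map_sum (laurentHom g u), Finset.sum_mul]
    refine Finset.sum_congr rfl fun e he => ?_
    rw [laurentHom_single, mul_assoc, ← Units.val_mul, ← Finset.prod_mul_distrib, hg,
      MvPolynomial.monomial_eq, map_mul]
    congr 1
    rw [Finsupp.prod_fintype _ _ (by simp), map_prod, Units.coe_prod]
    refine Finset.prod_congr rfl fun i _ => ?_
    have h1 : u i ^ e i * u i ^ N i = u i ^ (e i + N i).toNat := by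
      rw [← zpow_natCast, ← zpow_natCast, ← zpow_add, Int.toNat_of_nonneg (hN e he i)]
    rw [h1, Units.val_pow_eq_pow_val, hu, map_pow]
    simp [s]
  rw [hx, zero_mul] at key
  have hp : p = 0 := IsFractionRing.injective (MvPolynomial σ A)
    (FractionRing (MvPolynomial σ A)) (by rw [key, map_zero])
  have : x.coeff = 0 := by
    ext e
    by_contra hne
    have he : e ∈ x.coeff.support := Finsupp.mem_support_iff.2 hne
    have hc : MvPolynomial.coeff (s e) p = f (x.coeff e) := by
      simp only [p, MvPolynomial.coeff_sum, MvPolynomial.coeff_monomial]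
      rw [Finset.sum_eq_single e]
      · simp
      · intro e' he' hee
        rw [if_neg]
        intro h
        apply hee
        funext i
        have := DFunLike.congr_fun h i
        simp only [s, Finsupp.equivFunOnFinite_symm_apply_apply] at this
        have h1 := hN e he i
        have h2 := hN e' he' i
        omega
      · intro h; exact absurd he h
    rw [hp, MvPolynomial.coeff_zero] at hc
    exact hne (hf (by rw [← hc]; simp))
  exact AddMonoidAlgebra.coeff_eq_zero.1 this

/-- A substitution of the variables changes a Laurent polynomial only by a multiple of `w`, if it
changes every variable by a multiple of `w`. -/
lemma dvd_sub_subst [DecidableEq σ] (h : Laurent R σ →+* Laurent R σ) (w : Laurent R σ)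
    (hC : ∀ r, h (lC r) = lC r)
    (hv : ∀ k, w ∣ (lvar k : (Laurent R σ)ˣ) - h (lvar k : (Laurent R σ)ˣ)) (s : Laurent R σ) :
    w ∣ s - h s := by
  have : (Ideal.Quotient.mk (Ideal.span {w})) = (Ideal.Quotient.mk (Ideal.span {w})).comp h := by
    apply laurent_hom_ext
    · intro r; simp [hC]
    · intro i
      rw [RingHom.comp_apply, Ideal.Quotient.eq, Ideal.mem_span_singleton]
      exact hv i
  have h1 := congrArg (fun θ => θ s) this
  simp only [RingHom.comp_apply] at h1
  rwa [Ideal.Quotient.eq, Ideal.mem_span_singleton] at h1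

/-- Cancelling a factor `w` in a divisibility: `w` generates the kernel of a substitution which does
not kill the divisor. -/
lemma dvd_of_dvd_mul_of_subst {A : Type*} [CommRing A] [IsDomain A] (h : A →+* A) {w : A}
    (hw0 : w ≠ 0) (hw : h w = 0) (hs : ∀ s, w ∣ s - h s) {δ x : A} (hδ : h δ ≠ 0)
    (hd : δ ∣ w * x) : δ ∣ x := by
  obtain ⟨s, hs'⟩ := hd
  have h1 : h δ * h s = 0 := by rw [← map_mul, ← hs', map_mul, hw, zero_mul]
  have h2 : h s = 0 := (mul_eq_zero.1 h1).resolve_left hδ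
  have h3 := hs s
  rw [h2, sub_zero] at h3
  obtain ⟨t, rfl⟩ := h3
  refine ⟨t, mul_left_cancel₀ hw0 ?_⟩
  rw [hs']; ring

end Laurent

/-! ### Parameters and evaluation -/

lemma qHom_injective : Function.Injective qHom := by
  apply laurentHom_injective (A := ℤ) (RingHom.id ℤ) Function.injective_id
  · intro r; simp
  · intro i; fin_cases i <;> rfl

lemma toRat_injective (n : ℕ) : Function.Injective (toRat n) := by
  apply laurentHom_injective (A := Kq) qHom qHom_injective
  · intro r
    rw [RingHom.comp_apply, IsScalarTower.algebraMap_apply Kq (MvPolynomial (Fin n) Kq)]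
    rfl
  · intro i; rfl

instance (n : ℕ) : IsDomain (Laurent Zq (Fin n)) := (toRat_injective n).isDomain
instance : CharZero Zq := charZero_of_injective_ringHom
  (show Function.Injective (lC : ℤ →+* Zq) from AddMonoidAlgebra.single_right_injective)
instance (n : ℕ) : CharZero (Laurent Zq (Fin n)) :=
  charZero_of_injective_ringHom (show Function.Injective (lC : Zq →+* Laurent Zq (Fin n)) from
    AddMonoidAlgebra.single_right_injective)
instance : CharZero Kq := charZero_of_injective_ringHom qHom_injective

/-- The three parameters `q₁, q₂, q₃`, whose product is `1`, indexed by the cyclic group `Fin 3`. -/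
def col : Fin 3 → Kq := ![q1, q2, q3]

/-- The parameters `q₁, q₂, q₃` as units of `ℤ[q₁^{±1}, q₂^{±1}]`. -/
def zcol : Fin 3 → Zqˣ := ![lmon ![1, 0], lmon ![0, 1], lmon ![-1, -1]]

lemma qHom_lmon (e : Fin 2 → ℤ) : qHom (lmon e : Zqˣ) = q1 ^ e 0 * q2 ^ e 1 := by
  rw [qHom, laurentHom_lmon]
  simp [Fin.prod_univ_two]

lemma qHom_zcol (c : Fin 3) : qHom (zcol c) = col c := by
  fin_cases c <;> simp [zcol, qHom_lmon, col, q3, mul_comm]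

lemma col_ne_zero (c : Fin 3) : col c ≠ 0 := by
  rw [← qHom_zcol]
  exact ((zcol c).isUnit.map qHom).ne_zero

lemma col_prod (c : Fin 3) : col c * col (c + 1) * col (c + 2) = 1 := by
  have h1 := q1_ne_zero
  have h2 := q2_ne_zero
  fin_cases c <;> simp [col, q3] <;> field_simp

/-- Two different parameters are multiplicatively independent. -/
lemma col_indep {c c' : Fin 3} (h : c ≠ c') (i j : ℤ) (hij : col c ^ i * col c' ^ j = 1) :
    i = 0 ∧ j = 0 := by
  have key : ∀ x y : ℤ, q1 ^ x * q2 ^ y = 1 → x = 0 ∧ y = 0 := by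
    intro x y hxy
    have : qHom (lmon ![x, y] : Zqˣ) = qHom (lmon 0 : Zqˣ) := by
      rw [qHom_lmon, qHom_lmon]; simpa using hxy
    have h2 := qHom_injective this
    have h3 : (![x, y] : Fin 2 → ℤ) = 0 :=
      AddMonoidAlgebra.single_left_injective (one_ne_zero (α := ℤ)) h2
    exact ⟨by simpa using congrFun h3 0, by simpa using congrFun h3 1⟩
  have h1 := q1_ne_zero
  have h2 := q2_ne_zero
  have h3 : ∀ k : ℤ, col 2 ^ k = q1 ^ (-k) * q2 ^ (-k) := by
    intro k; simp [col, q3, mul_zpow, mul_comm]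
  have hc0 : col 0 = q1 := rfl
  have hc1 : col 1 = q2 := rfl
  fin_cases c <;> fin_cases c' <;> simp only [Fin.zero_eta, Fin.mk_one, Fin.reduceFinMk, ne_eq,
    not_true_eq_false, h3, hc0, hc1] at h hij
  · exact key _ _ hij
  · have := key (i - j) (-j) (by rw [← hij, sub_eq_add_neg, zpow_add₀ h1]; ring)
    omega
  · have := key j i (by rw [← hij]; ring)
    omega
  · have := key (- j) (i - j) (by rw [← hij, sub_eq_add_neg, zpow_add₀ h2]; ring)
    omega
  · have := key (j - i) (-i) (by rw [← hij, sub_eq_add_neg, zpow_add₀ h1]; ring)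
    omega
  · have := key (- i) (j - i) (by rw [← hij, sub_eq_add_neg, zpow_add₀ h2]; ring)
    omega

section Ev

variable {F : Type} [Field F] [Algebra Kq F]

variable (F) in
/-- The structure map of a `ℚ(q₁, q₂)`-algebra, restricted to `ℤ[q₁^{±1}, q₂^{±1}]`. -/
def coefHom : Zq →+* F := (algebraMap Kq F).comp qHom

lemma coefHom_injective : Function.Injective (coefHom F) :=
  (algebraMap Kq F).injective.comp qHom_injective

variable (F) in
/-- The parameters `q₁, q₂, q₃` as units of a `ℚ(q₁, q₂)`-algebra. -/
def fcol (c : Fin 3) : Fˣ := Units.mk0 (algebraMap Kq F (col c)) (by simp [col_ne_zero])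

lemma coe_fcol (c : Fin 3) : (fcol F c : F) = algebraMap Kq F (col c) := rfl

lemma coefHom_zcol (c : Fin 3) : coefHom F (zcol c) = fcol F c := by
  simp [coefHom, qHom_zcol, fcol]

lemma fcol_prod (c : Fin 3) : fcol F c * fcol F (c + 1) * fcol F (c + 2) = 1 := by
  ext1
  simp only [Units.val_mul, coe_fcol, ← map_mul, col_prod, map_one, Units.val_one]

lemma fcol_indep {c c' : Fin 3} (h : c ≠ c') (i j : ℤ) (hij : fcol F c ^ i * fcol F c' ^ j = 1) :
    i = 0 ∧ j = 0 := by
  apply col_indep h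
  apply (algebraMap Kq F).injective
  have := congrArg Units.val hij
  simpa [coe_fcol] using this

lemma fcol_zpow_inj (c : Fin 3) {i j : ℤ} (h : fcol F c ^ i = fcol F c ^ j) : i = j := by
  have := (fcol_indep (F := F) (c := c) (c' := c + 1) (by fin_cases c <;> decide) (i - j) 0
    (by rw [zpow_sub, h]; simp)).1
  omega

lemma fcol_pow_ne_one (c : Fin 3) {i : ℕ} (hi : i ≠ 0) : (fcol F c : F) ^ i ≠ 1 := by
  intro h
  apply hi
  have : fcol F c ^ (i : ℤ) = fcol F c ^ (0 : ℤ) := by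
    ext1; simpa using h
  exact_mod_cast fcol_zpow_inj c this

/-- The value of a Laurent polynomial at a point with invertible coordinates. -/
def ev {σ : Type*} [Fintype σ] (v : σ → Fˣ) : Laurent Zq σ →+* F := laurentHom (coefHom F) v

lemma toRat_eq_ev (n : ℕ) : toRat n = ev fun i => Units.mk0 (var n i) (var_ne_zero n i) := rfl

end Ev

/-! ### Divisibility by factors that only involve the parameters -/

/-- If `T`, `W` are monomials, and some linear form on the exponents vanishes on `T` but not on `W`,
then `1 - W` is not a zero divisor modulo `1 - T`: multiplication by a high power of `W` moves a
Laurent polynomial away from the union of the `T`-orbits of its support. -/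
lemma one_sub_dvd_of_dvd_mul (l : (Fin 2 → ℤ) →+ ℤ) (t w : Fin 2 → ℤ) (ht : l t = 0) (hw : 0 < l w)
    {A : Zq} (h : (1 - (lmon t : Zqˣ) : Zq) ∣ (1 - (lmon w : Zqˣ)) * A) :
    (1 - (lmon t : Zqˣ) : Zq) ∣ A := by
  classical
  obtain ⟨B, hB⟩ := h
  set T : Zq := ((lmon t : Zqˣ) : Zq) with hT
  set W : Zq := ((lmon w : Zqˣ) : Zq) with hW
  let L : Finset ℤ := A.coeff.support.image l
  -- Multiplication by `W ^ N` moves the support of `A` off the set `L` of levels of `l`.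
  obtain ⟨N, hN⟩ : ∃ N : ℕ, ∀ x ∈ L, ∀ y ∈ L, x + N * l w ≠ y := by
    refine ⟨∑ x ∈ L, x.natAbs + ∑ x ∈ L, x.natAbs + 1, fun x hx y hy he => ?_⟩
    have h1 : x.natAbs ≤ ∑ x ∈ L, x.natAbs :=
      Finset.single_le_sum (f := fun x : ℤ => x.natAbs) (fun _ _ => Nat.zero_le _) hx
    have h2 : y.natAbs ≤ ∑ x ∈ L, x.natAbs :=
      Finset.single_le_sum (f := fun x : ℤ => x.natAbs) (fun _ _ => Nat.zero_le _) hy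
    have h3 : ((∑ x ∈ L, x.natAbs + ∑ x ∈ L, x.natAbs + 1 : ℕ) : ℤ) ≤
        ((∑ x ∈ L, x.natAbs + ∑ x ∈ L, x.natAbs + 1 : ℕ) : ℤ) * l w := by nlinarith
    omega
  -- The restriction of the exponents to the levels in `L`. It commutes with the multiplication by
  -- `1 - T`, because `l` vanishes on `T`.
  let ρ : Zq → Zq := fun C => .ofCoeff (C.coeff.filter fun e => l e ∈ L)
  have hρ : ∀ C e, (ρ C).coeff e = if l e ∈ L then C.coeff e else 0 := by
    intro C e; simp only [ρ, Finsupp.filter_apply]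
  have hmul : ∀ (s : Fin 2 → ℤ) (C : Zq) (e : Fin 2 → ℤ),
      (((lmon s : Zqˣ) : Zq) * C).coeff e = C.coeff (-s + e) := by
    intro s C e
    change (AddMonoidAlgebra.single s 1 * C).coeff e = _
    rw [AddMonoidAlgebra.coeff_single_mul_apply, one_mul]
  -- `1 - W ^ N` is a multiple of `1 - W`. Restricting this equation to the levels in `L` removes
  -- the summand `W ^ N * A`.
  have e1 : A = W ^ N * A + (1 - T) * ((∑ k ∈ range N, W ^ k) * B) := by
    have : (∑ k ∈ range N, W ^ k) * (1 - W) = 1 - W ^ N := by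
      have := geom_sum_mul W N
      linear_combination -this
    have h2 : (1 - T) * ((∑ k ∈ range N, W ^ k) * B) = (1 - W ^ N) * A := by
      rw [← this, mul_assoc, hB]; ring
    rw [h2]; ring
  have hWN : W ^ N = (lmon (N • w) : Zqˣ) := by
    simp [hW, lmon, AddMonoidAlgebra.single_pow]
  refine ⟨ρ ((∑ k ∈ range N, W ^ k) * B), ?_⟩
  rw [← AddMonoidAlgebra.coeff_inj]
  ext e
  have h1 : A.coeff e = (ρ A).coeff e := by
    rw [hρ]
    split_ifs with hl
    · rfl
    · by_contra hne
      exact hl (Finset.mem_image_of_mem _ (Finsupp.mem_support_iff.2 hne))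
  have h2 : ∀ C : Zq, ((1 - T) * ρ C).coeff e = (ρ ((1 - T) * C)).coeff e := by
    intro C
    rw [hρ, sub_mul, one_mul, sub_mul, one_mul, AddMonoidAlgebra.coeff_sub,
      AddMonoidAlgebra.coeff_sub, Finsupp.sub_apply, Finsupp.sub_apply, hT, hmul, hmul, hρ, hρ]
    have : l (-t + e) = l e := by simp [ht]
    rw [this]
    split_ifs <;> simp
  rw [h2, h1, hρ, hρ]
  split_ifs with hl
  · conv_lhs => rw [e1]
    rw [AddMonoidAlgebra.coeff_add, Finsupp.add_apply, hWN, hmul]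
    have : A.coeff (-(N • w) + e) = 0 := by
      by_contra hne
      refine hN _ (Finset.mem_image_of_mem l (Finsupp.mem_support_iff.2 hne)) _ hl ?_
      rw [map_add, map_neg, map_nsmul, nsmul_eq_mul]
      ring
    rw [this, zero_add]
  · rfl

lemma lC_dvd_iff {n : ℕ} (α : Zq) (x : Laurent Zq (Fin n)) :
    lC α ∣ x ↔ ∀ e, α ∣ x.coeff e := by
  constructor
  · rintro ⟨y, rfl⟩ e
    rw [lC_apply, AddMonoidAlgebra.coeff_single_zero_mul]
    exact dvd_mul_right _ _
  · intro h
    rw [← AddMonoidAlgebra.sum_coeff_single x]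
    refine Finset.dvd_sum fun e _ => ?_
    obtain ⟨y, hy⟩ := h e
    refine ⟨AddMonoidAlgebra.single e y, ?_⟩
    rw [lC_apply, AddMonoidAlgebra.single_mul_single, hy, zero_add]

/-- `∏ (q₃^i - 1)` is prime to `∏ (q₁^j - 1)` in Laurent polynomial rings over
`ℤ[q₁^{±1}, q₂^{±1}]`. -/
lemma prod_col_dvd_of_dvd_mul {n : ℕ} (s t : ℕ) {x : Laurent Zq (Fin n)}
    (h : lC (∏ i ∈ range s, ((zcol 2 : Zq) ^ (i + 1) - 1)) ∣
      lC (∏ j ∈ range t, ((zcol 0 : Zq) ^ (j + 1) - 1)) * x) :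
    lC (∏ i ∈ range s, ((zcol 2 : Zq) ^ (i + 1) - 1)) ∣ x := by
  have base : ∀ (i j : ℕ) (A : Zq), ((zcol 2 : Zq) ^ (i + 1) - 1) ∣ ((zcol 0 : Zq) ^ (j + 1) - 1) * A →
      ((zcol 2 : Zq) ^ (i + 1) - 1) ∣ A := by
    intro i j A hA
    -- The difference of the exponents of `q₁` and `q₂` vanishes on `q₃`, but not on `q₁`.
    let l : (Fin 2 → ℤ) →+ ℤ :=
      (Pi.evalAddMonoidHom (fun _ : Fin 2 => ℤ) 0) - (Pi.evalAddMonoidHom (fun _ : Fin 2 => ℤ) 1)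
    have h2 : (zcol 2 : Zq) ^ (i + 1) = (lmon ((i + 1) • ![-1, -1]) : Zqˣ) := by
      simp only [zcol, lmon, Matrix.cons_val]
      rw [AddMonoidAlgebra.single_pow, one_pow]
    have h0 : (zcol 0 : Zq) ^ (j + 1) = (lmon ((j + 1) • ![1, 0]) : Zqˣ) := by
      simp only [zcol, lmon, Matrix.cons_val]
      rw [AddMonoidAlgebra.single_pow, one_pow]
    rw [← neg_dvd, neg_sub] at hA ⊢
    rw [h2] at hA ⊢
    refine one_sub_dvd_of_dvd_mul l _ ((j + 1) • ![1, 0]) ?_ ?_ ?_ (A := A)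
    · simp [l]
    · simp [l]
    · rw [← h0, ← neg_sub _ (1 : Zq), ← neg_sub ((zcol 0 : Zq) ^ (j + 1)) (1 : Zq), neg_mul,
        dvd_neg, neg_sub]
      exact hA
  have base' : ∀ (i j : ℕ) (x : Laurent Zq (Fin n)), lC ((zcol 2 : Zq) ^ (i + 1) - 1) ∣
      lC ((zcol 0 : Zq) ^ (j + 1) - 1) * x → lC ((zcol 2 : Zq) ^ (i + 1) - 1) ∣ x := by
    intro i j x hx
    rw [lC_dvd_iff] at hx ⊢
    intro e
    have := hx e
    rw [lC_apply, AddMonoidAlgebra.coeff_single_zero_mul] at this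
    exact base i j _ this
  have ne : ∀ i : ℕ, (zcol 2 : Zq) ^ (i + 1) - 1 ≠ 0 := by
    intro i hi
    have h1 := congrArg (coefHom Kq) hi
    rw [map_sub, map_pow, coefHom_zcol, map_one, map_zero, sub_eq_zero] at h1
    exact fcol_pow_ne_one 2 (Nat.succ_ne_zero i) h1
  have step : ∀ (i t : ℕ) (x : Laurent Zq (Fin n)), lC ((zcol 2 : Zq) ^ (i + 1) - 1) ∣
      lC (∏ j ∈ range t, ((zcol 0 : Zq) ^ (j + 1) - 1)) * x →
      lC ((zcol 2 : Zq) ^ (i + 1) - 1) ∣ x := by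
    intro i t
    induction t with
    | zero => intro x hx; simpa using hx
    | succ t ih =>
      intro x hx
      rw [Finset.prod_range_succ, map_mul, mul_assoc] at hx
      exact base' _ _ _ (ih _ hx)
  induction s generalizing x with
  | zero => simp
  | succ s ih =>
    rw [Finset.prod_range_succ, map_mul] at h ⊢
    obtain ⟨y, rfl⟩ := ih (dvd_of_mul_right_dvd h)
    refine mul_dvd_mul_left _ (step s t y ?_)
    rw [mul_left_comm] at h
    refine (mul_dvd_mul_iff_left ?_).1 h
    rw [map_ne_zero_iff _ (show Function.Injective (lC : Zq →+* Laurent Zq (Fin n)) from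
      AddMonoidAlgebra.single_right_injective), Finset.prod_ne_zero_iff]
    exact fun i _ => ne i

/-! ### Twisted convolution of set functions -/

/-- The functions on the finite subsets of `I`, with the product twisted by `κ`. A symmetric
rational function `R` and a family `v` of points give the set function `S ↦ R(v_i : i ∈ S)`, and
for `κ i j = ζ(v_i / v_j)` the twisted convolution corresponds to the shuffle product. -/
def Tw {I F : Type} (_ : I → I → F) : Type := Finset I → F

/-- The product of all `κ i j` with `i ∈ U` and `j ∈ V`. -/
def cross {I F : Type} [Field F] (κ : I → I → F) (U V : Finset I) : F := ∏ i ∈ U, ∏ j ∈ V, κ i j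

namespace Tw

variable {I F : Type} [DecidableEq I] [Field F] {κ : I → I → F}

lemma cross_union_left {U U' V : Finset I} (h : Disjoint U U') :
    cross κ (U ∪ U') V = cross κ U V * cross κ U' V := by
  simp only [cross, Finset.prod_union h]

lemma cross_union_right {U V V' : Finset I} (h : Disjoint V V') :
    cross κ U (V ∪ V') = cross κ U V * cross κ U V' := by
  simp only [cross, Finset.prod_union h, Finset.prod_mul_distrib]

instance : AddCommGroup (Tw κ) := inferInstanceAs (AddCommGroup (Finset I → F))
instance : Module F (Tw κ) := inferInstanceAs (Module F (Finset I → F))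

@[ext] lemma ext {f g : Tw κ} (h : ∀ S, f S = g S) : f = g := funext h

lemma add_apply (f g : Tw κ) (S : Finset I) : (f + g) S = f S + g S := rfl
lemma sub_apply (f g : Tw κ) (S : Finset I) : (f - g) S = f S - g S := rfl
lemma zero_apply (S : Finset I) : (0 : Tw κ) S = 0 := rfl
lemma smul_apply (r : F) (f : Tw κ) (S : Finset I) : (r • f) S = r * f S := rfl

/-- The value at `S`, as an additive map. -/
def evalHom (S : Finset I) : Tw κ →+ F where
  toFun f := f S
  map_zero' := rfl
  map_add' _ _ := rfl

lemma sum_apply {ι : Type*} (s : Finset ι) (f : ι → Tw κ) (S : Finset I) :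
    (∑ k ∈ s, f k) S = ∑ k ∈ s, f k S := map_sum (evalHom S) f s

instance : Mul (Tw κ) :=
  ⟨fun f g S => ∑ U ∈ S.powerset, f U * g (S \ U) * cross κ U (S \ U)⟩

lemma mul_apply (f g : Tw κ) (S : Finset I) :
    (f * g) S = ∑ U ∈ S.powerset, f U * g (S \ U) * cross κ U (S \ U) := rfl

instance : One (Tw κ) := ⟨fun S => if S = ∅ then 1 else 0⟩

lemma one_apply (S : Finset I) : (1 : Tw κ) S = if S = ∅ then 1 else 0 := rfl

lemma mul_assoc_aux (f g h : Tw κ) : f * g * h = f * (g * h) := by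
  ext S
  simp only [mul_apply, Finset.sum_mul, Finset.mul_sum]
  rw [Finset.sum_sigma', Finset.sum_sigma']
  refine Finset.sum_bij' (fun x _ => ⟨x.2, x.1 \ x.2⟩) (fun x _ => ⟨x.1 ∪ x.2, x.1⟩) ?_ ?_ ?_ ?_ ?_
  · rintro ⟨U, V⟩ hx
    simp only [mem_sigma, mem_powerset] at hx ⊢
    exact ⟨hx.2.trans hx.1, Finset.sdiff_subset_sdiff hx.1 subset_rfl⟩
  · rintro ⟨V, W⟩ hx
    simp only [mem_sigma, mem_powerset] at hx ⊢
    exact ⟨Finset.union_subset hx.1 (hx.2.trans sdiff_subset), subset_union_left⟩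
  · rintro ⟨U, V⟩ hx
    simp only [mem_sigma, mem_powerset] at hx
    simp [Finset.union_sdiff_of_subset hx.2]
  · rintro ⟨V, W⟩ hx
    simp only [mem_sigma, mem_powerset] at hx
    have : Disjoint V W := Finset.disjoint_of_subset_right hx.2 Finset.disjoint_sdiff
    simp [Finset.union_sdiff_cancel_left this]
  · rintro ⟨U, V⟩ hx
    simp only [mem_sigma, mem_powerset] at hx
    obtain ⟨hU, hV⟩ := hx
    have h1 : (S \ V) \ (U \ V) = S \ U := by
      ext x
      simp only [mem_sdiff]
      constructor
      · tauto
      · rintro ⟨h1, h2⟩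
        exact ⟨⟨h1, fun h => h2 (hV h)⟩, fun h => h2 h.1⟩
    have h2 : S \ V = (U \ V) ∪ (S \ U) := by
      ext x
      simp only [mem_sdiff, mem_union]
      constructor
      · tauto
      · rintro (h | h)
        · exact ⟨hU h.1, h.2⟩
        · exact ⟨h.1, fun h' => h.2 (hV h')⟩
    have h3 : cross κ U (S \ U) = cross κ V (S \ U) * cross κ (U \ V) (S \ U) := by
      conv_lhs => rw [← Finset.union_sdiff_of_subset hV]
      rw [cross_union_left Finset.disjoint_sdiff, Finset.union_sdiff_of_subset hV]
    have h4 : cross κ V (S \ V) = cross κ V (U \ V) * cross κ V (S \ U) := by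
      rw [h2, cross_union_right]
      exact Finset.disjoint_of_subset_left sdiff_subset Finset.disjoint_sdiff
    simp only [h1]
    rw [h3, h4]
    ring

instance : Ring (Tw κ) where
  __ := (inferInstance : AddCommGroup (Tw κ))
  mul_assoc := mul_assoc_aux
  zero_mul f := by ext S; simp [mul_apply, zero_apply]
  mul_zero f := by ext S; simp [mul_apply, zero_apply]
  left_distrib f g h := by
    ext S; simp only [mul_apply, add_apply, mul_add, add_mul, Finset.sum_add_distrib]
  right_distrib f g h := by
    ext S; simp only [mul_apply, add_apply, add_mul, Finset.sum_add_distrib]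
  one_mul f := by
    ext S
    rw [mul_apply, Finset.sum_eq_single ∅]
    · simp [one_apply, cross]
    · intro U _ hU; simp [one_apply, hU]
    · simp
  mul_one f := by
    ext S
    rw [mul_apply, Finset.sum_eq_single S]
    · simp [one_apply, cross]
    · intro U hU hne
      have : S \ U ≠ ∅ := by
        intro h
        exact hne (subset_antisymm (mem_powerset.1 hU) (sdiff_eq_empty_iff_subset.1 h))
      simp [one_apply, this]
    · simp

lemma smul_mul' (r : F) (f g : Tw κ) : r • f * g = r • (f * g) := by
  ext S; simp only [mul_apply, smul_apply, Finset.mul_sum, mul_assoc]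

lemma mul_smul' (r : F) (f g : Tw κ) : f * r • g = r • (f * g) := by
  ext S; simp only [mul_apply, smul_apply, Finset.mul_sum]
  exact Finset.sum_congr rfl fun _ _ => by ring

instance : Algebra F (Tw κ) := Algebra.ofModule smul_mul' mul_smul'

instance [CharZero F] : Module ℚ (Tw κ) := Module.compHom _ (algebraMap ℚ F)

lemma rat_smul_apply [CharZero F] (r : ℚ) (f : Tw κ) (S : Finset I) :
    (r • f) S = (r : F) * f S := rfl

lemma card_add {S U : Finset I} (h : U ⊆ S) : #U + #(S \ U) = #S := by
  rw [add_comm]; exact card_sdiff_add_card_eq_card h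

/-- Multiplication of the values on sets of size `m` by `w m`. -/
def scale (w : ℕ → F) (f : Tw κ) : Tw κ := fun S => w #S * f S

lemma scale_apply (w : ℕ → F) (f : Tw κ) (S : Finset I) : scale w f S = w #S * f S := rfl

lemma scale_add (w : ℕ → F) (f g : Tw κ) : scale w (f + g) = scale w f + scale w g := by
  ext S; simp only [scale_apply, add_apply, mul_add]

/-- The weight `m ↦ m` acts by a derivation. -/
lemma scale_natCast_mul (f g : Tw κ) :
    scale (fun m => (m : F)) (f * g) =
      scale (fun m => (m : F)) f * g + f * scale (fun m => (m : F)) g := by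
  ext S
  simp only [scale_apply, add_apply, mul_apply, Finset.mul_sum, ← Finset.sum_add_distrib]
  refine Finset.sum_congr rfl fun U hU => ?_
  rw [← card_add (mem_powerset.1 hU)]
  push_cast; ring

/-- A multiplicative weight acts by a ring homomorphism; it suffices that the weight is
multiplicative on the sizes of sets in the supports. -/
lemma scale_mul (w : ℕ → F) (a : ℕ) (hw : ∀ i j, a ∣ i → a ∣ j → w (i + j) = w i * w j)
    (f g : Tw κ) (hf : ∀ S, ¬ a ∣ #S → f S = 0) (hg : ∀ S, ¬ a ∣ #S → g S = 0) :
    scale w (f * g) = scale w f * scale w g := by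
  ext S
  simp only [scale_apply, mul_apply, Finset.mul_sum]
  refine Finset.sum_congr rfl fun U hU => ?_
  by_cases h1 : a ∣ #U
  · by_cases h2 : a ∣ #(S \ U)
    · rw [← card_add (mem_powerset.1 hU), hw _ _ h1 h2]; ring
    · rw [hg _ h2]; ring
  · rw [hf _ h1]; ring

lemma mul_supp {a : ℕ} {f g : Tw κ} (hf : ∀ S, ¬ a ∣ #S → f S = 0)
    (hg : ∀ S, ¬ a ∣ #S → g S = 0) (S : Finset I) (hS : ¬ a ∣ #S) : (f * g) S = 0 := by
  rw [mul_apply]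
  refine Finset.sum_eq_zero fun U hU => ?_
  by_cases h1 : a ∣ #U
  · have h2 : ¬ a ∣ #(S \ U) := by
      intro h2; apply hS; rw [← card_add (mem_powerset.1 hU)]; exact dvd_add h1 h2
    rw [hg _ h2]; ring
  · rw [hf _ h1]; ring

lemma mul_empty (f g : Tw κ) : (f * g) ∅ = f ∅ * g ∅ := by
  simp [mul_apply, cross]

/-- The leading term of a product at `S`. -/
lemma mul_apply_split (f g : Tw κ) (S : Finset I) :
    (f * g) S = f S * g ∅ + ∑ U ∈ S.powerset.erase S, f U * g (S \ U) * cross κ U (S \ U) := by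
  rw [mul_apply, ← Finset.add_sum_erase _ _ (Finset.mem_powerset_self S)]
  simp [cross]

lemma mul_right_cancel_of_empty {f h g : Tw κ} (hg : g ∅ ≠ 0) (e : f * g = h * g) : f = h := by
  ext S
  induction S using Finset.strongInduction with
  | H S ih =>
    have := congrFun e S
    rw [mul_apply_split, mul_apply_split] at this
    have h2 : ∑ U ∈ S.powerset.erase S, f U * g (S \ U) * cross κ U (S \ U) =
        ∑ U ∈ S.powerset.erase S, h U * g (S \ U) * cross κ U (S \ U) := by
      refine Finset.sum_congr rfl fun U hU => ?_
      rw [ih U]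
      rw [mem_erase, mem_powerset] at hU
      exact hU.2.ssubset_of_ne hU.1
    rw [h2] at this
    exact mul_right_cancel₀ hg (add_right_cancel this)

lemma pow_apply_of_card_lt {f : Tw κ} (hf : f ∅ = 0) (k : ℕ) (S : Finset I) (h : #S < k) :
    (f ^ k) S = 0 := by
  induction k generalizing S with
  | zero => omega
  | succ k ih =>
    rw [pow_succ, mul_apply]
    refine Finset.sum_eq_zero fun U hU => ?_
    rw [mem_powerset] at hU
    by_cases hUS : S \ U = ∅
    · rw [hUS, hf]; ring
    · have h1 := card_add hU
      have h2 : 0 < #(S \ U) := card_pos.2 (nonempty_iff_ne_empty.2 hUS)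
      rw [ih U (by omega)]; ring

lemma isNilpotent_of_empty [Fintype I] {f : Tw κ} (hf : f ∅ = 0) : f ^ (Fintype.card I + 1) = 0 := by
  ext S
  exact pow_apply_of_card_lt hf _ S (Nat.lt_succ_of_le (card_le_univ S))

/-- Uniqueness for the differential equation `N f = g f`, where `N` multiplies by the size. -/
lemma eq_of_scale_eq_mul [CharZero F] {f h g : Tw κ} (hg : g ∅ = 0) (h0 : f ∅ = h ∅)
    (hf : scale (fun m => (m : F)) f = g * f) (hh : scale (fun m => (m : F)) h = g * h) :
    f = h := by
  ext S
  induction S using Finset.strongInduction with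
  | H S ih =>
    by_cases hS : S = ∅
    · rw [hS, h0]
    have e1 := congrFun hf S
    have e2 := congrFun hh S
    rw [scale_apply, mul_apply] at e1 e2
    have h2 : ∑ U ∈ S.powerset, g U * f (S \ U) * cross κ U (S \ U) =
        ∑ U ∈ S.powerset, g U * h (S \ U) * cross κ U (S \ U) := by
      refine Finset.sum_congr rfl fun U hU => ?_
      by_cases hU0 : U = ∅
      · rw [hU0, hg]; ring
      · rw [ih]
        rw [mem_powerset] at hU
        exact sdiff_ssubset hU (nonempty_iff_ne_empty.2 hU0)
    have hc : (#S : F) ≠ 0 := by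
      rw [Nat.cast_ne_zero]; exact (card_pos.2 (nonempty_iff_ne_empty.2 hS)).ne'
    apply mul_left_cancel₀ hc
    rw [e1, e2, h2]

/-- The exponential solves the differential equation `N f = (N g) f`, if `g` and `N g` commute. -/
lemma scale_exp [CharZero F] [Fintype I] {g : Tw κ} (hg : g ∅ = 0)
    (hc : Commute (scale (fun m => (m : F)) g) g) :
    scale (fun m => (m : F)) (IsNilpotent.exp g) =
      scale (fun m => (m : F)) g * IsNilpotent.exp g := by
  set N : Tw κ → Tw κ := scale (fun m => (m : F)) with hN
  have hpow : ∀ k : ℕ, N (g ^ (k + 1)) = ((k + 1 : ℕ) : F) • (N g * g ^ k) := by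
    intro k
    induction k with
    | zero => simp
    | succ k ih =>
      rw [pow_succ g (k + 1), hN, scale_natCast_mul, ← hN, ih, smul_mul', mul_assoc, ← pow_succ,
        ← (hc.pow_right (k + 1)).eq, Nat.cast_succ (k + 1), add_smul, one_smul]
  have h1 := IsNilpotent.exp_eq_sum (isNilpotent_of_empty hg)
  -- One more, vanishing, summand balances the shift of the powers by the derivation.
  have h2 : IsNilpotent.exp g = ∑ i ∈ range (Fintype.card I + 2), (i.factorial : ℚ)⁻¹ • g ^ i := by
    rw [Finset.sum_range_succ, isNilpotent_of_empty hg, smul_zero, add_zero, h1]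
  conv_lhs => rw [h2]
  rw [Finset.sum_range_succ', h1]
  ext S
  have hN1 : N ((Nat.factorial 0 : ℚ)⁻¹ • g ^ 0) S = 0 := by
    rw [hN, scale_apply, rat_smul_apply, pow_zero, one_apply]
    split_ifs with h <;> simp [h]
  rw [hN, scale_add, ← hN, add_apply, hN1, add_zero, Finset.mul_sum, hN, scale_apply, sum_apply,
    sum_apply, Finset.mul_sum]
  refine Finset.sum_congr rfl fun k _ => ?_
  have h3 := congrFun (hpow k) S
  rw [hN, scale_apply, smul_apply] at h3
  have h4 : scale (fun m => (m : F)) g * (k.factorial : ℚ)⁻¹ • g ^ k =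
      ((k.factorial : ℚ)⁻¹ : ℚ) • (scale (fun m => (m : F)) g * g ^ k) := mul_smul' _ _ _
  rw [h4, rat_smul_apply, rat_smul_apply, mul_left_comm, h3, Nat.factorial_succ, ← mul_assoc]
  congr 1
  have : ((k + 1 : ℕ) : F) ≠ 0 := Nat.cast_ne_zero.2 (Nat.succ_ne_zero k)
  push_cast at this ⊢
  field_simp

/-- The part of a set function on sets of size `m`. -/
def part (m : ℕ) (f : Tw κ) : Tw κ := fun S => if #S = m then f S else 0

lemma part_apply (m : ℕ) (f : Tw κ) (S : Finset I) : part m f S = if #S = m then f S else 0 := rfl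

end Tw

/-! ### Sums over orderings -/

section Zeta

variable {F : Type} [Field F] [Algebra Kq F]

/-- The function `ζ(x) / (1 - 1/(x q_c))`: the factor of the shuffle kernel between two neighbouring
variables, after division by the denominator `1 - z_{i+1}/(z_i q_c)`. -/
def zred (c : Fin 3) (x : F) : F :=
  (fcol F 2 : F)⁻¹ * fcol F c * (1 - x * fcol F (c + 1)) * (1 - x * fcol F (c + 2)) / (1 - x)

lemma zeta_eq {x : F} (hx : x ≠ 0) : zeta x = -((fcol F 2 : F)⁻¹ * x⁻¹) *
    ((1 - x * fcol F 0) * (1 - x * fcol F 1) * (1 - x * fcol F 2)) / (1 - x) := by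
  have h := congrArg Units.val (fcol_prod (F := F) 0)
  simp only [zero_add, Units.val_mul, Units.val_one] at h
  have h2 : algebraMap Kq F (q1 * q2) = (fcol F 0 : F) * fcol F 1 := by
    rw [map_mul]; rfl
  have h3 : (fcol F 0 : F) * fcol F 1 = (fcol F 2 : F)⁻¹ :=
    eq_inv_of_mul_eq_one_left h
  rw [zeta, h2, h3]
  have h0 : (fcol F 2 : F) ≠ 0 := (fcol F 2).ne_zero
  change (1 - x * (fcol F 0 : F)) * (1 - x * (fcol F 1 : F)) * _ / _ = _
  congr 1
  field_simp
  ring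

lemma zeta_eq_col (c : Fin 3) {x : F} (hx : x ≠ 0) : zeta x = -((fcol F 2 : F)⁻¹ * x⁻¹) *
    ((1 - x * fcol F c) * (1 - x * fcol F (c + 1)) * (1 - x * fcol F (c + 2))) / (1 - x) := by
  rw [zeta_eq hx]
  congr 2
  fin_cases c
  · rfl
  · change _ = (1 - x * (fcol F 1 : F)) * (1 - x * (fcol F 2 : F)) * (1 - x * (fcol F 0 : F)); ring
  · change _ = (1 - x * (fcol F 2 : F)) * (1 - x * (fcol F 0 : F)) * (1 - x * (fcol F 1 : F)); ring

lemma zeta_eq_zred (c : Fin 3) {x : F} (hx : x ≠ 0) :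
    zeta x = zred c x * (1 - (x * fcol F c)⁻¹) := by
  rw [zeta_eq_col c hx, zred]
  have h0 : (fcol F 2 : F) ≠ 0 := (fcol F 2).ne_zero
  have h1 : (fcol F c : F) ≠ 0 := (fcol F c).ne_zero
  rw [div_mul_eq_mul_div]
  congr 1
  field_simp
  ring

lemma zeta_eq_zero (c : Fin 3) {x : F} (hx : x * fcol F c = 1) : zeta x = 0 := by
  have h0 : x ≠ 0 := left_ne_zero_of_mul_eq_one hx
  rw [zeta_eq_col c h0, hx]; simp

lemma zred_eq_zero {c c' : Fin 3} (hc : c' ≠ c) {x : F} (hx : x * fcol F c' = 1) :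
    zred c x = 0 := by
  have : c' = c + 1 ∨ c' = c + 2 := by clear hx; revert c c'; decide
  rcases this with rfl | rfl <;> simp [zred, hx]

lemma fcol_third {α β : Fin 3} (h : α ≠ β) :
    ∃ γ, γ ≠ α ∧ γ ≠ β ∧ fcol F α * fcol F β * fcol F γ = 1 := by
  have : β = α + 1 ∨ β = α + 2 := by revert α β; decide
  rcases this with rfl | rfl
  · exact ⟨α + 2, by revert α; decide, by revert α; decide, fcol_prod α⟩
  · refine ⟨α + 1, by revert α; decide, by revert α; decide, ?_⟩
    rw [mul_right_comm]; exact fcol_prod α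

/-- The kernel between the variables in positions `i < j` of an ordering. -/
def link (c : Fin 3) (i j : ℕ) (x : F) : F := if i + 1 = j then zred c x else zeta x

lemma link_eq_zero {c c' : Fin 3} {i j : ℕ} (h : c' = c → i + 1 ≠ j) {x : F}
    (hx : x * fcol F c' = 1) : link c i j x = 0 := by
  rw [link]
  split_ifs with h1
  · exact zred_eq_zero (fun h2 => h h2 h1) hx
  · exact zeta_eq_zero c' hx

end Zeta

section Orderings

variable {I : Type} [Fintype I] [DecidableEq I]

/-- The orderings of a set `S` of size `m`. -/
def ords (m : ℕ) (S : Finset I) : Finset (Fin m ↪ I) := univ.filter fun o => univ.map o = S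

lemma mem_ords {m : ℕ} {S : Finset I} {o : Fin m ↪ I} : o ∈ ords m S ↔ univ.map o = S := by
  simp [ords]

lemma ords_card {m : ℕ} {S : Finset I} (h : #S ≠ m) : ords m S = ∅ := by
  rw [Finset.eq_empty_iff_forall_notMem]
  intro o ho
  rw [mem_ords] at ho
  apply h
  rw [← ho, card_map, card_univ, Fintype.card_fin]

/-- An ordering of `S` is an ordering of a subset followed by one of the complement. -/
lemma sum_ords_split {A : Type*} [AddCommMonoid A] (n m : ℕ) (S : Finset I)
    (Φ : (Fin n ↪ I) → (Fin m ↪ I) → A) :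
    ∑ U ∈ S.powerset, ∑ o₁ ∈ ords n U, ∑ o₂ ∈ ords m (S \ U), Φ o₁ o₂ =
      ∑ o ∈ ords (n + m) S, Φ ((Fin.castAddEmb m).trans o) ((Fin.natAddEmb n).trans o) := by
  symm
  simp only [Finset.sum_sigma']
  have huniv : (univ : Finset (Fin (n + m))) =
      univ.map (Fin.castAddEmb m) ∪ univ.map (Fin.natAddEmb n) := by
    ext x
    simp only [mem_univ, mem_union, mem_map, true_and, true_iff]
    induction x using Fin.addCases with
    | left i => exact Or.inl ⟨i, rfl⟩
    | right i => exact Or.inr ⟨i, rfl⟩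
  refine Finset.sum_bij
    (fun o _ => ⟨univ.map ((Fin.castAddEmb m).trans o), (Fin.castAddEmb m).trans o,
      (Fin.natAddEmb n).trans o⟩) ?_ ?_ ?_ ?_
  · intro o ho
    rw [mem_ords] at ho
    simp only [mem_sigma, mem_powerset, mem_ords, true_and]
    rw [huniv, Finset.map_union, Finset.map_map, Finset.map_map] at ho
    have hd : Disjoint (univ.map ((Fin.castAddEmb m).trans o))
        (univ.map ((Fin.natAddEmb n).trans o)) := by
      rw [Finset.disjoint_left]
      intro x hx hx'
      simp only [mem_map, mem_univ, true_and] at hx hx'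
      obtain ⟨i, rfl⟩ := hx
      obtain ⟨j, hj⟩ := hx'
      have := o.injective hj
      have := congrArg Fin.val this
      simp at this
      omega
    refine ⟨ho ▸ subset_union_left, ?_⟩
    rw [← ho, Finset.union_sdiff_cancel_left hd]
  · intro o _ o' _ h
    simp only [Sigma.mk.injEq] at h
    obtain ⟨-, h⟩ := h
    have h := Sigma.mk.inj (eq_of_heq h)
    obtain ⟨h1, h2⟩ := h
    have h2 := eq_of_heq h2
    ext x
    induction x using Fin.addCases with
    | left i => exact DFunLike.congr_fun h1 i
    | right i => exact DFunLike.congr_fun h2 i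
  · rintro ⟨U, o₁, o₂⟩ h
    simp only [mem_sigma, mem_powerset, mem_ords] at h
    obtain ⟨hU, h1, h2⟩ := h
    have hinj : Function.Injective (Fin.append o₁ o₂) := by
      intro x y hxy
      have hne : ∀ i j, o₁ i ≠ o₂ j := by
        intro i j hij
        have h3 : o₁ i ∈ U := h1 ▸ Finset.mem_map_of_mem _ (mem_univ _)
        have h4 : o₂ j ∈ S \ U := h2 ▸ Finset.mem_map_of_mem _ (mem_univ _)
        rw [← hij] at h4
        exact (mem_sdiff.1 h4).2 h3
      induction x using Fin.addCases with
      | left i =>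
        induction y using Fin.addCases with
        | left j => simp only [Fin.append_left] at hxy; rw [o₁.injective hxy]
        | right j => simp only [Fin.append_left, Fin.append_right] at hxy; exact absurd hxy (hne _ _)
      | right i =>
        induction y using Fin.addCases with
        | left j =>
          simp only [Fin.append_left, Fin.append_right] at hxy; exact absurd hxy.symm (hne _ _)
        | right j => simp only [Fin.append_right] at hxy; rw [o₂.injective hxy]
    have e1 : (Fin.castAddEmb m).trans ⟨Fin.append o₁ o₂, hinj⟩ = o₁ := by ext i; simp
    have e2 : (Fin.natAddEmb n).trans ⟨Fin.append o₁ o₂, hinj⟩ = o₂ := by ext i; simp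
    refine ⟨⟨Fin.append o₁ o₂, hinj⟩, ?_, ?_⟩
    · rw [mem_ords, huniv, Finset.map_union, Finset.map_map, Finset.map_map, e1, e2, h1, h2,
        Finset.union_sdiff_of_subset hU]
    · rw [e1, e2, h1]
  · intro o _; rfl

end Orderings

section M

variable {I : Type} [Fintype I] [DecidableEq I] {F : Type} [Field F] [Algebra Kq F]

/-- The shuffle kernel at the points `v`. -/
def kap (v : I → Fˣ) (i j : I) : F := zeta ((v i / v j : Fˣ) : F)

/-- The monomial with exponents `d` at the points `v ∘ o`, times the shuffle kernels between
neighbours (reduced) and between other points. -/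
def wt (c : Fin 3) (d : ℕ → ℤ) (v : I → Fˣ) {m : ℕ} (o : Fin m → I) : F :=
  ((∏ i : Fin m, v (o i) ^ d i : Fˣ) : F) *
    ∏ i : Fin m, ∏ j : Fin m, if i < j then link c i j ((v (o i) / v (o j) : Fˣ) : F) else 1

/-- The set function of
`Sym [z_1^{d_0} ⋯ z_m^{d_{m-1}} / ∏ (1 - z_{i+1}/(z_i q_c)) · ∏_{i<j} ζ(z_i/z_j)]`. -/
def M (c : Fin 3) (m : ℕ) (d : ℕ → ℤ) (v : I → Fˣ) : Tw (kap v) :=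
  fun S => ∑ o ∈ ords m S, wt c d v o

lemma M_apply (c : Fin 3) (m : ℕ) (d : ℕ → ℤ) (v : I → Fˣ) (S : Finset I) :
    M c m d v S = ∑ o ∈ ords m S, wt c d v o := rfl

lemma M_of_card_ne (c : Fin 3) {m : ℕ} (d : ℕ → ℤ) (v : I → Fˣ) {S : Finset I} (h : #S ≠ m) :
    M c m d v S = 0 := by
  rw [M_apply, ords_card h, Finset.sum_empty]

lemma M_zero (c : Fin 3) (d : ℕ → ℤ) (v : I → Fˣ) : M c 0 d v = 1 := by
  ext S
  rw [M_apply, Tw.one_apply]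
  split_ifs with h
  · have : ords 0 S = univ := by
      ext o
      simp only [mem_ords, h, mem_univ, iff_true]
      rfl
    rw [this, Fintype.sum_unique]
    simp [wt]
  · rw [ords_card, Finset.sum_empty]
    rw [Ne, card_eq_zero]; exact h

/-- Concatenation of exponent sequences, the first one of length `n`. -/
def app (n : ℕ) (d d' : ℕ → ℤ) (i : ℕ) : ℤ := if i < n then d i else d' (i - n)

/-- The exponents of `z_{n+1} / z_n`. -/
def jump (n : ℕ) (i : ℕ) : ℤ := (if i = n then 1 else 0) - (if i + 1 = n then 1 else 0)

/-- The weights of two orderings, multiplied by the kernel between them. At the place where the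
orderings meet, the full kernel `ζ(x)` is the reduced one times `1 - 1 / (x q_c)`, whose two summands
give the two weights of the concatenated ordering. -/
lemma wt_split (c : Fin 3) {n m : ℕ} (d d' : ℕ → ℤ) (v : I → Fˣ) (o : Fin (n + 1 + (m + 1)) ↪ I) :
    wt c d v ((Fin.castAddEmb (m + 1)).trans o) * wt c d' v ((Fin.natAddEmb (n + 1)).trans o) *
      cross (kap v) (univ.map ((Fin.castAddEmb (m + 1)).trans o))
        (univ.map ((Fin.natAddEmb (n + 1)).trans o)) =
    wt c (app (n + 1) d d') v o - (fcol F c : F)⁻¹ *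
      wt c (app (n + 1) d d' + jump (n + 1)) v o := by
  set x : Fˣ := v (o (Fin.castAdd (m + 1) (Fin.last n))) / v (o (Fin.natAdd (n + 1) 0)) with hx
  have hmon : (∏ i : Fin (n + 1 + (m + 1)), v (o i) ^ app (n + 1) d d' i) =
      (∏ i, v (o (Fin.castAdd (m + 1) i)) ^ d i) * ∏ i, v (o (Fin.natAdd (n + 1) i)) ^ d' i := by
    rw [Fin.prod_univ_add]
    congr 1
    · exact Finset.prod_congr rfl fun i _ => by
        rw [app, if_pos (by simp; omega), Fin.val_castAdd]
    · exact Finset.prod_congr rfl fun i _ => by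
        rw [app, if_neg (by simp; omega), Fin.val_natAdd, Nat.add_sub_cancel_left]
  have hjump : (∏ i : Fin (n + 1 + (m + 1)), v (o i) ^ (app (n + 1) d d' + jump (n + 1)) i) =
      (∏ i : Fin (n + 1 + (m + 1)), v (o i) ^ app (n + 1) d d' i) * x⁻¹ := by
    simp only [Pi.add_apply, zpow_add, Finset.prod_mul_distrib]
    congr 1
    simp only [jump, zpow_sub, Finset.prod_mul_distrib]
    rw [Finset.prod_eq_single (Fin.natAdd (n + 1) (0 : Fin (m + 1))), Finset.prod_inv_distrib,
      Finset.prod_eq_single (Fin.castAdd (m + 1) (Fin.last n))]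
    · simp [hx, div_eq_mul_inv]
    · intro b _ hb
      rw [if_neg, zpow_zero]
      intro h; apply hb; ext; simp; omega
    · simp
    · intro b _ hb
      rw [if_neg, zpow_zero]
      intro h; apply hb; ext; simp [h]
    · simp
  set K : F := ∏ i : Fin (n + 1 + (m + 1)), ∏ j : Fin (n + 1 + (m + 1)),
    if i < j then link c i j ((v (o i) / v (o j) : Fˣ) : F) else 1 with hK
  set K₁ : F := ∏ i : Fin (n + 1), ∏ j : Fin (n + 1), if i < j then link c i j
    ((v (o (Fin.castAdd (m + 1) i)) / v (o (Fin.castAdd (m + 1) j)) : Fˣ) : F) else 1 with hK₁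
  set K₂ : F := ∏ i : Fin (m + 1), ∏ j : Fin (m + 1), if i < j then link c i j
    ((v (o (Fin.natAdd (n + 1) i)) / v (o (Fin.natAdd (n + 1) j)) : Fˣ) : F) else 1 with hK₂
  set K₃ : F := ∏ i : Fin (n + 1), ∏ j : Fin (m + 1), link c i (n + 1 + j)
    ((v (o (Fin.castAdd (m + 1) i)) / v (o (Fin.natAdd (n + 1) j)) : Fˣ) : F) with hK₃
  have hKs : K = K₁ * K₃ * K₂ := by
    rw [hK, Fin.prod_univ_add]
    have hsp : ∀ f : Fin (n + 1 + (m + 1)) → F, ∏ j, f j =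
        (∏ j, f (Fin.castAdd (m + 1) j)) * ∏ j, f (Fin.natAdd (n + 1) j) := Fin.prod_univ_add
    simp only [hsp, Finset.prod_mul_distrib]
    rw [hK₁, hK₂, hK₃]
    congr 1
    · congr 1
      refine Finset.prod_congr rfl fun i _ => Finset.prod_congr rfl fun j _ => ?_
      rw [if_pos]
      · simp
      · rw [Fin.lt_def]; simp; omega
    · rw [Finset.prod_eq_one, one_mul]
      · refine Finset.prod_congr rfl fun i _ => Finset.prod_congr rfl fun j _ => ?_
        have h1 : (Fin.natAdd (n + 1) i < Fin.natAdd (n + 1) j) ↔ i < j := by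
          simp
        simp only [h1]
        congr 1
        simp only [link, Fin.val_natAdd]
        congr 1
        simp only [eq_iff_iff]
        omega
      · refine fun i _ => Finset.prod_eq_one fun j _ => ?_
        rw [if_neg]
        rw [Fin.lt_def]; simp; omega
  have hcross : cross (kap v) (univ.map ((Fin.castAddEmb (m + 1)).trans o))
        (univ.map ((Fin.natAddEmb (n + 1)).trans o)) = K₃ * (1 - ((x : F) * fcol F c)⁻¹) := by
    rw [cross, Finset.prod_map]
    simp only [Finset.prod_map]
    have h1 : ∀ (i : Fin (n + 1)) (j : Fin (m + 1)),
        kap v (((Fin.castAddEmb (m + 1)).trans o) i) (((Fin.natAddEmb (n + 1)).trans o) j) =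
        link c i (n + 1 + j)
          ((v (o (Fin.castAdd (m + 1) i)) / v (o (Fin.natAdd (n + 1) j)) : Fˣ) : F) *
        (if i = Fin.last n then (if j = 0 then (1 - ((x : F) * fcol F c)⁻¹) else 1) else 1) := by
      intro i j
      change zeta ((v (o (Fin.castAdd (m + 1) i)) / v (o (Fin.natAdd (n + 1) j)) : Fˣ) : F) = _
      by_cases hi : i = Fin.last n
      · by_cases hj : j = 0
        · subst hi hj
          rw [if_pos rfl, if_pos rfl, link, if_pos (by simp), hx, zeta_eq_zred c (Units.ne_zero _)]
        · rw [if_pos hi, if_neg hj, mul_one, link, if_neg]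
          intro h; apply hj; ext; simp [hi] at h ⊢; exact h
      · rw [if_neg hi, mul_one, link, if_neg]
        intro h; apply hi; ext; simp; omega
    simp only [h1, Finset.prod_mul_distrib]
    congr 1
    rw [Finset.prod_eq_single (Fin.last n)]
    · simp only [if_true]
      rw [Finset.prod_ite_eq' univ (0 : Fin (m + 1))]; simp
    · intro b _ hb; simp [hb]
    · simp
  have w1 : wt c d v ((Fin.castAddEmb (m + 1)).trans o) =
      ((∏ i, v (o (Fin.castAdd (m + 1) i)) ^ d i : Fˣ) : F) * K₁ := rfl
  have w2 : wt c d' v ((Fin.natAddEmb (n + 1)).trans o) =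
      ((∏ i, v (o (Fin.natAdd (n + 1) i)) ^ d' i : Fˣ) : F) * K₂ := rfl
  have w3 : ∀ D, wt c D v o = ((∏ i : Fin (n + 1 + (m + 1)), v (o i) ^ D i : Fˣ) : F) * K :=
    fun _ => rfl
  rw [w1, w2, w3, w3, hjump, hmon, hcross, hKs]
  push_cast
  rw [mul_inv]
  ring

/-- Sums over orderings are closed under multiplication, up to integral combinations. -/
lemma M_mul_M (c : Fin 3) {n m : ℕ} (hn : n ≠ 0) (hm : m ≠ 0) (d d' : ℕ → ℤ) (v : I → Fˣ) :
    M c n d v * M c m d' v = M c (n + m) (app n d d') v -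
      (fcol F c : F)⁻¹ • M c (n + m) (app n d d' + jump n) v := by
  obtain ⟨n, rfl⟩ := Nat.exists_eq_succ_of_ne_zero hn
  obtain ⟨m, rfl⟩ := Nat.exists_eq_succ_of_ne_zero hm
  ext S
  rw [Tw.mul_apply, Tw.sub_apply, Tw.smul_apply, M_apply, M_apply, Finset.mul_sum,
    ← Finset.sum_sub_distrib]
  have := sum_ords_split (n + 1) (m + 1) S (fun o₁ o₂ => wt c d v o₁ * wt c d' v o₂ *
    cross (kap v) (univ.map o₁) (univ.map o₂))
  simp only [wt_split] at this
  rw [← this]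
  refine Finset.sum_congr rfl fun U _ => ?_
  rw [M_apply, M_apply, Finset.sum_mul_sum, Finset.sum_mul]
  refine Finset.sum_congr rfl fun o₁ h1 => ?_
  rw [Finset.sum_mul]
  refine Finset.sum_congr rfl fun o₂ h2 => ?_
  rw [mem_ords.1 h1, mem_ords.1 h2]

/-- Relabelling of the points. -/
lemma M_map {I' : Type} [Fintype I'] [DecidableEq I'] (c : Fin 3) (m : ℕ) (d : ℕ → ℤ) (v : I → Fˣ)
    (g : I' ↪ I) (S : Finset I') : M c m d (v ∘ g) S = M c m d v (S.map g) := by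
  rw [M_apply, M_apply]
  refine Finset.sum_bij (fun o _ => o.trans g) ?_ ?_ ?_ ?_
  · intro o ho
    rw [mem_ords] at ho ⊢
    rw [← Finset.map_map, ho]
  · intro o _ o' _ h
    ext i
    exact g.injective (DFunLike.congr_fun h i)
  · intro o ho
    rw [mem_ords] at ho
    have : ∀ i, ∃ j, g j = o i := by
      intro i
      have : o i ∈ S.map g := ho ▸ mem_map_of_mem _ (mem_univ i)
      rw [mem_map] at this
      exact ⟨this.choose, this.choose_spec.2⟩
    choose f hf using this
    have hfi : Function.Injective f := by
      intro i j h; apply o.injective; rw [← hf, ← hf, h]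
    have he : Function.Embedding.trans ⟨f, hfi⟩ g = o := by ext i; exact hf i
    refine ⟨⟨f, hfi⟩, ?_, he⟩
    rw [mem_ords]
    apply Finset.map_injective g
    rw [Finset.map_map, he, ho]
  · intro o _; rfl

lemma M_homogeneous (c : Fin 3) (m : ℕ) (d : ℕ → ℤ) (v : I → Fˣ) (a : Fˣ) (S : Finset I) :
    M c m d (fun i => a * v i) S = ((a ^ (∑ i ∈ range m, d i) : Fˣ) : F) * M c m d v S := by
  rw [M_apply, M_apply, Finset.mul_sum]
  refine Finset.sum_congr rfl fun o _ => ?_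
  simp only [wt, mul_div_mul_left_eq_div, mul_zpow, Finset.prod_mul_distrib]
  rw [← Fin.sum_univ_eq_sum_range, Units.val_mul, ← mul_assoc]
  congr 3
  exact (map_sum (zpowersHom Fˣ a).toAdditiveRight _ _).symm

/-- An ordering that meets a point `x` before the point `x q_{c'}` has weight zero, unless the two
are neighbours and `c' = c`. -/
lemma wt_eq_zero {c c' : Fin 3} {d : ℕ → ℤ} {v : I → Fˣ} {m : ℕ} {o : Fin m → I} {i j : Fin m}
    (hij : i < j) (hc : c' = c → (i : ℕ) + 1 ≠ j) (h : v (o j) = fcol F c' * v (o i)) :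
    wt c d v o = 0 := by
  rw [wt]
  apply mul_eq_zero_of_right
  apply Finset.prod_eq_zero (mem_univ i)
  apply Finset.prod_eq_zero (mem_univ j)
  rw [if_pos hij]
  apply link_eq_zero (c' := c') hc
  rw [h, ← Units.val_mul]
  simp

/-- The wheel conditions. -/
lemma M_wheel (c : Fin 3) (m : ℕ) (d : ℕ → ℤ) (v : I → Fˣ) {α β : Fin 3} (hαβ : α ≠ β)
    {A B C : I} (hB : v B = fcol F α * v A) (hC : v C = fcol F β * v B) {S : Finset I}
    (hA' : A ∈ S) (hB' : B ∈ S) (hC' : C ∈ S) (hAB : A ≠ B) (hBC : B ≠ C) (hAC : A ≠ C) :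
    M c m d v S = 0 := by
  obtain ⟨γ, hγα, hγβ, hγ⟩ := fcol_third (F := F) hαβ
  have hA : v A = fcol F γ * v C := by
    rw [hC, hB, ← mul_assoc, ← mul_assoc]
    have : fcol F γ * fcol F β * fcol F α = 1 := by rw [← hγ]; ac_rfl
    rw [this, one_mul]
  rw [M_apply]
  refine Finset.sum_eq_zero fun o ho => ?_
  rw [mem_ords] at ho
  have hex : ∀ x ∈ S, ∃ i, o i = x := by
    intro x hx; rw [← ho, mem_map] at hx; simpa using hx
  obtain ⟨i, rfl⟩ := hex A hA'
  obtain ⟨j, rfl⟩ := hex B hB'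
  obtain ⟨k, rfl⟩ := hex C hC'
  by_contra hne
  -- In an ordering of non-zero weight, each of the three steps of the wheel goes backwards, or
  -- it goes forward by one place and has the colour `c`. The latter happens for at most one step,
  -- so the steps cannot add up to zero.
  have h1 : ¬ i < j ∨ (α = c ∧ (i : ℕ) + 1 = j) := by
    by_contra! h; exact hne (wt_eq_zero h.1 h.2 hB)
  have h2 : ¬ j < k ∨ (β = c ∧ (j : ℕ) + 1 = k) := by
    by_contra! h; exact hne (wt_eq_zero h.1 h.2 hC)
  have h3 : ¬ k < i ∨ (γ = c ∧ (k : ℕ) + 1 = i) := by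
    by_contra! h; exact hne (wt_eq_zero h.1 h.2 hA)
  have e1 : (i : ℕ) ≠ j := fun h => hAB (congrArg o (Fin.ext h))
  have e2 : (j : ℕ) ≠ k := fun h => hBC (congrArg o (Fin.ext h))
  have e3 : (i : ℕ) ≠ k := fun h => hAC (congrArg o (Fin.ext h))
  simp only [Fin.lt_def] at h1 h2 h3
  rcases h1 with h1 | ⟨h1, h1'⟩ <;> rcases h2 with h2 | ⟨h2, h2'⟩ <;> rcases h3 with h3 | ⟨h3, h3'⟩ <;>
    omega

/-- The value at a string of a colour different from `c`: only the reversed ordering contributes. The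
factor `∏ ζ(q^{j-i})` does not depend on `c`, nor on the exponents. -/
lemma M_string {c γ β : Fin 3} (hc : γ ≠ c) (hβγ : fcol F c * fcol F γ * fcol F β = 1)
    {n : ℕ} (d : ℕ → ℤ) (v : Fin (n + 1) → Fˣ) (x : Fˣ) (hv : ∀ i, v i = x * fcol F γ ^ (i : ℕ)) :
    M c (n + 1) d v univ * (1 - (fcol F β : F)) ^ n =
      ((∏ i : Fin (n + 1), v i.rev ^ d i : Fˣ) : F) *
        ∏ i : Fin (n + 1), ∏ j : Fin (n + 1), if i < j then
          zeta ((v i.rev / v j.rev : Fˣ) : F) else 1 := by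
  rw [M_apply, Finset.sum_eq_single Fin.revPerm.toEmbedding]
  · rw [wt, mul_assoc]
    congr 1
    have h1 : ∀ i j : Fin (n + 1),
        (if i < j then zeta ((v i.rev / v j.rev : Fˣ) : F) else 1) =
        (if i < j then link c i j ((v i.rev / v j.rev : Fˣ) : F) else 1) *
          (if (i : ℕ) + 1 = j then (1 - (fcol F β : F)) else 1) := by
      intro i j
      by_cases hij : i < j
      · rw [if_pos hij, if_pos hij, link]
        split_ifs with h
        · have hvv : v i.rev / v j.rev = fcol F γ := by
            rw [hv, hv, mul_div_mul_left_eq_div, ← zpow_natCast, ← zpow_natCast, div_eq_mul_inv,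
              ← zpow_sub]
            simp only [Fin.val_rev]
            have : ((n + 1 - (i + 1) : ℕ) : ℤ) - ((n + 1 - (j + 1) : ℕ) : ℤ) = 1 := by omega
            rw [this, zpow_one]
          rw [zeta_eq_zred c (Units.ne_zero _), hvv, ← Units.val_mul, ← Units.val_inv_eq_inv_val]
          congr 4
          rw [mul_comm (fcol F γ)]
          exact inv_eq_of_mul_eq_one_right hβγ
        · rw [mul_one]
      · rw [if_neg hij, if_neg hij, if_neg, mul_one]
        intro h; apply hij; rw [Fin.lt_def]; omega
    simp only [h1, Finset.prod_mul_distrib]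
    congr 1
    symm
    rw [Fin.prod_univ_castSucc]
    have h2 : ∀ i : Fin n, (∏ j : Fin (n + 1),
        if ((Fin.castSucc i : Fin (n + 1)) : ℕ) + 1 = j then (1 - (fcol F β : F)) else 1) =
          1 - (fcol F β : F) := by
      intro i
      rw [Finset.prod_eq_single i.succ]
      · simp
      · intro j _ hj; rw [if_neg]; intro h; apply hj; ext; simp at h ⊢; exact h.symm
      · simp
    simp only [h2]
    rw [Finset.prod_const, card_univ, Fintype.card_fin, Finset.prod_eq_one, mul_one]
    intro j _; rw [if_neg]; simp; omega
  · intro o _ ho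
    by_contra hne
    apply ho
    have hbij : Function.Bijective o := Finite.injective_iff_bijective.1 o.injective
    let e : Fin (n + 1) ≃ Fin (n + 1) := Equiv.ofBijective o hbij
    have he : ∀ i, o i = e i := fun i => rfl
    have hanti : StrictAnti e.symm := by
      rw [Fin.strictAnti_iff_succ_lt]
      intro k
      by_contra hk
      have hlt : e.symm k.castSucc < e.symm k.succ := by
        refine lt_of_le_of_ne (not_lt.1 hk) fun h => ?_
        have := congrArg Fin.val (e.symm.injective h)
        simp at this
      -- The points `k` and `k + 1` of the string, met in this order, give the factor zero.
      refine hne (wt_eq_zero (c' := γ) hlt (fun h => absurd h hc) ?_)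
      rw [he, he, e.apply_symm_apply, e.apply_symm_apply, hv, hv]
      simp [pow_succ]; ac_rfl
    have hmono : StrictMono fun i => e.symm (Fin.rev i) := fun i j h =>
      hanti (Fin.rev_lt_rev.2 h)
    have hsub : ∀ f : Fin (n + 1) ≃o Fin (n + 1), ∀ i, f i = i := by
      intro f i
      have : f = OrderIso.refl _ := Subsingleton.elim _ _
      rw [this]; rfl
    have hid := hsub (StrictMono.orderIsoOfSurjective _ hmono
      (e.symm.surjective.comp Fin.rev_surjective))
    ext i
    have h3 : e.symm (Fin.rev i) = i := hid i
    have h4 : e i = Fin.rev i := by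
      conv_lhs => rw [← h3]
      rw [e.apply_symm_apply]
    rw [he, h4]; rfl
  · intro h
    exfalso; apply h
    rw [mem_ords]
    ext i; simp

end M

/-! ### Laurent polynomials that represent the sums over orderings -/

/-- The parameters as units of a Laurent polynomial ring. -/
def lcol {n : ℕ} (c : Fin 3) : (Laurent Zq (Fin n))ˣ :=
  Units.map (lC : Zq →+* Laurent Zq (Fin n)) (zcol c)

/-- The linear factor `y - x q_c`. -/
def lin {n : ℕ} (c : Fin 3) (x y : (Laurent Zq (Fin n))ˣ) : Laurent Zq (Fin n) :=
  (y : Laurent Zq (Fin n)) - ((x * lcol c : (Laurent Zq (Fin n))ˣ) : Laurent Zq (Fin n))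

/-- The Laurent polynomial whose quotient by `y - x` is `link c i j (x / y)`. -/
def numLink {n : ℕ} (c : Fin 3) (i j : ℕ) (x y : (Laurent Zq (Fin n))ˣ) : Laurent Zq (Fin n) :=
  if i + 1 = j then (((lcol 2)⁻¹ * lcol c * y⁻¹ : (Laurent Zq (Fin n))ˣ) : Laurent Zq (Fin n)) *
    (lin (c + 1) x y * lin (c + 2) x y)
  else -(((lcol 2)⁻¹ * x⁻¹ * y⁻¹ : (Laurent Zq (Fin n))ˣ) : Laurent Zq (Fin n)) *
    (lin c x y * lin (c + 1) x y * lin (c + 2) x y)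

section

variable {F : Type} [Field F] [Algebra Kq F]

lemma ev_lC {n : ℕ} (v : Fin n → Fˣ) (r : Zq) : ev v (lC r) = coefHom F r := laurentHom_lC _ _ _

lemma ev_lvar {n : ℕ} (v : Fin n → Fˣ) (i : Fin n) :
    ev v (lvar i : (Laurent Zq (Fin n))ˣ) = v i := laurentHom_lvar _ _ _

lemma map_ev_lcol {n : ℕ} (v : Fin n → Fˣ) (c : Fin 3) :
    Units.map (ev v : Laurent Zq (Fin n) →* F) (lcol c) = fcol F c := by
  ext1
  exact (ev_lC _ _).trans (coefHom_zcol c)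

lemma map_ev_lvar {n : ℕ} (v : Fin n → Fˣ) (i : Fin n) :
    Units.map (ev v : Laurent Zq (Fin n) →* F) (lvar i) = v i := by
  ext1
  exact ev_lvar _ _

lemma ev_unit {n : ℕ} (v : Fin n → Fˣ) (x : (Laurent Zq (Fin n))ˣ) :
    ev v (x : Laurent Zq (Fin n)) = Units.map (ev v : Laurent Zq (Fin n) →* F) x := rfl

lemma ev_lin {n : ℕ} (v : Fin n → Fˣ) (c : Fin 3) (x y : (Laurent Zq (Fin n))ˣ)
    {X Y : Fˣ} (hX : Units.map (ev v : Laurent Zq (Fin n) →* F) x = X)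
    (hY : Units.map (ev v : Laurent Zq (Fin n) →* F) y = Y) :
    ev v (lin c x y) = (Y : F) - X * fcol F c := by
  rw [lin, map_sub, ev_unit, ev_unit, map_mul, hX, hY, map_ev_lcol, Units.val_mul]

lemma ev_numLink {n : ℕ} (v : Fin n → Fˣ) (c : Fin 3) (i j : ℕ) (x y : (Laurent Zq (Fin n))ˣ)
    {X Y : Fˣ} (hX : Units.map (ev v : Laurent Zq (Fin n) →* F) x = X)
    (hY : Units.map (ev v : Laurent Zq (Fin n) →* F) y = Y) (h : X ≠ Y) :
    ev v (numLink c i j x y) = link c i j ((X / Y : Fˣ) : F) * ((Y : F) - X) := by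
  have h0 : (Y : F) - X ≠ 0 := sub_ne_zero.2 fun e => h (Units.ext e.symm)
  have hX0 := X.ne_zero
  have hY0 := Y.ne_zero
  have h1 : (1 : F) - X / Y ≠ 0 := by
    have : (1 : F) - X / Y = (Y - X) / Y := by field_simp
    rw [this]; exact div_ne_zero h0 hY0
  have h2 : ((fcol F 2 : Fˣ) : F) ≠ 0 := (fcol F 2).ne_zero
  have e1 : (Y : F) - X = (1 - X / Y) * Y := by field_simp
  rw [numLink, link]
  split_ifs with hij
  · simp only [map_mul, ev_lin v _ x y hX hY, ev_unit, map_ev_lcol, hY, map_inv, Units.val_mul,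
      Units.val_inv_eq_inv_val, Units.val_div_eq_div_val]
    rw [zred, e1, div_mul_eq_mul_div, mul_left_comm _ (1 - (X : F) / Y) (Y : F),
      mul_div_cancel_left₀ _ h1]
    field_simp
  · simp only [map_mul, map_neg, ev_lin v _ x y hX hY, ev_unit, map_ev_lcol, hX, hY, map_inv,
      Units.val_mul, Units.val_inv_eq_inv_val, Units.val_div_eq_div_val]
    rw [zeta_eq_col c (div_ne_zero hX0 hY0), e1, div_mul_eq_mul_div,
      mul_left_comm _ (1 - (X : F) / Y) (Y : F), mul_div_cancel_left₀ _ h1]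
    field_simp

end

/-- The numerator of `wt`. -/
def numWt {n m : ℕ} (c : Fin 3) (d : ℕ → ℤ) (x : Fin m → (Laurent Zq (Fin n))ˣ) :
    Laurent Zq (Fin n) :=
  ((∏ i : Fin m, x i ^ d i : (Laurent Zq (Fin n))ˣ) : Laurent Zq (Fin n)) *
    ∏ i : Fin m, ∏ j : Fin m, if i < j then numLink c i j (x i) (x j) else 1

lemma map_numWt {n n' m : ℕ} (c : Fin 3) (d : ℕ → ℤ) (x : Fin m → (Laurent Zq (Fin n))ˣ)
    (h : Laurent Zq (Fin n) →+* Laurent Zq (Fin n')) (hC : ∀ r, h (lC r) = lC r) :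
    h (numWt c d x) =
      numWt c d fun i => Units.map (h : Laurent Zq (Fin n) →* Laurent Zq (Fin n')) (x i) := by
  have hu : ∀ u : (Laurent Zq (Fin n))ˣ, h (u : Laurent Zq (Fin n)) =
      Units.map (h : Laurent Zq (Fin n) →* Laurent Zq (Fin n')) u := fun _ => rfl
  have hl : ∀ c, Units.map (h : Laurent Zq (Fin n) →* Laurent Zq (Fin n')) (lcol c) = lcol c := by
    intro c; ext1; exact hC _
  rw [numWt, numWt, map_mul, hu, map_prod, map_prod]
  simp only [map_zpow, map_prod]
  congr 1
  refine Finset.prod_congr rfl fun i _ => Finset.prod_congr rfl fun j _ => ?_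
  split_ifs with hij
  · simp only [numLink, lin]
    split_ifs <;> simp only [map_mul, map_sub, map_neg, hu, hl, map_inv]
  · exact map_one h

lemma lvar_injective {n : ℕ} : Function.Injective (lvar : Fin n → (Laurent Zq (Fin n))ˣ) := by
  intro i j h
  have h1 := AddMonoidAlgebra.single_left_injective (one_ne_zero (α := Zq)) (congrArg Units.val h)
  by_contra hne
  have := congrFun h1 i
  simp [hne] at this

/-- The substitution `z_j ↦ u`. -/
def subst {n : ℕ} (j : Fin n) (u : (Laurent Zq (Fin n))ˣ) :
    Laurent Zq (Fin n) →+* Laurent Zq (Fin n) :=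
  laurentHom lC (Function.update lvar j u)

lemma subst_lC {n : ℕ} (j : Fin n) (u : (Laurent Zq (Fin n))ˣ) (r : Zq) :
    subst j u (lC r) = lC r := laurentHom_lC _ _ _

lemma map_subst_lvar {n : ℕ} (j k : Fin n) (u : (Laurent Zq (Fin n))ˣ) :
    Units.map (subst j u : Laurent Zq (Fin n) →* Laurent Zq (Fin n)) (lvar k) =
      Function.update lvar j u k := by
  ext1; exact laurentHom_lvar _ _ _

lemma subst_lvar {n : ℕ} (j k : Fin n) (u : (Laurent Zq (Fin n))ˣ) :
    subst j u (lvar k : (Laurent Zq (Fin n))ˣ) =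
      (Function.update lvar j u k : (Laurent Zq (Fin n))ˣ) := laurentHom_lvar _ _ _

lemma dvd_sub_subst' {n : ℕ} (j : Fin n) (u : (Laurent Zq (Fin n))ˣ) (s : Laurent Zq (Fin n)) :
    ((lvar j : (Laurent Zq (Fin n))ˣ) - (u : Laurent Zq (Fin n))) ∣ s - subst j u s := by
  apply dvd_sub_subst _ _ (subst_lC j u)
  intro k
  rw [subst_lvar]
  by_cases h : k = j
  · subst h; rw [Function.update_self]
  · rw [Function.update_of_ne h]; simp

/-- A Laurent polynomial which vanishes on all diagonals `z_i = z_j` is divisible by the Vandermonde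
product. -/
lemma vandermonde_dvd {n : ℕ} {f : Laurent Zq (Fin n)}
    (hf : ∀ i j : Fin n, i ≠ j → subst j (lvar i) f = 0) :
    (∏ i : Fin n, ∏ j ∈ Ioi i, (((lvar j : (Laurent Zq (Fin n))ˣ) : Laurent Zq (Fin n)) -
      (lvar i : (Laurent Zq (Fin n))ˣ))) ∣ f := by
  rw [Finset.prod_sigma']
  suffices H : ∀ A : Finset ((_ : Fin n) × Fin n), (∀ p ∈ A, p.1 < p.2) →
      ∏ p ∈ A, (((lvar p.2 : (Laurent Zq (Fin n))ˣ) : Laurent Zq (Fin n)) -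
      (lvar p.1 : (Laurent Zq (Fin n))ˣ)) ∣ f by
    apply H
    intro p hp
    simpa using hp
  intro A
  induction A using Finset.induction_on with
  | empty => simp
  | insert p A hp ih =>
    intro hA
    obtain ⟨g, hg⟩ := ih fun q hq => hA q (mem_insert_of_mem hq)
    have hp1 : p.1 < p.2 := hA p (mem_insert_self _ _)
    have h0 := hf p.1 p.2 hp1.ne
    rw [hg, map_mul, map_prod] at h0
    have hne : ∏ q ∈ A, subst p.2 (lvar p.1) (((lvar q.2 : (Laurent Zq (Fin n))ˣ) :
        Laurent Zq (Fin n)) - (lvar q.1 : (Laurent Zq (Fin n))ˣ)) ≠ 0 := by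
      rw [Finset.prod_ne_zero_iff]
      intro q hq
      have hq1 : q.1 < q.2 := hA q (mem_insert_of_mem hq)
      rw [map_sub, subst_lvar, subst_lvar, sub_ne_zero]
      intro he
      have he := Units.ext he
      by_cases h2 : q.2 = p.2
      · have h1 : q.1 ≠ p.2 := h2 ▸ hq1.ne
        rw [h2, Function.update_self, Function.update_of_ne h1] at he
        have := lvar_injective he
        exact hp (by
          have : p = q := Sigma.ext this (heq_of_eq h2.symm)
          rw [this]; exact hq)
      · rw [Function.update_of_ne h2] at he
        by_cases h1 : q.1 = p.2
        · rw [h1, Function.update_self] at he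
          have h3 := lvar_injective he
          rw [h1, h3] at hq1
          exact absurd hp1 (not_lt.2 hq1.le)
        · rw [Function.update_of_ne h1] at he
          exact hq1.ne (lvar_injective he).symm
    have hg0 := (mul_eq_zero.1 h0).resolve_left hne
    rw [Finset.prod_insert hp, hg, mul_comm]
    apply mul_dvd_mul_left
    have := dvd_sub_subst' p.2 (lvar p.1) g
    rwa [hg0, sub_zero] at this

lemma sum_ords_univ {A : Type*} [AddCommMonoid A] {n : ℕ} (f : (Fin n ↪ Fin n) → A) :
    ∑ o ∈ ords n (univ : Finset (Fin n)), f o = ∑ σ : Equiv.Perm (Fin n), f σ.toEmbedding := by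
  symm
  refine Finset.sum_bij (fun σ _ => σ.toEmbedding) ?_ ?_ ?_ ?_
  · intro σ _; rw [mem_ords]; ext i; simp
  · intro σ _ τ _ h; ext i; exact congrArg Fin.val (DFunLike.congr_fun h i)
  · intro o _
    exact ⟨Equiv.ofBijective o (Finite.injective_iff_bijective.1 o.injective), mem_univ _, by
      ext i; rfl⟩
  · intro σ _; rfl

lemma prod_sub_perm {A : Type*} [CommRing A] {n : ℕ} (v : Fin n → A) (σ : Equiv.Perm (Fin n)) :
    ∏ i : Fin n, ∏ j ∈ Ioi i, (v (σ j) - v (σ i)) =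
      ((Equiv.Perm.sign σ : ℤ) : A) * ∏ i : Fin n, ∏ j ∈ Ioi i, (v j - v i) := by
  rw [← Matrix.det_vandermonde, ← Matrix.det_vandermonde v, ← Matrix.det_permute σ]
  rfl

/-- The sums over orderings are (values of) Laurent polynomials with integral coefficients. -/
lemma exists_rep (c : Fin 3) (m : ℕ) (d : ℕ → ℤ) : ∃ R : Laurent Zq (Fin m),
    ∀ (F : Type) [Field F] [Algebra Kq F] (v : Fin m → Fˣ), Function.Injective v →
      ev v R = M c m d v univ := by
  let x : Equiv.Perm (Fin m) → Laurent Zq (Fin m) := fun σ => numWt c d fun i => lvar (σ i)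
  -- The signed sum of the numerators is antisymmetric, so it is divisible by the common denominator
  -- of the weights, the Vandermonde product.
  obtain ⟨R, hR⟩ := vandermonde_dvd (f := ∑ σ : Equiv.Perm (Fin m),
    ((Equiv.Perm.sign σ : ℤ) : Laurent Zq (Fin m)) * x σ) (by
      intro i j hij
      set h := subst j (lvar i : (Laurent Zq (Fin m))ˣ) with hh
      set S := h (∑ σ : Equiv.Perm (Fin m), ((Equiv.Perm.sign σ : ℤ) : Laurent Zq (Fin m)) * x σ)
        with hS
      have hx : ∀ σ, h (x (Equiv.swap i j * σ)) = h (x σ) := by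
        intro σ
        rw [map_numWt _ _ _ h (subst_lC _ _), map_numWt _ _ _ h (subst_lC _ _)]
        congr 1
        funext k
        rw [hh, map_subst_lvar, map_subst_lvar, Equiv.Perm.mul_apply]
        by_cases h1 : σ k = i
        · rw [h1, Equiv.swap_apply_left, Function.update_self, Function.update_of_ne hij]
        · by_cases h2 : σ k = j
          · rw [h2, Equiv.swap_apply_right, Function.update_self, Function.update_of_ne hij]
          · rw [Equiv.swap_apply_of_ne_of_ne h1 h2]
      have : S = -S := by
        conv_lhs => rw [hS, map_sum, ← Equiv.sum_comp (Equiv.mulLeft (Equiv.swap i j))]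
        rw [hS, map_sum, ← Finset.sum_neg_distrib]
        refine Finset.sum_congr rfl fun σ _ => ?_
        rw [Equiv.coe_mulLeft, map_mul, map_mul, hx]
        simp [Equiv.Perm.sign_swap hij]
      exact self_eq_neg.1 this)
  refine ⟨R, fun F _ _ v hv => ?_⟩
  have hΔ : ∏ i : Fin m, ∏ j ∈ Ioi i, ((v j : F) - v i) ≠ 0 := by
    rw [Finset.prod_ne_zero_iff]
    intro i _
    rw [Finset.prod_ne_zero_iff]
    intro j hj
    rw [sub_ne_zero]
    intro h
    exact (mem_Ioi.1 hj).ne (hv (Units.ext h)).symm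
  apply mul_left_cancel₀ hΔ
  have h1 := congrArg (ev v) hR
  rw [map_mul, map_prod] at h1
  simp only [map_prod, map_sub, ev_lvar] at h1
  rw [← h1, map_sum, M_apply, sum_ords_univ, Finset.mul_sum]
  refine Finset.sum_congr rfl fun σ _ => ?_
  have h2 : ev v (x σ) = wt c d v σ * ∏ i : Fin m, ∏ j ∈ Ioi i, ((v (σ j) : F) - v (σ i)) := by
    simp only [x]
    rw [numWt, wt, map_mul, mul_assoc, ev_unit, map_prod]
    simp only [map_zpow, map_ev_lvar]
    congr 1
    rw [map_prod, ← Finset.prod_mul_distrib]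
    refine Finset.prod_congr rfl fun i _ => ?_
    have : ∏ j ∈ Ioi i, ((v (σ j) : F) - v (σ i)) =
        ∏ j : Fin m, if i < j then ((v (σ j) : F) - v (σ i)) else 1 := by
      rw [← Finset.prod_filter]
      congr 1
      ext j; simp
    rw [this, map_prod, ← Finset.prod_mul_distrib]
    refine Finset.prod_congr rfl fun j _ => ?_
    split_ifs with hij
    · exact ev_numLink v c i j _ _ (map_ev_lvar v _) (map_ev_lvar v _) fun h =>
        hij.ne (σ.injective (hv h))
    · rw [map_one, mul_one]
  rw [map_mul, map_intCast, h2, prod_sub_perm (fun i => (v i : F)) σ]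
  have h3 : (((Equiv.Perm.sign σ : ℤˣ) : ℤ) : F) * ((Equiv.Perm.sign σ : ℤ) : F) = 1 := by
    rw [← Int.cast_mul, ← Units.val_mul, Int.units_mul_self]; simp
  change _ = _ * wt c d v σ
  linear_combination (wt c d v σ * ∏ i : Fin m, ∏ j ∈ Ioi i, ((v j : F) - v i)) * h3

/-! ### Leading coefficients under a rescaling of some of the variables -/

section Lead

variable {F : Type} [Field F]

/-- The Laurent series `f` in `η` has the form `x η^{-w} + (higher powers of η)`. -/
def Lead (f : LaurentSeries F) (w : ℤ) (x : F) : Prop :=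
  (∀ k < -w, f.coeff k = 0) ∧ f.coeff (-w) = x

namespace Lead

variable {f g : LaurentSeries F} {w w' : ℤ} {x y : F}

lemma unique (h : Lead f w x) (h' : Lead f w y) : x = y := h.2.symm.trans h'.2

lemma mono (h : Lead f w x) (hw : w < w') : Lead f w' 0 :=
  ⟨fun k hk => h.1 k (by omega), h.1 _ (by omega)⟩

lemma zero (w : ℤ) : Lead (0 : LaurentSeries F) w 0 := ⟨fun _ _ => rfl, rfl⟩

lemma add (h : Lead f w x) (h' : Lead g w y) : Lead (f + g) w (x + y) :=
  ⟨fun k hk => by rw [HahnSeries.coeff_add, h.1 k hk, h'.1 k hk, add_zero],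
    by rw [HahnSeries.coeff_add, h.2, h'.2]⟩

lemma neg (h : Lead f w x) : Lead (-f) w (-x) :=
  ⟨fun k hk => by rw [HahnSeries.coeff_neg, h.1 k hk, neg_zero], by rw [HahnSeries.coeff_neg, h.2]⟩

lemma sub (h : Lead f w x) (h' : Lead g w y) : Lead (f - g) w (x - y) := by
  rw [sub_eq_add_neg, sub_eq_add_neg]; exact h.add h'.neg

lemma sum {ι : Type*} (s : Finset ι) {f : ι → LaurentSeries F} {x : ι → F}
    (h : ∀ i ∈ s, Lead (f i) w (x i)) : Lead (∑ i ∈ s, f i) w (∑ i ∈ s, x i) := by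
  classical
  induction s using Finset.induction_on with
  | empty => exact zero w
  | insert i s hi ih =>
    rw [Finset.sum_insert hi, Finset.sum_insert hi]
    exact (h i (mem_insert_self _ _)).add (ih fun j hj => h j (mem_insert_of_mem hj))

lemma mul (h : Lead f w x) (h' : Lead g w' y) : Lead (f * g) (w + w') (x * y) := by
  have hz : ∀ i j, f.coeff i ≠ 0 → g.coeff j ≠ 0 → -w ≤ i ∧ -w' ≤ j := by
    intro i j hi hj
    constructor
    · by_contra hlt; exact hi (h.1 i (by omega))
    · by_contra hlt; exact hj (h'.1 j (by omega))
  constructor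
  · intro k hk
    rw [HahnSeries.coeff_mul]
    refine Finset.sum_eq_zero fun p hp => ?_
    rw [Finset.mem_antidiagonal] at hp
    have := hz p.1 p.2 hp.1 hp.2.1
    omega
  · rw [HahnSeries.coeff_mul, ← h.2, ← h'.2, Finset.sum_eq_single (-w, -w')]
    · intro p hp hne
      rw [Finset.mem_antidiagonal] at hp
      have := hz p.1 p.2 hp.1 hp.2.1
      exfalso; apply hne; ext <;> simp <;> omega
    · intro hn
      rw [Finset.mem_antidiagonal] at hn
      by_contra h0
      exact hn ⟨left_ne_zero_of_mul h0, right_ne_zero_of_mul h0, by simp; ring⟩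

lemma single (k : ℤ) (x : F) : Lead (HahnSeries.single k x) (-k) x := by
  constructor
  · intro j hj; exact HahnSeries.coeff_single_of_ne (by omega)
  · rw [neg_neg, HahnSeries.coeff_single_same]

lemma C (x : F) : Lead (HahnSeries.C x) 0 x := by
  have := single 0 x; simpa using this

lemma one : Lead (1 : LaurentSeries F) 0 1 := by
  have := C (1 : F); simpa using this

lemma inv (h : Lead f w x) (hx : x ≠ 0) : Lead f⁻¹ (-w) x⁻¹ := by
  have hf : f ≠ 0 := by rintro rfl; exact hx h.2.symm
  have ho : f.order = -w := by
    apply le_antisymm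
    · exact HahnSeries.order_le_of_coeff_ne_zero (by rw [h.2]; exact hx)
    · by_contra hlt
      have := h.1 f.order (by omega)
      exact HahnSeries.coeff_order_eq_zero.not.2 hf this
  have hfi : f⁻¹ ≠ 0 := inv_ne_zero hf
  have h1 : f * f⁻¹ = 1 := mul_inv_cancel₀ hf
  have ho' : f⁻¹.order = w := by
    have := HahnSeries.order_mul hf hfi
    rw [h1, HahnSeries.order_one, ho] at this
    omega
  constructor
  · intro k hk
    apply HahnSeries.coeff_eq_zero_of_lt_order
    omega
  · have h2 : Lead f⁻¹ (-w) (f⁻¹.coeff w) := by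
      constructor
      · intro k hk
        apply HahnSeries.coeff_eq_zero_of_lt_order
        omega
      · rw [neg_neg]
    have h3 := h.mul h2
    rw [h1, add_neg_cancel] at h3
    have h4 := h3.unique one
    rw [neg_neg]
    exact eq_inv_of_mul_eq_one_right h4

lemma div (h : Lead f w x) (h' : Lead g w' y) (hy : y ≠ 0) : Lead (f / g) (w - w') (x / y) := by
  rw [div_eq_mul_inv, div_eq_mul_inv, sub_eq_add_neg]; exact h.mul (h'.inv hy)

lemma prod {ι : Type*} (s : Finset ι) {f : ι → LaurentSeries F} {w : ι → ℤ} {x : ι → F}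
    (h : ∀ i ∈ s, Lead (f i) (w i) (x i)) : Lead (∏ i ∈ s, f i) (∑ i ∈ s, w i) (∏ i ∈ s, x i) := by
  classical
  induction s using Finset.induction_on with
  | empty => exact one
  | insert i s hi ih =>
    rw [Finset.prod_insert hi, Finset.prod_insert hi, Finset.sum_insert hi]
    exact (h i (mem_insert_self _ _)).mul (ih fun j hj => h j (mem_insert_of_mem hj))

lemma pow (h : Lead f w x) (n : ℕ) : Lead (f ^ n) (n * w) (x ^ n) := by
  induction n with
  | zero => simpa using one
  | succ n ih =>
    rw [pow_succ, pow_succ]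
    have := ih.mul h
    convert this using 1
    push_cast; ring

lemma zpow (h : Lead f w x) (hx : x ≠ 0) (n : ℤ) : Lead (f ^ n) (n * w) (x ^ n) := by
  cases n with
  | ofNat n => simpa using h.pow n
  | negSucc n =>
    rw [zpow_negSucc, zpow_negSucc]
    have := (h.pow (n + 1)).inv (pow_ne_zero _ hx)
    convert this using 1
    rw [Int.negSucc_eq]; push_cast; ring

end Lead

end Lead

section Scaled

variable {F : Type} [Field F] [Algebra Kq F]

lemma algebraMap_laurentSeries (r : Kq) :
    algebraMap Kq (LaurentSeries F) r = HahnSeries.C (algebraMap Kq F r) := by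
  rw [HahnSeries.algebraMap_apply', PowerSeries.algebraMap_apply, HahnSeries.ofPowerSeries_C]

lemma coe_fcol_laurentSeries (c : Fin 3) :
    ((fcol (LaurentSeries F) c : (LaurentSeries F)ˣ) : LaurentSeries F) =
      HahnSeries.C (fcol F c : F) := by
  rw [coe_fcol, coe_fcol, algebraMap_laurentSeries]

lemma zeta_C (x : F) : zeta (HahnSeries.C x : LaurentSeries F) = HahnSeries.C (zeta x) := by
  simp only [zeta, algebraMap_laurentSeries, map_div₀, map_mul, map_sub, map_one]

lemma zred_C (c : Fin 3) (x : F) :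
    zred c (HahnSeries.C x : LaurentSeries F) = HahnSeries.C (zred c x) := by
  simp only [zred, coe_fcol_laurentSeries, map_div₀, map_mul, map_sub, map_one, map_inv₀]

lemma lead_fcol (c : Fin 3) :
    Lead ((fcol (LaurentSeries F) c : (LaurentSeries F)ˣ) : LaurentSeries F) 0 (fcol F c : F) := by
  rw [coe_fcol_laurentSeries]; exact Lead.C _

variable {a : ℤ} {f : LaurentSeries F} {y : F}

lemma lead_one_sub_up (ha : 0 < a) (h : Lead f a y) : Lead (1 - f) a (-y) := by
  have := (Lead.one.mono ha).sub h
  simpa using this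

lemma lead_one_sub_down (ha : 0 < a) (h : Lead f (-a) y) : Lead (1 - f) 0 1 := by
  have := Lead.one.sub (h.mono (w' := 0) (by omega))
  simpa using this

lemma lead_mul_fcol (c : Fin 3) {w : ℤ} (h : Lead f w y) :
    Lead (f * ((fcol (LaurentSeries F) c : (LaurentSeries F)ˣ) : LaurentSeries F)) w (y * fcol F c) := by
  have := h.mul (lead_fcol c)
  rwa [add_zero] at this

lemma lead_zeta_up (ha : 0 < a) (h : Lead f a y) (hy : y ≠ 0) :
    Lead (zeta f) a (-((fcol F 2 : F)⁻¹ * y)) := by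
  have hf : f ≠ 0 := by rintro rfl; exact hy h.2.symm
  rw [zeta_eq hf]
  have h2 := (fcol F 2).ne_zero
  have := ((((lead_fcol (F := F) 2).inv h2).mul (h.inv hy)).neg.mul
    (((lead_one_sub_up ha (lead_mul_fcol 0 h)).mul (lead_one_sub_up ha (lead_mul_fcol 1 h))).mul
      (lead_one_sub_up ha (lead_mul_fcol 2 h)))).div (lead_one_sub_up ha h) (neg_ne_zero.2 hy)
  convert this using 1
  · ring
  · have h3 := congrArg Units.val (fcol_prod (F := F) 0)
    simp only [zero_add, Units.val_mul, Units.val_one] at h3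
    field_simp
    linear_combination h3

lemma lead_zeta_down (ha : 0 < a) (h : Lead f (-a) y) (hy : y ≠ 0) :
    Lead (zeta f) a (-((fcol F 2 : F)⁻¹ * y⁻¹)) := by
  have hf : f ≠ 0 := by rintro rfl; exact hy h.2.symm
  rw [zeta_eq hf]
  have h2 := (fcol F 2).ne_zero
  have := ((((lead_fcol (F := F) 2).inv h2).mul (h.inv hy)).neg.mul
    (((lead_one_sub_down ha (lead_mul_fcol 0 h)).mul (lead_one_sub_down ha (lead_mul_fcol 1 h))).mul
      (lead_one_sub_down ha (lead_mul_fcol 2 h)))).div (lead_one_sub_down ha h) one_ne_zero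
  convert this using 1
  · ring
  · simp

lemma lead_zred_up (c : Fin 3) (ha : 0 < a) (h : Lead f a y) (hy : y ≠ 0) :
    Lead (zred c f) a (-((fcol F 2 : F)⁻¹ * y)) := by
  rw [zred]
  have h2 := (fcol F 2).ne_zero
  have := (((((lead_fcol (F := F) 2).inv h2).mul (lead_fcol c)).mul
    (lead_one_sub_up ha (lead_mul_fcol (c + 1) h))).mul
      (lead_one_sub_up ha (lead_mul_fcol (c + 2) h))).div (lead_one_sub_up ha h) (neg_ne_zero.2 hy)
  convert this using 1
  · ring
  · have h3 := congrArg Units.val (fcol_prod (F := F) c)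
    simp only [Units.val_mul, Units.val_one] at h3
    field_simp
    linear_combination h3

lemma lead_zred_down (c : Fin 3) (ha : 0 < a) (h : Lead f (-a) y) :
    Lead (zred c f) 0 ((fcol F 2 : F)⁻¹ * fcol F c) := by
  rw [zred]
  have h2 := (fcol F 2).ne_zero
  have := (((((lead_fcol (F := F) 2).inv h2).mul (lead_fcol c)).mul
    (lead_one_sub_down ha (lead_mul_fcol (c + 1) h))).mul
      (lead_one_sub_down ha (lead_mul_fcol (c + 2) h))).div (lead_one_sub_down ha h) one_ne_zero
  convert this using 1 <;> simp

variable {I : Type} [DecidableEq I]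

/-- The points `v`, with the coordinates in `T` multiplied by `η^{-a}`. -/
def scaled (a : ℤ) (T : Finset I) (v : I → Fˣ) (i : I) : (LaurentSeries F)ˣ :=
  Units.mk0 (HahnSeries.single (if i ∈ T then -a else 0) (v i : F)) (by simp)

/-- The leading coefficients of the shuffle kernel at the scaled points. -/
def kap0 (T : Finset I) (v : I → Fˣ) (i j : I) : F :=
  if (i ∈ T ↔ j ∈ T) then zeta ((v i / v j : Fˣ) : F)
  else if i ∈ T then -((fcol F 2 : F)⁻¹ * (v i / v j : Fˣ))
  else -((fcol F 2 : F)⁻¹ * (v j / v i : Fˣ))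

lemma kap0_comm {T : Finset I} {v : I → Fˣ} {i j : I} (h : ¬ (i ∈ T ↔ j ∈ T)) :
    kap0 T v i j = kap0 T v j i := by
  by_cases hi : i ∈ T <;> by_cases hj : j ∈ T
  · exact absurd (by simp [hi, hj]) h
  · simp [kap0, hi, hj]
  · simp [kap0, hi, hj]
  · exact absurd (by simp [hi, hj]) h

lemma lead_scaled (a : ℤ) (T : Finset I) (v : I → Fˣ) (i : I) :
    Lead ((scaled a T v i : (LaurentSeries F)ˣ) : LaurentSeries F) (if i ∈ T then a else 0)
      (v i : F) := by
  have := Lead.single (if i ∈ T then -a else 0) (v i : F)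
  have e : -(if i ∈ T then -a else 0) = if i ∈ T then a else 0 := by split_ifs <;> simp
  rwa [e] at this

lemma scaled_div_same {a : ℤ} {T : Finset I} {v : I → Fˣ} {i j : I} (h : i ∈ T ↔ j ∈ T) :
    ((scaled a T v i / scaled a T v j : (LaurentSeries F)ˣ) : LaurentSeries F) =
      HahnSeries.C ((v i / v j : Fˣ) : F) := by
  rw [Units.val_div_eq_div_val, div_eq_iff (Units.ne_zero _)]
  simp only [scaled, Units.val_mk0, h]
  rw [HahnSeries.C_apply, HahnSeries.single_mul_single, zero_add, Units.val_div_eq_div_val,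
    div_mul_cancel₀ _ (Units.ne_zero _)]

lemma lead_scaled_div (a : ℤ) (T : Finset I) (v : I → Fˣ) (i j : I) :
    Lead ((scaled a T v i / scaled a T v j : (LaurentSeries F)ˣ) : LaurentSeries F)
      ((if i ∈ T then a else 0) - (if j ∈ T then a else 0)) ((v i / v j : Fˣ) : F) := by
  rw [Units.val_div_eq_div_val, Units.val_div_eq_div_val]
  exact (lead_scaled a T v i).div (lead_scaled a T v j) (Units.ne_zero _)

/-- `1` for indices on different sides of `T`, and `0` otherwise. -/
def diffSide (T : Finset I) (i j : I) : ℤ := if (i ∈ T ↔ j ∈ T) then 0 else 1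

lemma lead_kap (ha : 0 < a) (T : Finset I) (v : I → Fˣ) (i j : I) :
    Lead (kap (scaled a T v) i j) (a * diffSide T i j) (kap0 T v i j) := by
  rw [kap, kap0, diffSide]
  have h := lead_scaled_div a T v i j
  by_cases hs : (i ∈ T ↔ j ∈ T)
  · rw [if_pos hs, if_pos hs, scaled_div_same hs, zeta_C, mul_zero]
    exact Lead.C _
  · rw [if_neg hs, if_neg hs, mul_one]
    by_cases hi : i ∈ T
    · have hj : j ∉ T := fun hj => hs (by simp [hi, hj])
      rw [if_pos hi]
      rw [if_pos hi, if_neg hj, sub_zero] at h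
      exact lead_zeta_up ha h (Units.ne_zero _)
    · have hj : j ∈ T := by by_contra hj; exact hs (by simp [hi, hj])
      rw [if_neg hi]
      rw [if_neg hi, if_pos hj, zero_sub] at h
      have := lead_zeta_down ha h (Units.ne_zero _)
      have e : ((v i / v j : Fˣ) : F)⁻¹ = ((v j / v i : Fˣ) : F) := by
        rw [← Units.val_inv_eq_inv_val, inv_div]
      rwa [e] at this

/-- The leading coefficient of the kernel between the positions `p < q` of an ordering: if the
positions are neighbours and the scaled variable comes second, then the weight drops. -/
lemma lead_link (ha : 0 < a) (c : Fin 3) (T : Finset I) (v : I → Fˣ) (p q : ℕ) (i j : I) :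
    ∃ y, Lead (link c p q ((scaled a T v i / scaled a T v j : (LaurentSeries F)ˣ) :
        LaurentSeries F))
      (a * (diffSide T i j - if p + 1 = q ∧ i ∉ T ∧ j ∈ T then 1 else 0)) y ∧
      (¬ (p + 1 = q ∧ i ∉ T ∧ j ∈ T) →
        y = if (i ∈ T ↔ j ∈ T) then link c p q ((v i / v j : Fˣ) : F) else kap0 T v i j) := by
  by_cases hd : p + 1 = q ∧ i ∉ T ∧ j ∈ T
  · refine ⟨(fcol F 2 : F)⁻¹ * fcol F c, ?_, fun h => absurd hd h⟩
    have h := lead_scaled_div a T v i j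
    rw [if_neg hd.2.1, if_pos hd.2.2, zero_sub] at h
    rw [if_pos hd, diffSide, if_neg (by simp [hd.2.1, hd.2.2]), sub_self, mul_zero, link,
      if_pos hd.1]
    exact lead_zred_down c ha h
  · refine ⟨_, ?_, fun _ => rfl⟩
    rw [if_neg hd, sub_zero]
    by_cases hs : (i ∈ T ↔ j ∈ T)
    · rw [if_pos hs, diffSide, if_pos hs, mul_zero, scaled_div_same hs, link, link]
      split_ifs
      · rw [zred_C]; exact Lead.C _
      · rw [zeta_C]; exact Lead.C _
    · rw [if_neg hs, link]
      split_ifs with h1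
      · have hi : i ∈ T := by
          by_contra hi
          exact hd ⟨h1, hi, by by_contra hj; exact hs (by simp [hi, hj])⟩
        have hj : j ∉ T := fun hj => hs (by simp [hi, hj])
        have h := lead_scaled_div a T v i j
        rw [if_pos hi, if_neg hj, sub_zero] at h
        rw [diffSide, kap0, if_neg hs, if_neg hs, if_pos hi, mul_one]
        exact lead_zred_up c ha h (Units.ne_zero _)
      · exact lead_kap ha T v i j

end Scaled

section Rel

variable {F : Type} [Field F] [Algebra Kq F] {I : Type} [DecidableEq I]

/-- The largest weight in the variables from `T` that is allowed, at a set `S` of variables, for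
slope `b / a`. (Weights are multiplied by `a`, to make them integral.) -/
def slopeWt (a b : ℤ) (T S : Finset I) : ℤ := a * (#(S ∩ T) * #(S \ T)) + b * #(S ∩ T)

/-- `f₀` collects the leading coefficients of `f`, a set function of slope at most `b / a`. -/
def Rel (a b : ℤ) (T : Finset I) (v : I → Fˣ) (f : Tw (kap (scaled a T v)))
    (f₀ : Tw (kap0 T v)) : Prop :=
  ∀ S, Lead (f S) (slopeWt a b T S) (f₀ S)

variable {a b : ℤ} {T : Finset I} {v : I → Fˣ} {f g : Tw (kap (scaled a T v))}
  {f₀ g₀ : Tw (kap0 T v)}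

namespace Rel

lemma unique {f₀' : Tw (kap0 T v)} (h : Rel a b T v f f₀) (h' : Rel a b T v f f₀') : f₀ = f₀' := by
  ext S; exact (h S).unique (h' S)

lemma sub (h : Rel a b T v f f₀) (h' : Rel a b T v g g₀) : Rel a b T v (f - g) (f₀ - g₀) :=
  fun S => (h S).sub (h' S)

lemma scale (h : Rel a b T v f f₀) :
    Rel a b T v (Tw.scale (fun m => (m : LaurentSeries F)) f) (Tw.scale (fun m => (m : F)) f₀) := by
  intro S
  have := (Lead.C ((#S : ℕ) : F)).mul (h S)
  rw [zero_add, map_natCast] at this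
  exact this

lemma part (h : Rel a b T v f f₀) (m : ℕ) : Rel a b T v (Tw.part m f) (Tw.part m f₀) := by
  intro S
  rw [Tw.part_apply, Tw.part_apply]
  split_ifs
  · exact h S
  · exact Lead.zero _

lemma slopeWt_split {S U : Finset I} (hU : U ⊆ S) :
    slopeWt a b T U + slopeWt a b T (S \ U) + ∑ i ∈ U, ∑ j ∈ S \ U, a * diffSide T i j =
      slopeWt a b T S := by
  have e1 : #(S ∩ T) = #(U ∩ T) + #((S \ U) ∩ T) := by
    rw [← card_union_of_disjoint, ← union_inter_distrib_right, union_sdiff_of_subset hU]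
    exact Finset.disjoint_of_subset_left inter_subset_left
      (Finset.disjoint_of_subset_right inter_subset_left disjoint_sdiff)
  have e2 : #(S \ T) = #(U \ T) + #((S \ U) \ T) := by
    rw [← card_union_of_disjoint, ← union_sdiff_distrib, union_sdiff_of_subset hU]
    exact Finset.disjoint_of_subset_left sdiff_subset
      (Finset.disjoint_of_subset_right sdiff_subset disjoint_sdiff)
  have e3 : ∑ i ∈ U, ∑ j ∈ S \ U, a * diffSide T i j =
      a * (#(U ∩ T) * #((S \ U) \ T) + #(U \ T) * #((S \ U) ∩ T)) := by
    have h1 : ∀ i j, diffSide T i j = (if i ∈ T then 1 else 0) * (if j ∈ T then 0 else 1) +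
        (if i ∈ T then 0 else 1) * (if j ∈ T then 1 else 0) := by
      intro i j
      by_cases hi : i ∈ T <;> by_cases hj : j ∈ T <;> simp [diffSide, hi, hj]
    have h2 : ∀ V : Finset I, ∑ i ∈ V, (if i ∈ T then (1 : ℤ) else 0) = #(V ∩ T) := by
      intro V; rw [Finset.sum_boole, Finset.filter_mem_eq_inter]
    have h3 : ∀ V : Finset I, ∑ i ∈ V, (if i ∈ T then (0 : ℤ) else 1) = #(V \ T) := by
      intro V
      rw [← Finset.filter_notMem_eq_sdiff, ← Finset.sum_boole]
      exact Finset.sum_congr rfl fun i _ => by split_ifs <;> rfl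
    simp only [h1, ← Finset.mul_sum, Finset.sum_add_distrib, ← Finset.sum_mul, h2, h3]
  rw [e3]
  simp only [slopeWt, e1, e2]
  push_cast
  ring

lemma lead_mul_cross (ha : 0 < a) {S U : Finset I} (hU : U ⊆ S) {x y : LaurentSeries F} {x₀ y₀ : F}
    (hx : Lead x (slopeWt a b T U) x₀) (hy : Lead y (slopeWt a b T (S \ U)) y₀) :
    Lead (x * y * cross (kap (scaled a T v)) U (S \ U)) (slopeWt a b T S)
      (x₀ * y₀ * cross (kap0 T v) U (S \ U)) := by
  rw [← slopeWt_split hU]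
  exact (hx.mul hy).mul (Lead.prod _ fun i _ => Lead.prod _ fun j _ => lead_kap ha T v i j)

lemma mul (ha : 0 < a) (h : Rel a b T v f f₀) (h' : Rel a b T v g g₀) :
    Rel a b T v (f * g) (f₀ * g₀) := by
  intro S
  exact Lead.sum _ fun U hU => lead_mul_cross ha (mem_powerset.1 hU) (h U) (h' _)

/-- A left factor of a set function of bounded slope has bounded slope. -/
lemma of_mul (ha : 0 < a) (hg0 : g ∅ = 1) (h' : Rel a b T v g g₀)
    (h : Rel a b T v (f * g) f₀) : ∃ p, Rel a b T v f p := by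
  refine ⟨fun S => (f S).coeff (-slopeWt a b T S), fun S => ?_⟩
  induction S using Finset.strongInduction with
  | H S ih =>
    have e := Tw.mul_apply_split f g S
    rw [hg0, mul_one] at e
    have e' : f S = (f * g) S - ∑ U ∈ S.powerset.erase S, f U * g (S \ U) *
      cross (kap (scaled a T v)) U (S \ U) := by rw [e]; ring
    have h2 := (h S).sub (Lead.sum (S.powerset.erase S) fun U hU => by
      rw [mem_erase, mem_powerset] at hU
      exact lead_mul_cross (v := v) ha hU.2 (ih U (hU.2.ssubset_of_ne hU.1)) (h' _))
    rw [← e'] at h2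
    exact ⟨h2.1, rfl⟩

end Rel

end Rel

/-! ### The exponents of slope `b / a` -/

/-- The exponents `⌊(i+1) b / a⌋ - ⌊i b / a⌋`. -/
def slopeExp (a : ℕ) (b : ℤ) (i : ℕ) : ℤ := ((i + 1 : ℕ) * b) / a - (i * b) / a

section SlopeExp

variable {a : ℕ} {b : ℤ}

lemma sum_slopeExp (k : ℕ) : ∑ i ∈ range k, slopeExp a b i = (k * b) / a := by
  have := Finset.sum_range_sub (fun i : ℕ => ((i : ℤ) * b) / (a : ℤ)) k
  simp only [slopeExp]
  rw [this]
  simp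

lemma slopeExp_add (ha : 0 < a) {k : ℕ} (hk : a ∣ k) (i : ℕ) :
    slopeExp a b (k + i) = slopeExp a b i := by
  obtain ⟨r, rfl⟩ := hk
  have ha' : (a : ℤ) ≠ 0 := by omega
  have h : ∀ j : ℕ, (((a * r + j : ℕ) : ℤ) * b) / a = (j * b) / a + r * b := by
    intro j
    rw [← Int.add_mul_ediv_right _ _ ha']
    congr 1
    push_cast; ring
  rw [slopeExp, slopeExp, add_assoc, h, h]
  ring

/-- The number of positions `i < m` at which `χ` starts to hold, other than position `0`. -/
def ascents (χ : ℕ → Prop) [DecidablePred χ] (m : ℕ) : ℤ :=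
  ∑ i ∈ range m, if 0 < i ∧ ¬ χ (i - 1) ∧ χ i then 1 else 0

/-- The sum of the exponents of slope `b / a` over a set of positions is at most `b / a` times the
size of the set, up to a correction of `1` for every run of positions that does not start at `0`. -/
lemma slope_inequality (ha : 0 < a) (χ : ℕ → Prop) [DecidablePred χ] (m : ℕ) :
    ascents χ m + (if 0 < m ∧ χ (m - 1) then (m * b) % a else 0) ≤
      b * (∑ i ∈ range m, if χ i then 1 else 0) -
        a * (∑ i ∈ range m, if χ i then slopeExp a b i else 0) + a * ascents χ m := by
  induction m with
  | zero => simp [ascents]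
  | succ m ih =>
    have ha' : (0 : ℤ) < a := by omega
    have h1 := Int.emod_nonneg (m * b) ha'.ne'
    have h2 := Int.emod_lt_of_pos (m * b) ha'
    have h3 := Int.emod_nonneg (((m + 1 : ℕ) : ℤ) * b) ha'.ne'
    have e1 := Int.emod_add_mul_ediv (m * b) a
    have e2 := Int.emod_add_mul_ediv (((m + 1 : ℕ) : ℤ) * b) a
    have e3 : a * slopeExp a b m = b + (m * b) % a - (((m + 1 : ℕ) : ℤ) * b) % a := by
      rw [slopeExp, mul_sub]
      push_cast at e2 ⊢
      linarith
    have e4 : ascents χ (m + 1) = ascents χ m + if 0 < m ∧ ¬ χ (m - 1) ∧ χ m then 1 else 0 :=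
      Finset.sum_range_succ _ _
    rw [e4, Finset.sum_range_succ, Finset.sum_range_succ, Nat.add_sub_cancel]
    by_cases hm : χ m
    · simp only [hm, if_true, Nat.succ_pos, and_true, mul_add, e3]
      rcases Nat.eq_zero_or_pos m with rfl | h0
      · simp only [lt_irrefl, false_and, if_false] at ih ⊢
        simp at e1 h1 h2 ih ⊢
        linarith
      · by_cases hm1 : χ (m - 1)
        · simp only [h0, hm1, not_true, and_true, and_false, if_true, if_false] at ih ⊢
          linarith
        · simp only [h0, hm1, not_false_iff, and_true, and_false, if_true, if_false] at ih ⊢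
          linarith
    · simp only [hm, and_false, if_false, add_zero]
      have : (0 : ℤ) ≤ if 0 < m ∧ χ (m - 1) then (m * b) % a else 0 := by split_ifs <;> omega
      linarith

lemma ascents_nonneg (χ : ℕ → Prop) [DecidablePred χ] (m : ℕ) : 0 ≤ ascents χ m :=
  Finset.sum_nonneg fun i _ => by split_ifs <;> simp

lemma lt_of_ascents_eq_zero {χ : ℕ → Prop} [DecidablePred χ] {m k : ℕ} (h : ascents χ m = 0)
    (hk : ∑ i ∈ range m, (if χ i then (1 : ℤ) else 0) = k) {i : ℕ} (hi : i < m) :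
    χ i ↔ i < k := by
  have h1 : ∀ j < m, 0 < j → χ j → χ (j - 1) := by
    intro j hj h0 hc
    by_contra hn
    have := (Finset.sum_eq_zero_iff_of_nonneg (fun i _ => by split_ifs <;> simp)).1 h j
      (mem_range.2 hj)
    simp [h0, hc, hn] at this
  have h2 : ∀ r j, j + r < m → χ (j + r) → χ j := by
    intro r
    induction r with
    | zero => intro j _ h; exact h
    | succ r ih => intro j hj hc; exact ih j (by omega) (h1 (j + (r + 1)) hj (by omega) hc)
  have h3 : #((range m).filter χ) = k := by
    rw [Finset.sum_boole] at hk; exact_mod_cast hk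
  have h4 : (range m).filter χ ⊆ range k := by
    intro x hx
    rw [mem_filter, mem_range] at hx
    rw [mem_range, ← h3, Nat.lt_iff_add_one_le, ← card_range (x + 1)]
    apply card_le_card
    intro y hy
    rw [mem_range] at hy
    rw [mem_filter, mem_range]
    refine ⟨by omega, h2 (x - y) y (by omega) ?_⟩
    rw [show y + (x - y) = x by omega]; exact hx.2
  have h5 := eq_of_subset_of_card_le h4 (by rw [h3, card_range])
  have := Finset.ext_iff.1 h5 i
  simpa [hi] using this

/-- The case of equality. -/
lemma slope_eq_iff (ha : 0 < a) (hab : IsCoprime (a : ℤ) b) (χ : ℕ → Prop) [DecidablePred χ]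
    {m k : ℕ} (hk : ∑ i ∈ range m, (if χ i then (1 : ℤ) else 0) = k) :
    a * (∑ i ∈ range m, if χ i then slopeExp a b i else 0) - a * ascents χ m = b * k ↔
      a ∣ k ∧ ∀ i < m, (χ i ↔ i < k) := by
  have h := slope_inequality (b := b) ha χ m
  have ha' : (0 : ℤ) < a := by omega
  have h1 : (0 : ℤ) ≤ if 0 < m ∧ χ (m - 1) then (m * b) % a else 0 := by
    have := Int.emod_nonneg (m * b) ha'.ne'
    split_ifs <;> omega
  have h2 := ascents_nonneg χ m
  rw [hk] at h
  constructor
  · intro he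
    have h3 : ascents χ m = 0 := by linarith
    refine ⟨?_, fun i hi => lt_of_ascents_eq_zero h3 hk hi⟩
    rw [h3] at he
    have : (a : ℤ) ∣ b * k := ⟨_, by linarith⟩
    exact Int.natCast_dvd_natCast.1 (hab.dvd_of_dvd_mul_left this)
  · rintro ⟨⟨r, rfl⟩, h4⟩
    have hkm : a * r ≤ m := by
      have : ∑ i ∈ range m, (if χ i then (1 : ℤ) else 0) ≤ ∑ i ∈ range m, 1 :=
        Finset.sum_le_sum fun i _ => by split_ifs <;> simp
      rw [hk] at this; simp at this; exact_mod_cast this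
    have h5 : ascents χ m = 0 := by
      refine Finset.sum_eq_zero fun i hi => ?_
      rw [mem_range] at hi
      rw [if_neg]
      rintro ⟨h6, h7, h8⟩
      rw [h4 _ hi] at h8
      rw [h4 _ (by omega)] at h7
      omega
    have h6 : (∑ i ∈ range m, if χ i then slopeExp a b i else 0) =
        ∑ i ∈ range (a * r), slopeExp a b i := by
      rw [← Finset.sum_filter]
      refine Finset.sum_congr ?_ fun _ _ => rfl
      ext i
      simp only [mem_filter, mem_range]
      constructor
      · rintro ⟨h, h'⟩; exact (h4 i h).1 h'
      · intro h; exact ⟨by omega, (h4 i (by omega)).2 h⟩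
    rw [h5, h6, sum_slopeExp, mul_zero, sub_zero, Int.mul_ediv_cancel']
    · ring
    · exact ⟨r * b, by push_cast; ring⟩

lemma slope_le (ha : 0 < a) (χ : ℕ → Prop) [DecidablePred χ]
    {m k : ℕ} (hk : ∑ i ∈ range m, (if χ i then (1 : ℤ) else 0) = k) :
    a * (∑ i ∈ range m, if χ i then slopeExp a b i else 0) - a * ascents χ m ≤ b * k := by
  have h := slope_inequality (b := b) ha χ m
  have ha' : (0 : ℤ) < a := by omega
  have h1 : (0 : ℤ) ≤ if 0 < m ∧ χ (m - 1) then (m * b) % a else 0 := by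
    have := Int.emod_nonneg (m * b) ha'.ne'
    split_ifs <;> omega
  have h2 := ascents_nonneg χ m
  rw [hk] at h
  linarith

end SlopeExp

/-! ### Restriction of set functions and leading coefficients of `X` -/

section Restr

variable {F : Type} [Field F] [Algebra Kq F] {I : Type} [Fintype I] [DecidableEq I]

namespace Tw

/-- The restriction of a set function to the subsets of `R`. -/
def restr {κ : I → I → F} (κ' : I → I → F) (R : Finset I) (f : Tw κ) : Tw κ' :=
  fun S => if S ⊆ R then f S else 0

variable {κ κ' : I → I → F} {R : Finset I}

lemma restr_apply (f : Tw κ) (S : Finset I) :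
    restr κ' R f S = if S ⊆ R then f S else 0 := rfl

lemma restr_mul (h : ∀ i ∈ R, ∀ j ∈ R, κ i j = κ' i j) (f g : Tw κ) :
    restr κ' R (f * g) = restr κ' R f * restr κ' R g := by
  ext S
  rw [restr_apply, mul_apply, mul_apply]
  split_ifs with hS
  · refine Finset.sum_congr rfl fun U hU => ?_
    have h1 : U ⊆ R := (mem_powerset.1 hU).trans hS
    have h2 : S \ U ⊆ R := sdiff_subset.trans hS
    rw [restr_apply, restr_apply, if_pos h1, if_pos h2]
    congr 1
    exact Finset.prod_congr rfl fun i hi => Finset.prod_congr rfl fun j hj => h i (h1 hi) j (h2 hj)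
  · symm
    refine Finset.sum_eq_zero fun U hU => ?_
    rw [restr_apply, restr_apply]
    by_cases h1 : U ⊆ R
    · rw [if_neg (fun h2 : S \ U ⊆ R => hS ?_)]
      · ring
      · rw [← union_sdiff_of_subset (mem_powerset.1 hU)]; exact union_subset h1 h2
    · rw [if_neg h1]; ring

lemma restr_scale (w : ℕ → F) (f : Tw κ) : restr κ' R (scale w f) = scale w (restr κ' R f) := by
  ext S; simp only [restr_apply, scale_apply]; split_ifs <;> simp

lemma restr_sub (f g : Tw κ) : restr κ' R (f - g) = restr κ' R f - restr κ' R g := by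
  ext S; simp only [restr_apply, sub_apply]; split_ifs <;> simp

/-- A product of restrictions to complementary sets. -/
lemma restr_mul_restr (f g : Tw κ) (S : Finset I) :
    (restr κ' R f * restr κ' Rᶜ g) S = f (S ∩ R) * g (S \ R) * cross κ' (S ∩ R) (S \ R) := by
  rw [mul_apply, Finset.sum_eq_single (S ∩ R)]
  · rw [restr_apply, restr_apply, if_pos inter_subset_right, if_pos, sdiff_inter_self_left]
    rw [sdiff_inter_self_left]
    intro x hx; simp at hx ⊢; exact hx.2
  · intro U hU hne
    rw [mem_powerset] at hU
    rw [restr_apply, restr_apply]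
    by_cases h1 : U ⊆ R
    · rw [if_neg (fun h2 : S \ U ⊆ Rᶜ => hne ?_)]
      · ring
      · ext x
        rw [mem_inter]
        constructor
        · intro hx; exact ⟨hU hx, h1 hx⟩
        · rintro ⟨hx, hx'⟩
          by_contra hxU
          have := h2 (mem_sdiff.2 ⟨hx, hxU⟩)
          rw [mem_compl] at this; exact this hx'
    · rw [if_neg h1]; ring
  · intro h; exact absurd (mem_powerset.2 inter_subset_left) h

lemma restr_commute (h : ∀ i ∈ R, ∀ j ∉ R, κ' i j = κ' j i) (f g : Tw κ) :
    Commute (restr κ' R f) (restr κ' Rᶜ g) := by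
  change _ * _ = _ * _
  ext S
  have e := restr_mul_restr (κ' := κ') (R := Rᶜ) g f S
  rw [compl_compl] at e
  have e1 : S ∩ Rᶜ = S \ R := by ext x; simp
  have e2 : S \ Rᶜ = S ∩ R := by ext x; simp
  rw [restr_mul_restr, e, e1, e2, mul_comm (g _)]
  congr 1
  rw [cross, cross, Finset.prod_comm]
  exact Finset.prod_congr rfl fun j hj => Finset.prod_congr rfl fun i hi =>
    h i (mem_inter.1 hi).2 j (mem_sdiff.1 hj).2

end Tw

variable (T : Finset I) (v : I → Fˣ)

lemma kap_eq_kap0 : ∀ i ∈ T, ∀ j ∈ T, kap v i j = kap0 T v i j := by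
  intro i hi j hj
  rw [kap, kap0, if_pos (by simp [hi, hj])]

lemma kap_eq_kap0_compl : ∀ i ∈ Tᶜ, ∀ j ∈ Tᶜ, kap v i j = kap0 T v i j := by
  intro i hi j hj
  rw [mem_compl] at hi hj
  rw [kap, kap0, if_pos (by simp [hi, hj])]

lemma kap0_symm : ∀ i ∈ T, ∀ j ∉ T, kap0 T v i j = kap0 T v j i := fun i hi j hj =>
  kap0_comm (by simp [hi, hj])

/-- The set function of `∑_t x_t`, where `x_t` has the exponents of slope `b / a` in degree `a t`. -/
def X (c : Fin 3) (a : ℕ) (b : ℤ) (v : I → Fˣ) : Tw (kap v) :=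
  fun S => if a ∣ #S then M c #S (slopeExp a b) v S else 0

variable {T v}

lemma sum_diffSide {m : ℕ} (o : Fin m → I) :
    ∑ i, ∑ j, (if i < j then diffSide T (o i) (o j) else 0) =
      (∑ i, if o i ∈ T then 1 else 0) * ∑ i, if o i ∈ T then 0 else 1 := by
  have h1 : ∀ i j, diffSide T i j = (if i ∈ T then 1 else 0) * (if j ∈ T then 0 else 1) +
      (if i ∈ T then 0 else 1) * (if j ∈ T then 1 else 0) := by
    intro i j
    by_cases hi : i ∈ T <;> by_cases hj : j ∈ T <;> simp [diffSide, hi, hj]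
  have h2 : ∑ i, ∑ j, diffSide T (o i) (o j) =
      2 * ((∑ i, if o i ∈ T then 1 else 0) * ∑ i, if o i ∈ T then 0 else 1) := by
    simp only [h1, ← Finset.mul_sum, Finset.sum_add_distrib, ← Finset.sum_mul]
    ring
  have h3 : ∑ i, ∑ j, diffSide T (o i) (o j) =
      ∑ i, ∑ j, (if i < j then diffSide T (o i) (o j) else 0) +
        ∑ i, ∑ j, (if i < j then diffSide T (o i) (o j) else 0) := by
    conv_rhs => rhs; rw [Finset.sum_comm]
    rw [← Finset.sum_add_distrib]
    refine Finset.sum_congr rfl fun i _ => ?_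
    rw [← Finset.sum_add_distrib]
    refine Finset.sum_congr rfl fun j _ => ?_
    rcases lt_trichotomy i j with h | h | h
    · rw [if_pos h, if_neg h.not_gt, add_zero]
    · subst h; simp [diffSide]
    · rw [if_neg h.not_gt, if_pos h, zero_add]
      simp only [diffSide, iff_comm]
  linarith

lemma sum_ascents {m : ℕ} (o : Fin m → I) (χ : ℕ → Prop) [DecidablePred χ]
    (hχ : ∀ i : Fin m, χ i ↔ o i ∈ T) :
    ∑ i : Fin m, ∑ j : Fin m, (if i < j then
      (if (i : ℕ) + 1 = j ∧ o i ∉ T ∧ o j ∈ T then (1 : ℤ) else 0) else 0) = ascents χ m := by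
  rw [ascents, ← Fin.sum_univ_eq_sum_range
    (fun i => if 0 < i ∧ ¬ χ (i - 1) ∧ χ i then (1 : ℤ) else 0), Finset.sum_comm]
  refine Finset.sum_congr rfl fun j _ => ?_
  by_cases h0 : (j : ℕ) = 0
  · rw [if_neg (by omega)]
    refine Finset.sum_eq_zero fun i _ => ?_
    rw [if_neg]; rw [Fin.lt_def]; omega
  · rw [Finset.sum_eq_single ⟨j - 1, by omega⟩]
    · rw [if_pos (by rw [Fin.lt_def]; simp; omega)]
      have := hχ ⟨j - 1, by omega⟩
      simp only at this
      simp only [← hχ, show (j : ℕ) - 1 + 1 = j by omega, true_and, show 0 < (j : ℕ) by omega]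
    · intro i _ hi
      split_ifs with h1 h2
      · exfalso; apply hi; ext; simp; omega
      · rfl
      · rfl
    · simp

/-- The leading coefficient of the weight of an ordering. The maximal weight `slopeWt` is attained if
and only if the variables from `T` come first and their number is divisible by `a`; in this case the
ordering splits into an ordering of `S ∩ T` and one of `S \ T`. -/
lemma lead_wt {a : ℕ} {b : ℤ} (ha : 0 < a) (hab : IsCoprime (a : ℤ) b) (c : Fin 3) {k l : ℕ}
    {S : Finset I} (hk : #(S ∩ T) = k) (hl : #(S \ T) = l) {o : Fin (k + l) ↪ I}
    (ho : univ.map o = S) :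
    Lead (wt c (slopeExp a b) (scaled (a : ℤ) T v) o) (slopeWt a b T S)
      (if a ∣ k ∧ ∀ i, (o i ∈ T ↔ (i : ℕ) < k) then
        wt c (slopeExp a b) v ((Fin.castAddEmb l).trans o) *
          wt c (slopeExp a b) v ((Fin.natAddEmb k).trans o) *
          cross (kap0 T v) (univ.map ((Fin.castAddEmb l).trans o))
            (univ.map ((Fin.natAddEmb k).trans o)) else 0) := by
  classical
  have ha' : (0 : ℤ) < a := by omega
  set χ : ℕ → Prop := fun i => ∃ h : i < k + l, o ⟨i, h⟩ ∈ T with hχd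
  have hχ : ∀ i : Fin (k + l), χ i ↔ o i ∈ T := fun i =>
    ⟨fun ⟨_, h⟩ => h, fun h => ⟨i.2, h⟩⟩
  have hsumT : ∀ f : ℕ → ℤ, (∑ i : Fin (k + l), if o i ∈ T then f i else 0) =
      ∑ i ∈ range (k + l), if χ i then f i else 0 := by
    intro f
    rw [← Fin.sum_univ_eq_sum_range (fun i => if χ i then f i else 0)]
    exact Finset.sum_congr rfl fun i _ => by simp only [hχ]
  have hcount : (∑ i : Fin (k + l), if o i ∈ T then (1 : ℤ) else 0) = k := by
    rw [show (k : ℤ) = #(S ∩ T) by rw [hk], ← filter_mem_eq_inter, ← Finset.sum_boole, ← ho,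
      Finset.sum_map]
  have hcount' : (∑ i : Fin (k + l), if o i ∈ T then (0 : ℤ) else 1) = l := by
    rw [show (l : ℤ) = #(S \ T) by rw [hl], ← filter_notMem_eq_sdiff, ← Finset.sum_boole, ← ho,
      Finset.sum_map]
    exact Finset.sum_congr rfl fun i _ => by split_ifs <;> rfl
  have hkr : ∑ i ∈ range (k + l), (if χ i then (1 : ℤ) else 0) = k := by
    rw [← hsumT (fun _ => 1), hcount]
  choose y hy hy' using fun i j : Fin (k + l) => lead_link ha' c T v i j (o i) (o j)
  have hlead : Lead (wt c (slopeExp a b) (scaled (a : ℤ) T v) o)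
      (∑ i : Fin (k + l), slopeExp a b i * (if o i ∈ T then (a : ℤ) else 0) +
        ∑ i : Fin (k + l), ∑ j : Fin (k + l), if i < j then (a * (diffSide T (o i) (o j) -
          if (i : ℕ) + 1 = j ∧ o i ∉ T ∧ o j ∈ T then 1 else 0) : ℤ) else 0)
      (((∏ i : Fin (k + l), v (o i) ^ slopeExp a b i : Fˣ) : F) *
        ∏ i, ∏ j, if i < j then y i j else 1) := by
    rw [wt]
    refine Lead.mul ?_ (Lead.prod _ fun i _ => Lead.prod _ fun j _ => ?_)
    · push_cast
      exact Lead.prod _ fun i _ => (lead_scaled _ T v (o i)).zpow (Units.ne_zero _) _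
    · by_cases hij : i < j
      · rw [if_pos hij, if_pos hij, if_pos hij]; exact hy i j
      · rw [if_neg hij, if_neg hij, if_neg hij]; exact Lead.one
  -- The weight in terms of the places at which the ordering enters `T`, which is bounded by
  -- `slope_le`, with the cases of equality given by `slope_eq_iff`.
  have hw : (∑ i : Fin (k + l), slopeExp a b i * (if o i ∈ T then (a : ℤ) else 0) +
        ∑ i : Fin (k + l), ∑ j : Fin (k + l), if i < j then (a * (diffSide T (o i) (o j) -
          if (i : ℕ) + 1 = j ∧ o i ∉ T ∧ o j ∈ T then 1 else 0) : ℤ) else 0) =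
      a * (∑ i ∈ range (k + l), if χ i then slopeExp a b i else 0) - a * ascents χ (k + l)
        + a * (k * l) := by
    have e1 : ∑ i : Fin (k + l), slopeExp a b i * (if o i ∈ T then (a : ℤ) else 0) =
        a * (∑ i ∈ range (k + l), if χ i then slopeExp a b i else 0) := by
      rw [← hsumT, Finset.mul_sum]
      exact Finset.sum_congr rfl fun i _ => by split_ifs <;> ring
    have e2 := sum_diffSide (T := T) o
    have e3 := sum_ascents (T := T) o χ hχ
    rw [hcount, hcount'] at e2
    rw [e1, ← e2, ← e3, sub_add, ← mul_sub, ← Finset.sum_sub_distrib, sub_eq_add_neg, ← mul_neg,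
      ← Finset.sum_neg_distrib]
    congr 1
    rw [Finset.mul_sum]
    refine Finset.sum_congr rfl fun i _ => ?_
    rw [← Finset.sum_sub_distrib, ← Finset.sum_neg_distrib, Finset.mul_sum]
    refine Finset.sum_congr rfl fun j _ => ?_
    by_cases hij : i < j
    · rw [if_pos hij, if_pos hij, if_pos hij]; ring
    · rw [if_neg hij, if_neg hij, if_neg hij]; ring
  have hS : slopeWt a b T S = b * k + a * (k * l) := by
    rw [slopeWt, hk, hl]; ring
  rw [hw] at hlead
  have hiff := slope_eq_iff ha hab χ hkr
  have hcond : (∀ i < k + l, (χ i ↔ i < k)) ↔ ∀ i : Fin (k + l), (o i ∈ T ↔ (i : ℕ) < k) := by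
    constructor
    · intro h i; rw [← hχ]; exact h i i.2
    · intro h i hi; rw [hχ ⟨i, hi⟩]; exact h ⟨i, hi⟩
  rw [hcond] at hiff
  by_cases hgood : a ∣ k ∧ ∀ i : Fin (k + l), (o i ∈ T ↔ (i : ℕ) < k)
  · rw [if_pos hgood]
    rw [hiff.2 hgood, ← hS] at hlead
    convert hlead using 1
    obtain ⟨hak, hpos⟩ := hgood
    have hyv : ∀ i j : Fin (k + l), i < j → y i j = if (o i ∈ T ↔ o j ∈ T) then
        link c i j ((v (o i) / v (o j) : Fˣ) : F) else kap0 T v (o i) (o j) := by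
      intro i j hij
      apply hy'
      rintro ⟨h1, h2, h3⟩
      rw [hpos] at h2 h3
      omega
    have hmon : (∏ i : Fin (k + l), v (o i) ^ slopeExp a b i) =
        (∏ i, v (o (Fin.castAdd l i)) ^ slopeExp a b i) *
          ∏ i, v (o (Fin.natAdd k i)) ^ slopeExp a b i := by
      rw [Fin.prod_univ_add]
      congr 1
      exact Finset.prod_congr rfl fun i _ => by rw [Fin.val_natAdd, slopeExp_add ha hak]
    have hT1 : ∀ i : Fin k, o (Fin.castAdd l i) ∈ T := fun i => (hpos _).2 (by simp)
    have hT2 : ∀ i : Fin l, o (Fin.natAdd k i) ∉ T := fun i => by rw [hpos]; simp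
    have hK : (∏ i, ∏ j, if i < j then y i j else 1) =
        (∏ i : Fin k, ∏ j : Fin k, if i < j then link c i j
          ((v (o (Fin.castAdd l i)) / v (o (Fin.castAdd l j)) : Fˣ) : F) else 1) *
        (∏ i : Fin k, ∏ j : Fin l, kap0 T v (o (Fin.castAdd l i)) (o (Fin.natAdd k j))) *
        (∏ i : Fin l, ∏ j : Fin l, if i < j then link c i j
          ((v (o (Fin.natAdd k i)) / v (o (Fin.natAdd k j)) : Fˣ) : F) else 1) := by
      rw [Fin.prod_univ_add]
      have hsp : ∀ f : Fin (k + l) → F, ∏ j, f j =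
          (∏ j, f (Fin.castAdd l j)) * ∏ j, f (Fin.natAdd k j) := Fin.prod_univ_add
      simp only [hsp, Finset.prod_mul_distrib]
      congr 1
      · congr 1
        · refine Finset.prod_congr rfl fun i _ => Finset.prod_congr rfl fun j _ => ?_
          by_cases hij : i < j
          · have hij' : Fin.castAdd l i < Fin.castAdd l j := hij
            rw [if_pos hij, if_pos hij', hyv _ _ hij', if_pos (by simp [hT1])]
            simp
          · rw [if_neg hij, if_neg (show ¬ (Fin.castAdd l i < Fin.castAdd l j) from hij)]
        · refine Finset.prod_congr rfl fun i _ => Finset.prod_congr rfl fun j _ => ?_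
          have hij' : Fin.castAdd l i < Fin.natAdd k j := by rw [Fin.lt_def]; simp; omega
          rw [if_pos hij', hyv _ _ hij', if_neg (by simp [hT1, hT2])]
      · rw [Finset.prod_eq_one, one_mul]
        · refine Finset.prod_congr rfl fun i _ => Finset.prod_congr rfl fun j _ => ?_
          by_cases hij : i < j
          · have hij' : Fin.natAdd k i < Fin.natAdd k j := by simpa using hij
            rw [if_pos hij, if_pos hij', hyv _ _ hij', if_pos (by simp [hT2])]
            simp only [link, Fin.val_natAdd]
            congr 1
            simp only [eq_iff_iff]
            omega
          · rw [if_neg hij, if_neg (by simpa using hij)]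
        · refine fun i _ => Finset.prod_eq_one fun j _ => ?_
          rw [if_neg]
          rw [Fin.lt_def]; simp; omega
    have hcr : cross (kap0 T v) (univ.map ((Fin.castAddEmb l).trans o))
        (univ.map ((Fin.natAddEmb k).trans o)) =
        ∏ i : Fin k, ∏ j : Fin l, kap0 T v (o (Fin.castAdd l i)) (o (Fin.natAdd k j)) := by
      rw [cross, Finset.prod_map]
      simp only [Finset.prod_map]
      rfl
    have w1 : wt c (slopeExp a b) v ((Fin.castAddEmb l).trans o) =
        ((∏ i, v (o (Fin.castAdd l i)) ^ slopeExp a b i : Fˣ) : F) *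
          ∏ i : Fin k, ∏ j : Fin k, if i < j then link c i j
          ((v (o (Fin.castAdd l i)) / v (o (Fin.castAdd l j)) : Fˣ) : F) else 1 := rfl
    have w2 : wt c (slopeExp a b) v ((Fin.natAddEmb k).trans o) =
        ((∏ i, v (o (Fin.natAdd k i)) ^ slopeExp a b i : Fˣ) : F) *
          ∏ i : Fin l, ∏ j : Fin l, if i < j then link c i j
          ((v (o (Fin.natAdd k i)) / v (o (Fin.natAdd k j)) : Fˣ) : F) else 1 := rfl
    rw [hK, hmon, hcr, w1, w2, Units.val_mul]
    ring
  · rw [if_neg hgood]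
    refine hlead.mono ?_
    rw [hS]
    have h1 := slope_le (b := b) ha χ hkr
    have h2 := fun h => hgood (hiff.1 h)
    have := lt_of_le_of_ne h1 h2
    linarith

lemma X_empty (c : Fin 3) (a : ℕ) (b : ℤ) : X c a b v ∅ = 1 := by
  rw [X, card_empty, if_pos (dvd_zero a), M_zero, Tw.one_apply, if_pos rfl]

/-- The leading coefficients of `X` factor: those orderings contribute that meet the variables from `T`
first, and they are pairs of orderings. -/
lemma rel_X {a : ℕ} {b : ℤ} (ha : 0 < a) (hab : IsCoprime (a : ℤ) b) (c : Fin 3) :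
    Rel a b T v (X c a b (scaled (a : ℤ) T v))
      (Tw.restr (kap0 T v) T (X c a b v) * Tw.restr (kap0 T v) Tᶜ (X c a b v)) := by
  intro S
  rw [Tw.restr_mul_restr]
  obtain ⟨k, hk⟩ : ∃ k, #(S ∩ T) = k := ⟨_, rfl⟩
  obtain ⟨l, hl⟩ : ∃ l, #(S \ T) = l := ⟨_, rfl⟩
  have hkl : #S = k + l := by rw [← hk, ← hl]; exact (card_inter_add_card_sdiff S T).symm
  simp only [X, hk, hl, hkl]
  by_cases hd : a ∣ k + l
  · rw [if_pos hd, M_apply]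
    have h := Lead.sum (ords (k + l) S) (fun o ho =>
      lead_wt (v := v) ha hab c hk hl (mem_ords.1 ho))
    convert h using 1
    by_cases hak : a ∣ k
    · have hal : a ∣ l := (Nat.dvd_add_right hak).1 hd
      rw [if_pos hak, if_pos hal]
      have h2 := sum_ords_split k l S (fun o₁ o₂ => if univ.map o₁ = S ∩ T then
        wt c (slopeExp a b) v o₁ * wt c (slopeExp a b) v o₂ *
          cross (kap0 T v) (univ.map o₁) (univ.map o₂) else 0)
      have h3 : ∀ o ∈ ords (k + l) S, (a ∣ k ∧ ∀ i, (o i ∈ T ↔ (i : ℕ) < k)) ↔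
          univ.map ((Fin.castAddEmb l).trans o) = S ∩ T := by
        intro o ho
        rw [mem_ords] at ho
        constructor
        · rintro ⟨_, h⟩
          apply eq_of_subset_of_card_le
          · intro x hx
            simp only [mem_map, mem_univ, true_and] at hx
            obtain ⟨i, rfl⟩ := hx
            rw [mem_inter]
            refine ⟨ho ▸ mem_map_of_mem _ (mem_univ _), (h _).2 (by simp)⟩
          · rw [card_map, hk]; simp
        · intro h
          refine ⟨hak, fun i => ?_⟩
          constructor
          · intro hi
            have : o i ∈ S ∩ T := mem_inter.2 ⟨ho ▸ mem_map_of_mem _ (mem_univ _), hi⟩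
            rw [← h] at this
            simp only [mem_map, mem_univ, true_and] at this
            obtain ⟨j, hj⟩ := this
            rw [← o.injective hj]; simp
          · intro hi
            have : o i ∈ univ.map ((Fin.castAddEmb l).trans o) := by
              rw [mem_map]; exact ⟨⟨i, hi⟩, mem_univ _, rfl⟩
            rw [h] at this; exact (mem_inter.1 this).2
      have h4 : ∀ o ∈ ords (k + l) S, (if a ∣ k ∧ ∀ i, (o i ∈ T ↔ (i : ℕ) < k) then
          wt c (slopeExp a b) v ((Fin.castAddEmb l).trans o) *
          wt c (slopeExp a b) v ((Fin.natAddEmb k).trans o) *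
          cross (kap0 T v) (univ.map ((Fin.castAddEmb l).trans o))
            (univ.map ((Fin.natAddEmb k).trans o)) else 0) =
          if univ.map ((Fin.castAddEmb l).trans o) = S ∩ T then
          wt c (slopeExp a b) v ((Fin.castAddEmb l).trans o) *
          wt c (slopeExp a b) v ((Fin.natAddEmb k).trans o) *
          cross (kap0 T v) (univ.map ((Fin.castAddEmb l).trans o))
            (univ.map ((Fin.natAddEmb k).trans o)) else 0 := by
        intro o ho
        exact if_congr (h3 o ho) rfl rfl
      rw [Finset.sum_congr rfl h4, ← h2, Finset.sum_eq_single (S ∩ T)]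
      · rw [sdiff_inter_self_left, M_apply, M_apply, Finset.sum_mul_sum, Finset.sum_mul]
        refine Finset.sum_congr rfl fun o₁ h1 => ?_
        rw [Finset.sum_mul]
        refine Finset.sum_congr rfl fun o₂ h2 => ?_
        rw [mem_ords] at h1 h2
        rw [if_pos h1, h1, h2]
      · intro U _ hU
        refine Finset.sum_eq_zero fun o₁ h1 => Finset.sum_eq_zero fun o₂ _ => ?_
        rw [mem_ords] at h1
        rw [if_neg (h1 ▸ hU)]
      · intro h; exact absurd (mem_powerset.2 inter_subset_left) h
    · rw [if_neg hak, zero_mul, zero_mul]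
      symm
      exact Finset.sum_eq_zero fun o _ => if_neg fun h => hak h.1
  · rw [if_neg hd]
    have : ¬ (a ∣ k ∧ a ∣ l) := fun h => hd (dvd_add h.1 h.2)
    by_cases hak : a ∣ k
    · rw [if_neg (fun hal => this ⟨hak, hal⟩), mul_zero, zero_mul]; exact Lead.zero _
    · rw [if_neg hak, zero_mul, zero_mul]; exact Lead.zero _

end Restr

/-! ### The logarithmic derivative of `X` -/

section Total

variable {I F : Type} [DecidableEq I] [Field F] {κ : I → I → F}

namespace Tw

/-- The sum of a sequence of set functions, the `t`-th of which lives on sets of size `a t`. -/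
def total (a : ℕ) (f : ℕ → Tw κ) : Tw κ := fun S => if a ∣ #S then f (#S / a) S else 0

lemma total_apply {a : ℕ} (ha : 0 < a) (f : ℕ → Tw κ) {S : Finset I} {t : ℕ} (h : #S = a * t) :
    total a f S = f t S := by
  rw [total, h, if_pos (dvd_mul_right a t), Nat.mul_div_cancel_left t ha]

lemma total_of_not_dvd {a : ℕ} (f : ℕ → Tw κ) {S : Finset I} (h : ¬ a ∣ #S) :
    total a f S = 0 := if_neg h

lemma total_mul {a : ℕ} (ha : 0 < a) (f g : ℕ → Tw κ) (hf : ∀ t S, #S ≠ a * t → f t S = 0) :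
    total a f * total a g = total a fun t => ∑ p ∈ antidiagonal t, f p.1 * g p.2 := by
  ext S
  by_cases hd : a ∣ #S
  · obtain ⟨t, ht⟩ := hd
    rw [total_apply ha _ ht, sum_apply, mul_apply]
    simp only [mul_apply]
    rw [Finset.sum_comm]
    refine Finset.sum_congr rfl fun U hU => ?_
    have hc := card_add (mem_powerset.1 hU)
    by_cases h1 : a ∣ #U
    · obtain ⟨k, hk⟩ := h1
      have h2 : a ∣ #(S \ U) := (Nat.dvd_add_right (⟨k, hk⟩ : a ∣ #U)).1 (hc ▸ ⟨t, ht⟩)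
      obtain ⟨l, hl⟩ := h2
      have hkl : k + l = t := by
        rw [hk, hl, ht, ← mul_add] at hc; exact Nat.eq_of_mul_eq_mul_left ha hc
      rw [total_apply ha _ hk, total_apply ha _ hl, Finset.sum_eq_single (k, l)]
      · intro p hp hne
        rw [hf p.1 U, zero_mul, zero_mul]
        intro h
        apply hne
        rw [HasAntidiagonal.mem_antidiagonal] at hp
        have : p.1 = k := Nat.eq_of_mul_eq_mul_left ha (by rw [← h, hk])
        ext <;> simp <;> omega
      · intro h; exact absurd (HasAntidiagonal.mem_antidiagonal.2 hkl) h
    · rw [total_of_not_dvd _ h1, zero_mul, zero_mul]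
      symm
      refine Finset.sum_eq_zero fun p _ => ?_
      rw [hf p.1 U (fun h => h1 ⟨_, h⟩), zero_mul, zero_mul]
  · rw [total_of_not_dvd _ hd, mul_supp (a := a) (fun S hS => total_of_not_dvd f hS)
      (fun S hS => total_of_not_dvd g hS) S hd]

end Tw

end Total

section Dlog

variable {I : Type} [Fintype I] [DecidableEq I] {F : Type} [Field F] [Algebra Kq F]

/-- The set function of `P_{at,bt}` (with `q₂` replaced by `q_c`). -/
def PP (c : Fin 3) (a : ℕ) (b : ℤ) (t : ℕ) (v : I → Fˣ) : Tw (kap v) :=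
  ∑ s ∈ range t, ((fcol F c : F)⁻¹ ^ s) •
    M c (a * t) (slopeExp a b + ∑ r ∈ Ico (t - s) t, jump (a * r)) v

lemma PP_of_card_ne (c : Fin 3) (a : ℕ) (b : ℤ) {t : ℕ} (v : I → Fˣ) {S : Finset I}
    (h : #S ≠ a * t) : PP c a b t v S = 0 := by
  rw [PP, Tw.sum_apply]
  exact Finset.sum_eq_zero fun s _ => by rw [Tw.smul_apply, M_of_card_ne c _ v h, mul_zero]

lemma X_eq_total (c : Fin 3) (a : ℕ) (b : ℤ) (v : I → Fˣ) :
    X c a b v = Tw.total a fun t => M c (a * t) (slopeExp a b) v := by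
  ext S
  rw [X, Tw.total]
  split_ifs with h
  · rw [Nat.mul_div_cancel' h]
  · rfl

lemma app_slopeExp {a : ℕ} {b : ℤ} (ha : 0 < a) (t s : ℕ) :
    app (a * t) (slopeExp a b + ∑ r ∈ Ico (t - s) t, jump (a * r)) (slopeExp a b) =
      slopeExp a b + ∑ r ∈ Ico (t - s) t, jump (a * r) := by
  ext i
  rw [app]
  split_ifs with h
  · rfl
  · rw [Pi.add_apply, Finset.sum_apply, Finset.sum_eq_zero, add_zero,
      ← slopeExp_add ha (dvd_mul_right a t), Nat.add_sub_cancel' (not_lt.1 h)]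
    intro r hr
    rw [mem_Ico] at hr
    have : a * r < a * t := Nat.mul_lt_mul_of_pos_left hr.2 ha
    rw [jump, if_neg (by omega), if_neg (by omega), sub_zero]

/-- A telescoping sum: `∑ P_t X_{T-t} = T X_T`. -/
lemma sum_PP_mul {a : ℕ} (ha : 0 < a) (c : Fin 3) (b : ℤ) (v : I → Fˣ) (T : ℕ) :
    ∑ p ∈ antidiagonal T, PP c a b p.1 v * M c (a * p.2) (slopeExp a b) v =
      (T : F) • M c (a * T) (slopeExp a b) v := by
  set A : ℕ → ℕ → Tw (kap v) := fun t s => ((fcol F c : F)⁻¹ ^ s) •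
    M c (a * T) (slopeExp a b + ∑ r ∈ Ico (t - s) t, jump (a * r)) v with hA
  have hA0 : ∀ t, A t 0 = M c (a * T) (slopeExp a b) v := by intro t; simp [hA]
  rw [Finset.Nat.sum_antidiagonal_eq_sum_range_succ
    (fun i j => PP c a b i v * M c (a * j) (slopeExp a b) v), Finset.sum_range_succ, Nat.sub_self,
    mul_zero, M_zero, mul_one]
  have h1 : ∀ t ∈ range T, PP c a b t v * M c (a * (T - t)) (slopeExp a b) v =
      ((∑ s ∈ range t, A t s) - ∑ s ∈ range (t + 1), A (t + 1) s) +
        M c (a * T) (slopeExp a b) v := by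
    intro t ht
    rw [mem_range] at ht
    rw [Finset.sum_range_succ', hA0, PP, Finset.sum_mul, sub_add, add_sub_cancel_right,
      ← Finset.sum_sub_distrib]
    refine Finset.sum_congr rfl fun s hs => ?_
    rw [mem_range] at hs
    have h2 : a * t + a * (T - t) = a * T := by rw [← mul_add]; congr 1; omega
    have h3 : (∑ r ∈ Ico (t - s) t, jump (a * r)) + jump (a * t) =
        ∑ r ∈ Ico (t + 1 - (s + 1)) (t + 1), jump (a * r) := by
      rw [Finset.sum_Ico_succ_top (by omega)]; congr 3; omega
    have hne : a * t ≠ 0 := by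
      have : 0 < a * t := Nat.mul_pos ha (by omega)
      omega
    have hne' : a * (T - t) ≠ 0 := by
      have : 0 < a * (T - t) := Nat.mul_pos ha (by omega)
      omega
    rw [Tw.smul_mul', M_mul_M c hne hne', h2, app_slopeExp ha, add_assoc, h3, smul_sub, smul_smul,
      ← pow_succ]
  rw [Finset.sum_congr rfl h1, Finset.sum_add_distrib,
    Finset.sum_range_sub' (fun t => ∑ s ∈ range t, A t s), Finset.sum_const, card_range]
  have h4 : PP c a b T v = ∑ s ∈ range T, A T s := rfl
  rw [h4, Finset.sum_range_zero, zero_sub, ← Nat.cast_smul_eq_nsmul F]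
  abel

/-- The set function of `∑_t a P_{at,bt}`. -/
def dlog (c : Fin 3) (a : ℕ) (b : ℤ) (v : I → Fˣ) : Tw (kap v) :=
  (a : F) • Tw.total a fun t => PP c a b t v

/-- `dlog` is the logarithmic derivative of `X`. -/
lemma dlog_mul_X {a : ℕ} (ha : 0 < a) (c : Fin 3) (b : ℤ) (v : I → Fˣ) :
    dlog c a b v * X c a b v = Tw.scale (fun m => (m : F)) (X c a b v) := by
  rw [dlog, Tw.smul_mul', X_eq_total, Tw.total_mul ha _ _ fun t S h => PP_of_card_ne c a b v h]
  simp only [sum_PP_mul ha]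
  ext S
  rw [Tw.smul_apply, Tw.scale_apply]
  by_cases hd : a ∣ #S
  · obtain ⟨t, ht⟩ := hd
    rw [Tw.total_apply ha _ ht, Tw.total_apply ha _ ht, Tw.smul_apply, ht]
    push_cast; ring
  · rw [Tw.total_of_not_dvd _ hd, Tw.total_of_not_dvd _ hd, mul_zero, mul_zero]

lemma part_dlog {a : ℕ} (ha : 0 < a) (c : Fin 3) (b : ℤ) (v : I → Fˣ) (t : ℕ) :
    Tw.part (a * t) (dlog c a b v) = (a : F) • PP c a b t v := by
  ext S
  rw [Tw.part_apply, Tw.smul_apply]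
  split_ifs with h
  · rw [dlog, Tw.smul_apply, Tw.total_apply ha _ h]
  · rw [PP_of_card_ne c a b v h, mul_zero]

variable {T : Finset I} {v : I → Fˣ}

/-- `dlog` is primitive for the leading coefficients. -/
lemma rel_dlog {a : ℕ} {b : ℤ} (ha : 0 < a) (hab : IsCoprime (a : ℤ) b) (c : Fin 3) :
    Rel a b T v (dlog c a b (scaled (a : ℤ) T v))
      (Tw.restr (kap0 T v) T (dlog c a b v) + Tw.restr (kap0 T v) Tᶜ (dlog c a b v)) := by
  have ha' : (0 : ℤ) < a := by omega
  have hX := rel_X (T := T) (v := v) ha hab c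
  have hN := hX.scale
  rw [← dlog_mul_X ha] at hN
  obtain ⟨p, hp⟩ := Rel.of_mul ha' (X_empty c a b) hX hN
  have h1 := (hp.mul ha' hX).unique hN
  have e1 := congrArg (Tw.restr (kap0 T v) T) (dlog_mul_X ha c b v)
  have e2 := congrArg (Tw.restr (kap0 T v) Tᶜ) (dlog_mul_X ha c b v)
  rw [Tw.restr_mul (kap_eq_kap0 T v), Tw.restr_scale] at e1
  rw [Tw.restr_mul (kap_eq_kap0_compl T v), Tw.restr_scale] at e2
  have hcomm := (Tw.restr_commute (kap0_symm T v) (X c a b v) (dlog c a b v)).eq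
  have h2 : p = Tw.restr (kap0 T v) T (dlog c a b v) + Tw.restr (kap0 T v) Tᶜ (dlog c a b v) := by
    refine Tw.mul_right_cancel_of_empty (g := Tw.restr (kap0 T v) T (X c a b v) *
      Tw.restr (kap0 T v) Tᶜ (X c a b v)) ?_ ?_
    · rw [Tw.mul_empty, Tw.restr_apply, Tw.restr_apply, if_pos (empty_subset _),
        if_pos (empty_subset _), X_empty, one_mul]
      exact one_ne_zero
    · rw [h1, Tw.scale_natCast_mul, ← e1, ← e2, ← mul_assoc _ (Tw.restr _ Tᶜ (dlog c a b v)),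
        hcomm]
      noncomm_ring
  rwa [h2] at hp

lemma rel_part_dlog {a : ℕ} {b : ℤ} (ha : 0 < a) (hab : IsCoprime (a : ℤ) b) (c : Fin 3) (m : ℕ) :
    Rel a b T v (Tw.part m (dlog c a b (scaled (a : ℤ) T v)))
      (Tw.restr (kap0 T v) T (Tw.part m (dlog c a b v)) +
        Tw.restr (kap0 T v) Tᶜ (Tw.part m (dlog c a b v))) := by
  have := (rel_dlog (T := T) (v := v) ha hab c).part m
  convert this using 1
  ext S
  simp only [Tw.add_apply, Tw.restr_apply, Tw.part_apply]
  split_ifs <;> simp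

lemma lead_part_dlog {a : ℕ} {b : ℤ} (ha : 0 < a) (hab : IsCoprime (a : ℤ) b) (c : Fin 3) (m : ℕ)
    {S : Finset I} (h1 : ¬ S ⊆ T) (h2 : ¬ S ⊆ Tᶜ) :
    Lead (Tw.part m (dlog c a b (scaled (a : ℤ) T v)) S) (slopeWt a b T S) 0 := by
  have := rel_part_dlog (T := T) (v := v) ha hab c m S
  rwa [Tw.add_apply, Tw.restr_apply, Tw.restr_apply, if_neg h1, if_neg h2, add_zero] at this

/-- The commutator of two primitive elements is primitive. -/
lemma lead_commutator_dlog {a : ℕ} {b : ℤ} (ha : 0 < a) (hab : IsCoprime (a : ℤ) b) (c : Fin 3)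
    (m k : ℕ) {S : Finset I} (h1 : ¬ S ⊆ T) (h2 : ¬ S ⊆ Tᶜ) :
    Lead ((Tw.part m (dlog c a b (scaled (a : ℤ) T v)) *
        Tw.part k (dlog c a b (scaled (a : ℤ) T v)) -
      Tw.part k (dlog c a b (scaled (a : ℤ) T v)) *
        Tw.part m (dlog c a b (scaled (a : ℤ) T v))) S) (slopeWt a b T S) 0 := by
  have ha' : (0 : ℤ) < a := by omega
  have hm := rel_part_dlog (T := T) (v := v) ha hab c m
  have hk := rel_part_dlog (T := T) (v := v) ha hab c k
  have h := ((hm.mul ha' hk).sub (hk.mul ha' hm)) S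
  set f := Tw.part m (dlog c a b v)
  set g := Tw.part k (dlog c a b v)
  have c1 := (Tw.restr_commute (kap0_symm T v) f g).eq
  have c2 := (Tw.restr_commute (kap0_symm T v) g f).eq
  have e : (Tw.restr (kap0 T v) T f + Tw.restr (kap0 T v) Tᶜ f) *
        (Tw.restr (kap0 T v) T g + Tw.restr (kap0 T v) Tᶜ g) -
      (Tw.restr (kap0 T v) T g + Tw.restr (kap0 T v) Tᶜ g) *
        (Tw.restr (kap0 T v) T f + Tw.restr (kap0 T v) Tᶜ f) =
      Tw.restr (kap0 T v) T (f * g - g * f) + Tw.restr (kap0 T v) Tᶜ (f * g - g * f) := by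
    rw [Tw.restr_sub, Tw.restr_sub, Tw.restr_mul (kap_eq_kap0 T v), Tw.restr_mul (kap_eq_kap0 T v),
      Tw.restr_mul (kap_eq_kap0_compl T v), Tw.restr_mul (kap_eq_kap0_compl T v), mul_add, add_mul,
      add_mul, mul_add, add_mul, add_mul, c1, c2]
    abel
  rw [e, Tw.add_apply, Tw.restr_apply, Tw.restr_apply, if_neg h1, if_neg h2, add_zero] at h
  exact h

end Dlog

/-! ### Laurent polynomials in one variable -/

section OneVariable

variable {K : Type} [Field K]

lemma laurentHom_eq_sum {R S σ : Type*} [CommRing R] [CommRing S] [Fintype σ] (f : R →+* S)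
    (u : σ → Sˣ) (x : Laurent R σ) :
    laurentHom f u x = ∑ e ∈ x.coeff.support, f (x.coeff e) * ((∏ i, u i ^ e i : Sˣ) : S) := by
  conv_lhs => rw [← AddMonoidAlgebra.sum_coeff_single x]
  rw [Finsupp.sum, map_sum]
  exact Finset.sum_congr rfl fun e _ => laurentHom_single _ _ _ _

/-- A Laurent polynomial in one variable with many roots, compared to its width, is zero. -/
lemma eq_zero_of_roots (g : Laurent K (Fin 1)) (Z : Finset Kˣ)
    (hZ : ∀ w ∈ Z, laurentHom (RingHom.id K) (fun _ => w) g = 0) (k₀ : ℤ)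
    (hg : ∀ k, g.coeff (fun _ => k) ≠ 0 → k₀ ≤ k ∧ k < k₀ + #Z) : g = 0 := by
  set p : Polynomial K := ∑ j ∈ range #Z, Polynomial.monomial j (g.coeff fun _ => k₀ + j) with hp
  have hp0 : p = 0 := by
    apply Polynomial.eq_zero_of_degree_lt_of_eval_finset_eq_zero
      (s := Z.map ⟨Units.val, Units.val_injective⟩)
    · rw [card_map]
      refine (Polynomial.degree_sum_le _ _).trans_lt ?_
      rw [Finset.sup_lt_iff (WithBot.bot_lt_coe _)]
      intro j hj
      exact (Polynomial.degree_monomial_le _ _).trans_lt (by exact_mod_cast mem_range.1 hj)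
    · intro x hx
      rw [mem_map] at hx
      obtain ⟨w, hw, rfl⟩ := hx
      have h := hZ w hw
      rw [laurentHom_eq_sum] at h
      simp only [Function.Embedding.coeFn_mk]
      rw [hp, Polynomial.eval_finsetSum]
      have h2 : ∑ e ∈ g.coeff.support, RingHom.id K (g.coeff e) *
          ((∏ i : Fin 1, w ^ e i : Kˣ) : K) = ∑ j ∈ range #Z, g.coeff (fun _ => k₀ + j) *
            ((w ^ (k₀ + j : ℤ) : Kˣ) : K) := by
        have hsub : g.coeff.support ⊆ (range #Z).map
            ⟨fun j : ℕ => (fun _ : Fin 1 => k₀ + (j : ℤ)), fun i j h => by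
              have := congrFun h 0; simpa using this⟩ := by
          intro e he
          rw [Finsupp.mem_support_iff] at he
          have he' : e = fun _ => e 0 := by ext i; rw [Subsingleton.elim i 0]
          rw [he'] at he
          have := hg _ he
          rw [mem_map]
          refine ⟨(e 0 - k₀).toNat, ?_, ?_⟩
          · rw [mem_range]; omega
          · rw [he']; funext i
            change k₀ + ((e 0 - k₀).toNat : ℤ) = e 0
            omega
        rw [Finset.sum_subset hsub, Finset.sum_map]
        · refine Finset.sum_congr rfl fun j _ => ?_
          rw [Fin.prod_univ_one]
          rfl
        · intro e _ he
          rw [Finsupp.notMem_support_iff.1 he, map_zero, zero_mul]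
      rw [h2] at h
      have h3 : ∑ j ∈ range #Z, g.coeff (fun _ => k₀ + j) * ((w ^ (k₀ + j : ℤ) : Kˣ) : K) =
          ((w ^ k₀ : Kˣ) : K) * ∑ j ∈ range #Z, g.coeff (fun _ => k₀ + j) * (w : K) ^ j := by
        rw [Finset.mul_sum]
        refine Finset.sum_congr rfl fun j _ => ?_
        rw [zpow_add, zpow_natCast]
        push_cast
        ring
      rw [h3] at h
      simp only [Polynomial.eval_monomial]
      exact (mul_eq_zero.1 h).resolve_left (Units.ne_zero _)
  ext e
  by_contra he
  have he' : e = fun _ => e 0 := by ext i; rw [Subsingleton.elim i 0]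
  have h1 := he
  rw [he'] at h1
  have h2 := hg _ h1
  have h3 := congrArg (fun q => Polynomial.coeff q (e 0 - k₀).toNat) hp0
  simp only [hp, Polynomial.finsetSum_coeff, Polynomial.coeff_monomial, Polynomial.coeff_zero] at h3
  rw [Finset.sum_ite_eq' , if_pos (by rw [mem_range]; omega)] at h3
  apply he
  rw [he']
  have : (k₀ + ((e 0 - k₀).toNat : ℤ)) = e 0 := by omega
  rw [this] at h3
  exact h3

/-- The monomial `η^k`. -/
def etaPow (K : Type) [Field K] (k : ℤ) : (LaurentSeries K)ˣ :=
  Units.mk0 (HahnSeries.single k 1) (by simp)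

lemma etaPow_add (k l : ℤ) : etaPow K (k + l) = etaPow K k * etaPow K l := by
  ext1
  simp [etaPow]

lemma etaPow_zpow (k l : ℤ) : etaPow K k ^ l = etaPow K (k * l) := by
  have h0 : etaPow K 0 = 1 := by ext1; rfl
  have hnat : ∀ (k : ℤ) (n : ℕ), etaPow K k ^ n = etaPow K (k * n) := by
    intro k n
    induction n with
    | zero => simp [h0]
    | succ n ih => rw [pow_succ, ih, ← etaPow_add]; congr 1; push_cast; ring
  have hneg : ∀ k : ℤ, (etaPow K k)⁻¹ = etaPow K (-k) := by
    intro k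
    rw [inv_eq_iff_mul_eq_one, ← etaPow_add, add_neg_cancel, h0]
  cases l with
  | ofNat n => simpa using hnat k n
  | negSucc n =>
    rw [zpow_negSucc, hnat, hneg]
    congr 1
    rw [Int.negSucc_eq]; push_cast; ring

lemma coeff_laurentHom_etaPow (g : Laurent K (Fin 1)) {a : ℤ} (ha : a ≠ 0) (k : ℤ) :
    (laurentHom HahnSeries.C (fun _ => etaPow K a) g : LaurentSeries K).coeff (a * k) =
      g.coeff fun _ => k := by
  rw [laurentHom_eq_sum, HahnSeries.coeff_sum]
  have h : ∀ e : Fin 1 → ℤ, (HahnSeries.C (g.coeff e) *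
      ((∏ i, etaPow K a ^ e i : (LaurentSeries K)ˣ) : LaurentSeries K)).coeff (a * k) =
        if e = fun _ => k then g.coeff e else 0 := by
    intro e
    rw [Fin.prod_univ_one, etaPow_zpow, etaPow, Units.val_mk0, HahnSeries.C_apply,
      HahnSeries.single_mul_single, zero_add, mul_one, HahnSeries.coeff_single]
    congr 1
    rw [eq_iff_iff]
    constructor
    · intro h; funext i; rw [Subsingleton.elim i 0]; exact (mul_left_cancel₀ ha h).symm
    · rintro rfl; rfl
  simp only [h]
  rw [Finset.sum_ite_eq' g.coeff.support]
  split_ifs with h1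
  · rfl
  · exact (Finsupp.notMem_support_iff.1 h1).symm

end OneVariable

/-! ### Strings -/

section Strings

variable {n m : ℕ} {G : Type*} [CommGroup G]

/-- The point with coordinates `u`, with the coordinates `s 0, …, s m` changed to the string
`u_{s 0}, u_{s 0} q, …, u_{s 0} q^m`. -/
def stringPt (s : Fin (m + 1) ↪ Fin n) (u : Fin n → G) (q : G) (i : Fin n) : G :=
  open Classical in if h : ∃ j, s j = i then u (s 0) * q ^ (h.choose : ℕ) else u i

lemma stringPt_apply (s : Fin (m + 1) ↪ Fin n) (u : Fin n → G) (q : G) (j : Fin (m + 1)) :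
    stringPt s u q (s j) = u (s 0) * q ^ (j : ℕ) := by
  have h : ∃ k, s k = s j := ⟨j, rfl⟩
  rw [stringPt, dif_pos h, s.injective h.choose_spec]

lemma stringPt_of_ne (s : Fin (m + 1) ↪ Fin n) (u : Fin n → G) (q : G) {i : Fin n}
    (h : ∀ j, s j ≠ i) : stringPt s u q i = u i := by
  rw [stringPt, dif_neg (by simpa using h)]

lemma map_stringPt {H : Type*} [CommGroup H] (φ : G →* H) (s : Fin (m + 1) ↪ Fin n) (u : Fin n → G)
    (q : G) (i : Fin n) : φ (stringPt s u q i) = stringPt s (fun i => φ (u i)) (φ q) i := by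
  rw [stringPt, stringPt]
  split_ifs <;> simp

lemma stringPt_self (s : Fin (m + 1) ↪ Fin n) {v : Fin n → G} {x q : G}
    (hv : ∀ j, v (s j) = x * q ^ (j : ℕ)) : stringPt s v q = v := by
  have h0 : v (s 0) = x := by rw [hv]; simp
  funext i
  by_cases h : ∃ j, s j = i
  · obtain ⟨j, rfl⟩ := h
    rw [stringPt_apply, h0, hv]
  · exact stringPt_of_ne s v q (by simpa using h)

/-- The variables, as units of the field of rational functions. -/
def uvar (n : ℕ) (i : Fin n) : (RatFun n)ˣ := Units.mk0 (var n i) (var_ne_zero n i)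

lemma uvar_indep {n : ℕ} {i j : Fin n} {κ κ' : Kqˣ}
    (h : uvar n i * Units.map (algebraMap Kq (RatFun n) : Kq →* RatFun n) κ =
      uvar n j * Units.map (algebraMap Kq (RatFun n) : Kq →* RatFun n) κ') : i = j ∧ κ = κ' := by
  have h1 := congrArg Units.val h
  simp only [Units.val_mul, uvar, Units.val_mk0, Units.coe_map, MonoidHom.coe_coe, var] at h1
  rw [IsScalarTower.algebraMap_apply Kq (MvPolynomial (Fin n) Kq) (RatFun n),
    IsScalarTower.algebraMap_apply Kq (MvPolynomial (Fin n) Kq) (RatFun n), ← map_mul, ← map_mul] at h1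
  have h2 := IsFractionRing.injective (MvPolynomial (Fin n) Kq) (RatFun n) h1
  have h3 := congrArg (MvPolynomial.coeff (Finsupp.single i 1)) h2
  simp only [MvPolynomial.algebraMap_eq, mul_comm _ (MvPolynomial.C _), MvPolynomial.coeff_C_mul,
    MvPolynomial.coeff_X] at h3
  by_cases hij : i = j
  · subst hij
    refine ⟨rfl, ?_⟩
    ext1
    simpa using h3
  · exfalso
    have h4 : ¬ (Finsupp.single j 1 = Finsupp.single i 1) := fun h4 =>
      hij ((Finsupp.single_left_inj one_ne_zero).1 h4).symm
    rw [if_neg h4] at h3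
    simp at h3

lemma uvar_injective (n : ℕ) : Function.Injective (uvar n) := fun i j h =>
  (uvar_indep (κ := 1) (κ' := 1) (by rw [h])).1

/-- The parameters as units of `ℚ(q₁, q₂)`. -/
lemma fcol_eq_map (F : Type) [Field F] [Algebra Kq F] (c : Fin 3) :
    fcol F c = Units.map (algebraMap Kq F : Kq →* F) (fcol Kq c) := by
  ext1
  simp [coe_fcol]

/-- A Laurent polynomial that vanishes at the generic point with a string vanishes at all points
with such a string. -/
lemma ev_eq_zero_of_generic {s : Fin (m + 1) ↪ Fin n} {γ : Fin 3} {R : Laurent Zq (Fin n)}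
    (h : ev (stringPt s (uvar n) (fcol (RatFun n) γ)) R = 0) {F : Type} [Field F] [Algebra Kq F]
    {v : Fin n → Fˣ} {x : Fˣ} (hv : ∀ j, v (s j) = x * fcol F γ ^ (j : ℕ)) : ev v R = 0 := by
  set φ : Laurent Zq (Fin n) →+* Laurent Zq (Fin n) :=
    laurentHom lC (stringPt s lvar (lcol γ)) with hφ
  have key : ∀ {F : Type} [Field F] [Algebra Kq F] (v : Fin n → Fˣ),
      ev v (φ R) = ev (stringPt s v (fcol F γ)) R := by
    intro F _ _ v
    rw [hφ, comp_laurentHom]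
    have h1 : (ev v).comp lC = coefHom F := RingHom.ext fun r => ev_lC v r
    rw [h1]
    change ev _ R = _
    congr 1
    congr 1
    funext i
    rw [map_stringPt, map_ev_lcol]
    congr 1
    funext i
    exact map_ev_lvar v i
  have h2 : φ R = 0 := by
    apply toRat_injective n
    rw [map_zero, toRat_eq_ev]
    exact (key (uvar n)).trans h
  rw [← stringPt_self s hv, ← key, h2, map_zero]

end Strings

/-! ### The vanishing theorem -/

lemma scaled_injective {F : Type} [Field F] [Algebra Kq F] {I : Type} [DecidableEq I] {a : ℤ}
    {v : I → Fˣ} (hv : Function.Injective v) (T : Finset I) : Function.Injective (scaled a T v) := by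
  intro i j h
  have h1 := congrArg Units.val h
  simp only [scaled, Units.val_mk0] at h1
  have h2 := congrArg HahnSeries.order h1
  rw [HahnSeries.order_single (Units.ne_zero _), HahnSeries.order_single (Units.ne_zero _)] at h2
  rw [h2] at h1
  exact hv (Units.ext (HahnSeries.single_injective _ h1))

section Vanishing

variable {n : ℕ}

/-- The points at which the coordinates in `T` are multiplied by `w`. -/
def twist {G : Type*} [CommGroup G] (T : Finset (Fin n)) (w : G) (v : Fin n → G) (i : Fin n) : G :=
  v i * if i ∈ T then w else 1

/-- `R`, as a Laurent polynomial in a factor by which the coordinates in `T` are multiplied. -/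
def pencil {K : Type} [Field K] [Algebra Kq K] (T : Finset (Fin n)) (v : Fin n → Kˣ) :
    Laurent Zq (Fin n) →+* Laurent K (Fin 1) :=
  laurentHom (lC.comp (coefHom K))
    (twist T (lvar 0) fun i => Units.map (lC : K →+* Laurent K (Fin 1)) (v i))

variable {K : Type} [Field K] [Algebra Kq K] (T : Finset (Fin n)) (v : Fin n → Kˣ)
  (R : Laurent Zq (Fin n))

lemma laurentHom_pencil {E : Type} [CommRing E] (φ : K →+* E) (w : Eˣ) :
    laurentHom φ (fun _ => w) (pencil T v R) =
      laurentHom (φ.comp (coefHom K)) (twist T w fun i => Units.map (φ : K →* E) (v i)) R := by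
  have h1 : (laurentHom φ (fun _ : Fin 1 => w)).comp (lC.comp (coefHom K)) =
      φ.comp (coefHom K) := RingHom.ext fun r => laurentHom_lC _ _ _
  rw [pencil, comp_laurentHom, h1]
  congr 2
  funext i
  ext1
  simp only [twist, map_mul, Units.val_mul, Units.coe_map, MonoidHom.coe_coe]
  congr 1
  · exact laurentHom_lC _ _ _
  · split_ifs
    · exact laurentHom_lvar _ _ _
    · exact map_one _

lemma ev_twist_eq (w : Kˣ) :
    laurentHom (RingHom.id K) (fun _ => w) (pencil T v R) = ev (twist T w v) R := by
  rw [laurentHom_pencil]; rfl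

lemma ev_twist_etaPow (k : ℤ) :
    laurentHom HahnSeries.C (fun _ => etaPow K k) (pencil T v R) =
      ev (twist T (etaPow K k) fun i => Units.map (HahnSeries.C : K →+* LaurentSeries K) (v i)) R := by
  rw [laurentHom_pencil]
  have : (HahnSeries.C : K →+* LaurentSeries K).comp (coefHom K) = coefHom (LaurentSeries K) :=
    RingHom.ext fun r => (algebraMap_laurentSeries _).symm
  rw [this]; rfl

lemma scaled_eq_twist (a : ℤ) : scaled a T v =
    twist T (etaPow K (-a)) fun i => Units.map (HahnSeries.C : K →+* LaurentSeries K) (v i) := by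
  funext i
  ext1
  simp only [scaled, twist, Units.val_mk0, Units.val_mul, Units.coe_map, MonoidHom.coe_coe,
    HahnSeries.C_apply]
  split_ifs
  · simp [etaPow]
  · simp

lemma scaled_compl_eq_twist (a : ℤ) : scaled a Tᶜ v = fun i => etaPow K (-a) *
    twist T (etaPow K a) (fun i => Units.map (HahnSeries.C : K →+* LaurentSeries K) (v i)) i := by
  funext i
  ext1
  simp only [scaled, twist, Units.val_mk0, Units.val_mul, Units.coe_map, MonoidHom.coe_coe,
    HahnSeries.C_apply, mem_compl]
  by_cases h : i ∈ T
  · simp [etaPow, h]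
  · simp [etaPow, h]

/-- The degree bounds that follow from a vanishing leading coefficient. -/
lemma pencil_bounds {a t : ℕ} {b : ℤ} (ha : 0 < a) (hn : n = a * t)
    (hH : ev (scaled (a : ℤ) Tᶜ v) R = ((etaPow K (-a) ^ (b * t) : (LaurentSeries K)ˣ) :
      LaurentSeries K) * ev (twist T (etaPow K a) fun i =>
        Units.map (HahnSeries.C : K →+* LaurentSeries K) (v i)) R)
    (h1 : Lead (ev (scaled (a : ℤ) T v) R) (slopeWt a b T univ) 0)
    (h2 : Lead (ev (scaled (a : ℤ) Tᶜ v) R) (slopeWt a b Tᶜ univ) 0) {k : ℤ}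
    (hk : (pencil T v R).coeff (fun _ => k) ≠ 0) :
    b * #T - a * (#T * #Tᶜ) < a * k ∧ a * k < b * #T + a * (#T * #Tᶜ) := by
  have ha' : (a : ℤ) ≠ 0 := by omega
  have hcard : (#T : ℤ) + #Tᶜ = n := by
    have := card_add_card_compl T
    rw [Fintype.card_fin] at this
    exact_mod_cast this
  have hn' : (n : ℤ) = a * t := by exact_mod_cast hn
  rw [scaled_eq_twist, ← ev_twist_etaPow] at h1
  rw [hH, ← ev_twist_etaPow, etaPow_zpow] at h2
  have w1 : slopeWt a b T univ = a * (#T * #Tᶜ) + b * #T := by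
    rw [slopeWt, univ_inter, ← compl_eq_univ_sdiff]
  have w2 : slopeWt a b Tᶜ univ = a * (#T * #Tᶜ) + b * #Tᶜ := by
    rw [slopeWt, univ_inter, ← compl_eq_univ_sdiff, compl_compl]; ring
  rw [w1] at h1
  rw [w2] at h2
  constructor
  · by_contra hlt
    apply hk
    rw [← coeff_laurentHom_etaPow _ ha']
    have h3 : ∀ j, (((etaPow K (-a * (b * t)) : (LaurentSeries K)ˣ) : LaurentSeries K) *
        laurentHom HahnSeries.C (fun _ => etaPow K a) (pencil T v R)).coeff (j + -a * (b * t)) =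
        (laurentHom HahnSeries.C (fun _ => etaPow K a) (pencil T v R)).coeff j := by
      intro j
      rw [etaPow, Units.val_mk0, HahnSeries.coeff_single_mul_add, one_mul]
    rw [← h3]
    have h4 : a * k + -a * (b * t) ≤ -(a * (#T * #Tᶜ) + b * #Tᶜ) := by
      have e2 : (a : ℤ) * (b * t) = b * (#T + #Tᶜ) := by rw [hcard, hn']; ring
      linarith
    rcases h4.lt_or_eq with h5 | h5
    · exact h2.1 _ h5
    · rw [h5]; exact h2.2
  · by_contra hlt
    apply hk
    rw [← coeff_laurentHom_etaPow _ (neg_ne_zero.2 ha')]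
    have h4 : -a * k ≤ -(a * (#T * #Tᶜ) + b * #T) := by linarith
    rcases h4.lt_or_eq with h5 | h5
    · exact h1.1 _ h5
    · rw [h5]; exact h1.2

/-- The exponents `(i, j)` of the ratios `α^i q^j` between another coordinate and the first element of
a `q`-string of length `m + 1` at which the string gets longer or a wheel is formed. -/
def rootExp (m : ℕ) : Finset (ℤ × ℤ) :=
  ({(0, -((m : ℤ) + 1)), (0, 1)} : Finset (ℤ × ℤ)) ∪
    ((range m).image (fun i : ℕ => ((1 : ℤ), -(i : ℤ))) ∪
      (range m).image (fun i : ℕ => ((-1 : ℤ), -1 - (i : ℤ))))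

lemma card_rootExp (m : ℕ) : #(rootExp m) = 2 * (m + 1) := by
  have h1 : #((range m).image (fun i : ℕ => ((1 : ℤ), -(i : ℤ)))) = m := by
    rw [card_image_of_injective, card_range]
    intro i j h; simpa using h
  have h2 : #((range m).image (fun i : ℕ => ((-1 : ℤ), -1 - (i : ℤ)))) = m := by
    rw [card_image_of_injective, card_range]
    intro i j h; simpa using h
  rw [rootExp, card_union_of_disjoint, card_union_of_disjoint, h1, h2, card_pair]
  · ring
  · intro h; have := congrArg Prod.snd h; simp at this; omega
  · rw [Finset.disjoint_left]
    intro x hx hx'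
    rw [mem_image] at hx hx'
    obtain ⟨i, _, rfl⟩ := hx
    obtain ⟨j, _, h⟩ := hx'
    have := congrArg Prod.fst h; simp at this
  · rw [Finset.disjoint_left]
    intro x hx hx'
    rw [mem_union, mem_image, mem_image] at hx'
    have h0 : x.1 = 0 := by
      rw [mem_insert, mem_singleton] at hx
      rcases hx with rfl | rfl <;> rfl
    rcases hx' with ⟨i, _, h⟩ | ⟨i, _, h⟩ <;> · rw [← h] at h0; simp at h0

/-- A Laurent polynomial of the degrees of slope `b / a` that satisfies the wheel conditions, has no
leading coefficients of maximal weight, and vanishes at strings, is zero: by downward induction, it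
vanishes at all points that contain a string of a given length, since the position of such a string
relative to the other coordinates is the variable of a Laurent polynomial that has more roots than its
degree bounds allow. -/
theorem eq_zero_of_vanishing {a t : ℕ} {b : ℤ} (ha : 0 < a) (hn : n = a * t) (hpos : 0 < n)
    (γ : Fin 3) (R : Laurent Zq (Fin n))
    (hH : ∀ (F : Type) [Field F] [Algebra Kq F] (v : Fin n → Fˣ) (x : Fˣ), Function.Injective v →
      ev (fun i => x * v i) R = ((x ^ (b * t) : Fˣ) : F) * ev v R)
    (hW : ∀ (F : Type) [Field F] [Algebra Kq F] (v : Fin n → Fˣ), Function.Injective v →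
      ∀ (α β : Fin 3) (A B C : Fin n), α ≠ β → v B = fcol F α * v A → v C = fcol F β * v B →
        ev v R = 0)
    (hL : ∀ (F : Type) [Field F] [Algebra Kq F] (v : Fin n → Fˣ), Function.Injective v →
      ∀ T : Finset (Fin n), T ≠ ∅ → T ≠ univ →
        Lead (ev (scaled (a : ℤ) T v) R) (slopeWt a b T univ) 0)
    (hS : ∀ (F : Type) [Field F] [Algebra Kq F] (v : Fin n → Fˣ) (x : Fˣ) (s : Fin n ↪ Fin n),
      (∀ i, v (s i) = x * fcol F γ ^ (i : ℕ)) → ev v R = 0) : R = 0 := by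
  classical
  -- Induction on the number `d` of the coordinates outside the string.
  have key : ∀ d m : ℕ, m + 1 + d = n → ∀ (s : Fin (m + 1) ↪ Fin n) (F : Type) [Field F]
      [Algebra Kq F] (v : Fin n → Fˣ) (x : Fˣ), (∀ j, v (s j) = x * fcol F γ ^ (j : ℕ)) →
        ev v R = 0 := by
    intro d
    induction d with
    | zero =>
      intro m hm s F _ _ v x hv
      obtain rfl : m + 1 = n := hm
      exact hS F v x s hv
    | succ d ih =>
      intro m hm s F _ _ v x hv
      refine ev_eq_zero_of_generic (γ := γ) ?_ hv
      clear hv v x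
      set K := RatFun n with hK
      set q : Kˣ := fcol K γ with hq
      set α : Kˣ := fcol K (γ + 1) with hα
      have hβ : fcol K (γ + 2) = α⁻¹ * q⁻¹ := by
        rw [← mul_inv, mul_comm α q]
        exact (inv_eq_of_mul_eq_one_right (fcol_prod γ)).symm
      have hαγ : γ + 1 ≠ γ := (by decide : ∀ γ : Fin 3, γ + 1 ≠ γ) γ
      have hβγ : γ + 2 ≠ γ := (by decide : ∀ γ : Fin 3, γ + 2 ≠ γ) γ
      set v₀ : Fin n → Kˣ := stringPt s (uvar n) q with hv₀
      set T : Finset (Fin n) := univ.map s with hT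
      have hsT : ∀ j, s j ∈ T := fun j => mem_map_of_mem _ (mem_univ j)
      have hnT : ∀ i, i ∉ T → ∀ j, s j ≠ i := fun i hi j h => hi (h ▸ hsT j)
      have hv₀s : ∀ j, v₀ (s j) = uvar n (s 0) * q ^ (j : ℕ) := stringPt_apply s _ _
      have hv₀n : ∀ i, i ∉ T → v₀ i = uvar n i := fun i hi => stringPt_of_ne s _ _ (hnT i hi)
      have hTcard : #T = m + 1 := by rw [hT, card_map, card_univ, Fintype.card_fin]
      have hTc : #Tᶜ = d + 1 := by rw [card_compl, hTcard, Fintype.card_fin]; omega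
      have hT0 : T ≠ ∅ := by rw [Ne, ← card_eq_zero]; omega
      have hT1 : T ≠ univ := by
        intro h; rw [h, compl_univ, card_empty] at hTc; omega
      -- The coordinates of a generic point, the parameter `α` and the parameter `q` are
      -- multiplicatively independent.
      have hindep : ∀ {i j : Fin n} {e e' : ℤ × ℤ}, uvar n i * (α ^ e.1 * q ^ e.2) =
          uvar n j * (α ^ e'.1 * q ^ e'.2) → i = j ∧ e = e' := by
        intro i j e e' h
        have hm : ∀ e : ℤ × ℤ, α ^ e.1 * q ^ e.2 =
            Units.map (algebraMap Kq K : Kq →* K) (fcol Kq (γ + 1) ^ e.1 * fcol Kq γ ^ e.2) := by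
          intro e
          rw [map_mul, map_zpow, map_zpow, ← fcol_eq_map, ← fcol_eq_map]
        rw [hm, hm] at h
        obtain ⟨h1, h2⟩ := uvar_indep h
        refine ⟨h1, ?_⟩
        have h3 := fcol_indep (F := Kq) hαγ (e.1 - e'.1) (e.2 - e'.2) (by
          rw [zpow_sub, zpow_sub, mul_mul_mul_comm, h2]
          rw [mul_mul_mul_comm, mul_inv_cancel, mul_inv_cancel, one_mul])
        ext <;> omega
      have hv₀inj : Function.Injective v₀ := by
        have hform : ∀ i, ∃ k : Fin n, ∃ e : ℤ × ℤ, v₀ i = uvar n k * (α ^ e.1 * q ^ e.2) ∧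
            ((i ∉ T ∧ k = i ∧ e = 0) ∨ (k ∈ T ∧ ∃ j : Fin (m + 1), i = s j ∧ e = (0, (j : ℤ)))) := by
          intro i
          by_cases hi : i ∈ T
          · obtain ⟨j, _, rfl⟩ := mem_map.1 hi
            exact ⟨s 0, (0, (j : ℤ)), by simp [hv₀s], Or.inr ⟨hsT 0, j, rfl, rfl⟩⟩
          · exact ⟨i, 0, by simp [hv₀n i hi], Or.inl ⟨hi, rfl, rfl⟩⟩
        intro i i' h
        obtain ⟨k, e, h1, h2⟩ := hform i
        obtain ⟨k', e', h1', h2'⟩ := hform i'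
        rw [h1, h1'] at h
        obtain ⟨rfl, rfl⟩ := hindep h
        rcases h2 with ⟨h3, h4, h5⟩ | ⟨h3, j, h4, h5⟩ <;>
          rcases h2' with ⟨h3', h4', h5'⟩ | ⟨h3', j', h4', h5'⟩
        · rw [← h4, ← h4']
        · exact absurd (h4 ▸ h3') h3
        · exact absurd (h4' ▸ h3) h3'
        · rw [h4, h4']
          rw [h5] at h5'
          have := congrArg Prod.snd h5'
          simp at this
          rw [Fin.ext this]
      -- Move the string by a factor `w`: the result is a Laurent polynomial in `w`, which vanishes if
      -- the moved string is in a special position to one of the other coordinates.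
      set g : Laurent K (Fin 1) := pencil T v₀ R with hg
      set Z : Finset Kˣ := (Tᶜ ×ˢ rootExp m).image fun p =>
        uvar n p.1 * (α ^ p.2.1 * q ^ p.2.2) * (uvar n (s 0))⁻¹ with hZ
      have hZcard : #Z = 2 * ((m + 1) * (d + 1)) := by
        rw [hZ, card_image_of_injOn, card_product, card_rootExp, hTc]
        · ring
        · intro p _ p' _ h
          have h1 := hindep (mul_right_cancel h)
          exact Prod.ext h1.1 h1.2
      have hg0 : g = 0 := by
        refine eq_zero_of_roots g Z ?_ ((b * (m + 1)) / a - (m + 1) * (d + 1) + 1) ?_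
        · intro w hw
          obtain ⟨⟨i₀, e⟩, hmem, hwe⟩ := mem_image.1 hw
          rw [mem_product, mem_compl] at hmem
          obtain ⟨hi₀, he⟩ := hmem
          simp only at hwe hi₀ he
          rw [ev_twist_eq]
          set v := twist T w v₀ with hv
          have hvs : ∀ j, v (s j) = uvar n i₀ * (α ^ e.1 * q ^ e.2) * q ^ (j : ℕ) := by
            intro j
            rw [hv, twist, if_pos (hsT j), hv₀s, ← hwe, mul_comm, mul_assoc, inv_mul_cancel_left]
          have hvn : ∀ i, i ∉ T → v i = uvar n i := by
            intro i hi
            rw [hv, twist, if_neg hi, mul_one, hv₀n i hi]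
          -- The positions in which two neighbours on the string and the coordinate `i₀` form a wheel.
          have hwheel : ∀ (δ : Fin 3) (i : ℕ), i < m → δ ≠ γ → e.1 ≠ 0 →
              (uvar n i₀ * (α ^ e.1 * q ^ e.2) * q ^ i = fcol K δ * uvar n i₀) → ev v R = 0 := by
            intro δ i hi hδ he0 h
            refine hW K v ?_ δ γ i₀ (s ⟨i, by omega⟩) (s ⟨i + 1, by omega⟩) hδ ?_ ?_
            · intro k k' hkk
              by_cases hk : k ∈ T <;> by_cases hk' : k' ∈ T
              · obtain ⟨j, _, rfl⟩ := mem_map.1 hk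
                obtain ⟨j', _, rfl⟩ := mem_map.1 hk'
                rw [hvs, hvs] at hkk
                have h1 : q ^ (j : ℤ) = q ^ (j' : ℤ) := by
                  simpa using mul_left_cancel hkk
                have h2 := fcol_zpow_inj γ h1
                rw [show j = j' from Fin.ext (by exact_mod_cast h2)]
              · obtain ⟨j, _, rfl⟩ := mem_map.1 hk
                rw [hvs, hvn k' hk'] at hkk
                have h1 := hindep (i := i₀) (j := k') (e := (e.1, e.2 + j)) (e' := (0, 0)) (by
                  simpa [zpow_add, mul_assoc] using hkk)
                exact absurd (congrArg Prod.fst h1.2) he0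
              · obtain ⟨j, _, rfl⟩ := mem_map.1 hk'
                rw [hvs, hvn k hk] at hkk
                have h1 := hindep (i := i₀) (j := k) (e := (e.1, e.2 + j)) (e' := (0, 0)) (by
                  simpa [zpow_add, mul_assoc] using hkk.symm)
                exact absurd (congrArg Prod.fst h1.2) he0
              · rw [hvn k hk, hvn k' hk'] at hkk
                exact uvar_injective n hkk
            · rw [hvs, hvn i₀ hi₀]; exact h
            · rw [hvs, hvs, pow_succ]
              simp only
              rw [← mul_assoc, mul_comm]
          rw [rootExp, mem_union, mem_union, mem_insert, mem_singleton, mem_image, mem_image] at he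
          -- The coordinate `i₀` extends the string at its end or at its beginning, or it forms a wheel
          -- of one of the two orientations.
          rcases he with (rfl | rfl) | ⟨i, hi, rfl⟩ | ⟨i, hi, rfl⟩
          · refine ih (m + 1) (by omega) (Fin.Embedding.snoc s (a := i₀) ?_) K v
              (uvar n i₀ * q ^ (-((m : ℤ) + 1))) ?_
            · rintro ⟨j, hj⟩; exact hnT i₀ hi₀ j hj
            · intro j
              induction j using Fin.lastCases with
              | last =>
                rw [Fin.Embedding.snoc_last]
                rw [hvn i₀ hi₀, Fin.val_last, ← zpow_natCast, mul_assoc, ← zpow_add]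
                simp
              | cast j => simp [hvs, ← hq]
          · refine ih (m + 1) (by omega) (Fin.Embedding.cons s (a := i₀) ?_) K v (uvar n i₀) ?_
            · rintro ⟨j, hj⟩; exact hnT i₀ hi₀ j hj
            · intro j
              induction j using Fin.cases with
              | zero => simp [hvn i₀ hi₀]
              | succ j => simp [hvs, pow_succ, mul_assoc, mul_comm q, ← hq]
          · refine hwheel (γ + 1) i (mem_range.1 hi) hαγ (by simp) ?_
            simp only
            rw [zpow_one, zpow_neg, zpow_natCast, mul_assoc, inv_mul_cancel_right, mul_comm]
          · refine hwheel (γ + 2) i (mem_range.1 hi) hβγ (by simp) ?_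
            simp only
            rw [hβ, zpow_sub, zpow_neg_one, zpow_natCast, mul_assoc, mul_assoc, inv_mul_cancel_right,
              zpow_neg_one, mul_comm]
        -- The leading coefficients at `T` and at its complement bound the exponents of `w`, and the
        -- bounds leave room for no more exponents than there are roots.
        · intro k hk
          have hbd := pencil_bounds T v₀ R (t := t) (b := b) ha hn ?_ (hL K v₀ hv₀inj T hT0 hT1)
            (hL K v₀ hv₀inj Tᶜ (by rw [Ne, ← card_eq_zero]; omega)
              (by rw [Ne, compl_eq_univ_iff]; exact hT0)) hk
          · rw [hTcard, hTc] at hbd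
            push_cast at hbd
            rw [hZcard]
            push_cast
            have ha' : (0 : ℤ) < a := by omega
            have e1 := Int.emod_add_mul_ediv (b * (m + 1)) a
            have e2 := Int.emod_nonneg (b * (m + 1)) ha'.ne'
            have e3 := Int.emod_lt_of_pos (b * (m + 1)) ha'
            set D := (b * (m + 1)) / (a : ℤ)
            set L : ℤ := (m + 1) * (d + 1)
            constructor
            · have : (a : ℤ) * (D - L) < a * k := by rw [mul_sub]; linarith
              have := lt_of_mul_lt_mul_left this ha'.le
              omega
            · have : (a : ℤ) * k < a * (D + L + 1) := by rw [mul_add, mul_add]; linarith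
              have := lt_of_mul_lt_mul_left this ha'.le
              omega
          · rw [scaled_compl_eq_twist]
            apply hH
            intro i j hij
            apply scaled_injective hv₀inj Tᶜ (a := (a : ℤ))
            rw [scaled_compl_eq_twist]
            simp only at hij ⊢
            rw [hij]
      -- The factor `w = 1` returns the point `v₀`.
      have h1 := ev_twist_eq T v₀ R 1
      rw [← hg, hg0, map_zero] at h1
      rw [h1]
      congr 2
      funext i
      simp [twist]
  obtain ⟨m, rfl⟩ : ∃ m, n = m + 1 := ⟨n - 1, by omega⟩
  apply toRat_injective
  rw [map_zero, toRat_eq_ev]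
  refine key m 0 (by omega) ⟨fun _ => 0, fun i j _ => Subsingleton.elim (α := Fin 1) i j⟩ _ _ (uvar (m + 1) 0) ?_
  intro j
  simp
  rfl

end Vanishing

/-! ### Integral combinations of sums over orderings -/

/-- Families of set functions, given uniformly for all fields and points. -/
abbrev Fam : Type 1 := ∀ (I F : Type) [Fintype I] [DecidableEq I] [Field F] [Algebra Kq F] (v : I → Fˣ),
  Tw (kap v)

/-- The span of the families `M c n d` over `ℤ[q₁^{±1}, q₂^{±1}]`. -/
inductive IsComb (c : Fin 3) (n : ℕ) : Fam → Prop
  | M (d : ℕ → ℤ) : IsComb c n fun _ _ _ _ _ _ v => M c n d v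
  | zero : IsComb c n fun _ _ _ _ _ _ _ => 0
  | add {f g : Fam} : IsComb c n f → IsComb c n g →
      IsComb c n fun I F _ _ _ _ v => f I F v + g I F v
  | smul (r : Zq) {f : Fam} : IsComb c n f → IsComb c n fun I F _ _ _ _ v => coefHom F r • f I F v

namespace IsComb

variable {c : Fin 3} {n : ℕ} {f g : Fam}

lemma congr (h : IsComb c n f) (e : ∀ (I F : Type) [Fintype I] [DecidableEq I] [Field F]
    [Algebra Kq F] (v : I → Fˣ), g I F v = f I F v) : IsComb c n g := by
  have : g = f := by
    funext I F _ _ _ _ v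
    exact e I F v
  rwa [this]

lemma sub (h : IsComb c n f) (h' : IsComb c n g) :
    IsComb c n fun I F _ _ _ _ v => f I F v - g I F v :=
  (h.add (h'.smul (-1))).congr fun I F _ _ _ _ v => by
    rw [map_neg, map_one, neg_one_smul, sub_eq_add_neg]

lemma sum {ι : Type*} (s : Finset ι) {f : ι → Fam} (h : ∀ i ∈ s, IsComb c n (f i)) :
    IsComb c n fun I F _ _ _ _ v => ∑ i ∈ s, f i I F v := by
  classical
  induction s using Finset.induction_on with
  | empty => exact zero.congr fun I F _ _ _ _ v => Finset.sum_empty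
  | insert i s hi ih =>
    exact ((h i (mem_insert_self _ _)).add (ih fun j hj => h j (mem_insert_of_mem hj))).congr
      fun I F _ _ _ _ v => Finset.sum_insert hi

lemma mul {m : ℕ} (hf : IsComb c n f) (hg : IsComb c m g) :
    IsComb c (n + m) fun I F _ _ _ _ v => f I F v * g I F v := by
  induction hf with
  | M d =>
    induction hg with
    | M d' =>
      rcases eq_or_ne n 0 with rfl | hn
      · rw [Nat.zero_add]
        exact (IsComb.M d').congr fun I F _ _ _ _ v => by beta_reduce; rw [M_zero, one_mul]
      rcases eq_or_ne m 0 with rfl | hm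
      · exact (IsComb.M d).congr fun I F _ _ _ _ v => by beta_reduce; rw [M_zero, mul_one]; rfl
      refine ((IsComb.M (app n d d')).sub
        ((IsComb.M (app n d d' + jump n)).smul ((zcol c)⁻¹ : Zqˣ))).congr
        fun I F _ _ _ _ v => ?_
      beta_reduce
      rw [M_mul_M c hn hm]
      congr 2
      have h := congrArg Units.val (map_inv (Units.map (coefHom F : Zq →* F)) (zcol c))
      simp only [Units.coe_map, MonoidHom.coe_coe] at h
      rw [h, Units.val_inv_eq_inv_val, Units.coe_map, MonoidHom.coe_coe, coefHom_zcol]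
    | zero => exact zero.congr fun I F _ _ _ _ v => mul_zero _
    | add _ _ ih1 ih2 => exact (ih1.add ih2).congr fun I F _ _ _ _ v => mul_add _ _ _
    | smul r _ ih => exact (ih.smul r).congr fun I F _ _ _ _ v => Tw.mul_smul' _ _ _
  | zero => exact zero.congr fun I F _ _ _ _ v => zero_mul _
  | add _ _ ih1 ih2 => exact (ih1.add ih2).congr fun I F _ _ _ _ v => add_mul _ _ _
  | smul r _ ih => exact (ih.smul r).congr fun I F _ _ _ _ v => Tw.smul_mul' _ _ _

lemma map (hf : IsComb c n f) {I I' F : Type} [Fintype I] [DecidableEq I] [Fintype I']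
    [DecidableEq I'] [Field F] [Algebra Kq F] (v : I → Fˣ) (g : I' ↪ I) (S : Finset I') :
    f I' F (v ∘ g) S = f I F v (S.map g) := by
  induction hf with
  | M d => exact M_map c n d v g S
  | zero => rfl
  | add _ _ ih1 ih2 => beta_reduce; rw [Tw.add_apply, Tw.add_apply, ih1, ih2]
  | smul r _ ih => beta_reduce; rw [Tw.smul_apply, Tw.smul_apply, ih]

lemma of_card_ne (hf : IsComb c n f) {I F : Type} [Fintype I] [DecidableEq I]
    [Field F] [Algebra Kq F] (v : I → Fˣ) {S : Finset I} (h : #S ≠ n) : f I F v S = 0 := by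
  induction hf with
  | M d => exact M_of_card_ne c d v h
  | zero => rfl
  | add _ _ ih1 ih2 => beta_reduce; rw [Tw.add_apply, ih1, ih2, add_zero]
  | smul r _ ih => beta_reduce; rw [Tw.smul_apply, ih, mul_zero]

lemma wheel (hf : IsComb c n f) {I F : Type} [Fintype I] [DecidableEq I]
    [Field F] [Algebra Kq F] (v : I → Fˣ) {α β : Fin 3} (hαβ : α ≠ β)
    {A B C : I} (hB : v B = fcol F α * v A) (hC : v C = fcol F β * v B) {S : Finset I}
    (hA' : A ∈ S) (hB' : B ∈ S) (hC' : C ∈ S) (hAB : A ≠ B) (hBC : B ≠ C) (hAC : A ≠ C) :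
    f I F v S = 0 := by
  induction hf with
  | M d => exact M_wheel c n d v hαβ hB hC hA' hB' hC' hAB hBC hAC
  | zero => rfl
  | add _ _ ih1 ih2 => beta_reduce; rw [Tw.add_apply, ih1, ih2, add_zero]
  | smul r _ ih => beta_reduce; rw [Tw.smul_apply, ih, mul_zero]

lemma rep (hf : IsComb c n f) : ∃ R : Laurent Zq (Fin n), ∀ (F : Type) [Field F] [Algebra Kq F]
    (v : Fin n → Fˣ), Function.Injective v → ev v R = f (Fin n) F v univ := by
  induction hf with
  | M d =>
    obtain ⟨R, hR⟩ := exists_rep c n d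
    exact ⟨R, fun F _ _ v hv => hR F v hv⟩
  | zero => exact ⟨0, fun F _ _ v hv => map_zero _⟩
  | add _ _ ih1 ih2 =>
    obtain ⟨R, hR⟩ := ih1
    obtain ⟨R', hR'⟩ := ih2
    exact ⟨R + R', fun F _ _ v hv => by
      beta_reduce; rw [map_add, hR F v hv, hR' F v hv, Tw.add_apply]⟩
  | smul r _ ih =>
    obtain ⟨R, hR⟩ := ih
    exact ⟨lC r * R, fun F _ _ v hv => by
      beta_reduce; rw [map_mul, ev_lC, hR F v hv, Tw.smul_apply]⟩

/-- Restricting a family to the points with indices in `S` reduces statements about all sets of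
indices to the set of all indices. -/
lemma exists_map_univ {I : Type} {S : Finset I} {n : ℕ} (h : #S = n) :
    ∃ g : Fin n ↪ I, univ.map g = S := by
  let e := S.equivFinOfCardEq h
  refine ⟨e.symm.toEmbedding.trans (Function.Embedding.subtype _), ?_⟩
  ext x
  simp only [mem_map, mem_univ, true_and]
  constructor
  · rintro ⟨i, rfl⟩; exact (e.symm i).2
  · intro hx; exact ⟨e ⟨x, hx⟩, by simp⟩

end IsComb

section PP

lemma coefHom_zcol_inv_pow (F : Type) [Field F] [Algebra Kq F] (c : Fin 3) (s : ℕ) :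
    coefHom F (((zcol c)⁻¹ ^ s : Zqˣ) : Zq) = (fcol F c : F)⁻¹ ^ s := by
  have h := congrArg Units.val (map_inv (Units.map (coefHom F : Zq →* F)) (zcol c))
  simp only [Units.coe_map, MonoidHom.coe_coe] at h
  rw [Units.val_pow_eq_pow_val, map_pow, h, Units.val_inv_eq_inv_val, Units.coe_map,
    MonoidHom.coe_coe, coefHom_zcol]

lemma isComb_PP (c : Fin 3) (a : ℕ) (b : ℤ) (t : ℕ) :
    IsComb c (a * t) fun _ _ _ _ _ _ v => PP c a b t v :=
  (IsComb.sum (range t) fun s _ => (IsComb.M (c := c) (n := a * t)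
    (slopeExp a b + ∑ r ∈ Ico (t - s) t, jump (a * r))).smul (((zcol c)⁻¹ ^ s : Zqˣ) : Zq)).congr
    fun I F _ _ _ _ v => by simp only [coefHom_zcol_inv_pow]; rfl

variable {I : Type} [Fintype I] [DecidableEq I] {F : Type} [Field F] [Algebra Kq F]

lemma sum_jump {n k : ℕ} (hk : 0 < k) (hkn : k < n) : ∑ i ∈ range n, jump k i = 0 := by
  simp only [jump, Finset.sum_sub_distrib]
  have h : ∀ i, (i + 1 = k) ↔ i = k - 1 := fun i => by omega
  simp only [h, Finset.sum_ite_eq', mem_range]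
  rw [if_pos hkn, if_pos (by omega), sub_self]

lemma sum_slopeExp_jumps {a : ℕ} {b : ℤ} (ha : 0 < a) {t s : ℕ} (hs : s < t) :
    ∑ i ∈ range (a * t), (slopeExp a b + ∑ r ∈ Ico (t - s) t, jump (a * r)) i = b * t := by
  simp only [Pi.add_apply, Finset.sum_apply, Finset.sum_add_distrib]
  rw [sum_slopeExp, Finset.sum_comm, Finset.sum_eq_zero, add_zero]
  · have : ((a * t : ℕ) : ℤ) * b = a * (b * t) := by push_cast; ring
    rw [this, Int.mul_ediv_cancel_left _ (by omega)]
  · intro r hr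
    rw [mem_Ico] at hr
    exact sum_jump (Nat.mul_pos ha (by omega)) (Nat.mul_lt_mul_of_pos_left hr.2 ha)

lemma PP_homogeneous {a : ℕ} (ha : 0 < a) (c : Fin 3) (b : ℤ) (t : ℕ) (v : I → Fˣ) (x : Fˣ)
    (S : Finset I) :
    PP c a b t (fun i => x * v i) S = ((x ^ (b * t) : Fˣ) : F) * PP c a b t v S := by
  rw [PP, PP, Tw.sum_apply, Tw.sum_apply, Finset.mul_sum]
  refine Finset.sum_congr rfl fun s hs => ?_
  rw [Tw.smul_apply, Tw.smul_apply, M_homogeneous, sum_slopeExp_jumps ha (mem_range.1 hs)]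
  ring

lemma mul_homogeneous {v : I → Fˣ} {x : Fˣ} {f g : Tw (kap v)} {f' g' : Tw (kap fun i => x * v i)}
    {p r : F} (hf : ∀ S, f' S = p * f S) (hg : ∀ S, g' S = r * g S) (S : Finset I) :
    (f' * g') S = p * r * (f * g) S := by
  have hk : kap (fun i => x * v i) = kap v := by
    funext i j
    simp only [kap, mul_div_mul_left_eq_div]
  rw [Tw.mul_apply, Tw.mul_apply, Finset.mul_sum]
  refine Finset.sum_congr rfl fun U _ => ?_
  rw [hf, hg, hk]
  ring

/-! ### Values at strings -/

/-- The monomial with exponents `d` at a reversed string of length `n`. -/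
def strVal (x q : Fˣ) (n : ℕ) (d : ℕ → ℤ) : Fˣ :=
  x ^ (∑ i ∈ range n, d i) * q ^ (∑ i ∈ range n, ((n : ℤ) - 1 - i) * d i)

lemma prod_zpow_string {n : ℕ} (d : ℕ → ℤ) (v : Fin n → Fˣ) (x q : Fˣ)
    (hv : ∀ i, v i = x * q ^ (i : ℕ)) : ∏ i : Fin n, v i.rev ^ d i = strVal x q n d := by
  have h1 : ∀ (y : Fˣ) (e : ℕ → ℤ), ∏ i : Fin n, y ^ e i = y ^ (∑ i ∈ range n, e i) := by
    intro y e
    rw [← Fin.sum_univ_eq_sum_range]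
    exact (map_sum (zpowersHom Fˣ y).toAdditiveRight _ _).symm
  rw [strVal, ← h1, ← h1 q fun i => ((n : ℤ) - 1 - i) * d i, ← Finset.prod_mul_distrib]
  refine Finset.prod_congr rfl fun i _ => ?_
  rw [hv, mul_zpow, zpow_mul, ← zpow_natCast]
  congr 3
  rw [Fin.val_rev]
  omega

lemma strVal_add_jump (x q : Fˣ) {n k : ℕ} (hk : 0 < k) (hkn : k < n) (d : ℕ → ℤ) :
    strVal x q n (d + jump k) = strVal x q n d * q⁻¹ := by
  have h2 : ∑ i ∈ range n, ((n : ℤ) - 1 - i) * jump k i = -1 := by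
    have h : ∀ i, (i + 1 = k) ↔ i = k - 1 := fun i => by omega
    simp only [jump, mul_sub, Finset.sum_sub_distrib, h, mul_ite, mul_one, mul_zero,
      Finset.sum_ite_eq', mem_range]
    rw [if_pos hkn, if_pos (by omega)]
    omega
  simp only [strVal, Pi.add_apply, mul_add, Finset.sum_add_distrib, h2, sum_jump hk hkn, add_zero]
  rw [zpow_add, zpow_neg_one, mul_assoc]

lemma strVal_app (x q : Fˣ) (n m : ℕ) (d d' : ℕ → ℤ) :
    strVal x q (n + m) (app n d d') = strVal x q n d * strVal x q m d' *
      q ^ (m * ∑ i ∈ range n, d i) := by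
  have h1 : ∀ i ∈ range n, app n d d' i = d i := fun i hi => if_pos (mem_range.1 hi)
  have h2 : ∀ i, app n d d' (n + i) = d' i := fun i => by
    rw [app, if_neg (by omega), Nat.add_sub_cancel_left]
  have e1 : ∑ i ∈ range (n + m), app n d d' i = ∑ i ∈ range n, d i + ∑ i ∈ range m, d' i := by
    rw [Finset.sum_range_add, Finset.sum_congr rfl h1]
    simp only [h2]
  have e2 : ∑ i ∈ range (n + m), (((n + m : ℕ) : ℤ) - 1 - i) * app n d d' i =
      ∑ i ∈ range n, ((n : ℤ) - 1 - i) * d i + ∑ i ∈ range m, ((m : ℤ) - 1 - i) * d' i +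
        m * ∑ i ∈ range n, d i := by
    rw [Finset.sum_range_add, Finset.mul_sum, add_right_comm, ← Finset.sum_add_distrib]
    congr 1
    · refine Finset.sum_congr rfl fun i hi => ?_
      rw [h1 i hi]; push_cast; ring
    · refine Finset.sum_congr rfl fun i hi => ?_
      rw [h2]; push_cast; ring
  rw [strVal, e1, e2, strVal, strVal, zpow_add, zpow_add, zpow_add]
  ac_rfl

lemma strVal_jumps (x q : Fˣ) {a : ℕ} {b : ℤ} (ha : 0 < a) {t s : ℕ} (hs : s < t) :
    strVal x q (a * t) (slopeExp a b + ∑ r ∈ Ico (t - s) t, jump (a * r)) =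
      strVal x q (a * t) (slopeExp a b) * q⁻¹ ^ s := by
  have key : ∀ (J : Finset ℕ), (∀ r ∈ J, 0 < r ∧ r < t) → ∀ d,
      strVal x q (a * t) (d + ∑ r ∈ J, jump (a * r)) = strVal x q (a * t) d * q⁻¹ ^ #J := by
    intro J
    induction J using Finset.induction_on with
    | empty => intro _ d; simp
    | insert r J hr ih =>
      intro h d
      obtain ⟨h1, h2⟩ := h r (mem_insert_self _ _)
      rw [Finset.sum_insert hr, ← add_assoc, ih (fun r' hr' => h r' (mem_insert_of_mem hr')),
        strVal_add_jump x q (Nat.mul_pos ha h1) (Nat.mul_lt_mul_of_pos_left h2 ha),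
        card_insert_of_notMem hr, pow_succ]
      ac_rfl
  rw [key _ (fun r hr => by rw [mem_Ico] at hr; omega), Nat.card_Ico]
  congr 2
  omega

/-- The product of the shuffle kernels at a reversed string. -/
def strKer {n : ℕ} (v : Fin n → Fˣ) : F :=
  ∏ i : Fin n, ∏ j : Fin n, if i < j then zeta ((v i.rev / v j.rev : Fˣ) : F) else 1

lemma M_strVal {c γ β : Fin 3} (hc : γ ≠ c) (hβγ : fcol F c * fcol F γ * fcol F β = 1)
    {n : ℕ} (hn : 0 < n) (d : ℕ → ℤ) (v : Fin n → Fˣ) (x : Fˣ)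
    (hv : ∀ i, v i = x * fcol F γ ^ (i : ℕ)) :
    M c n d v univ * (1 - (fcol F β : F)) ^ (n - 1) =
      (strVal x (fcol F γ) n d : F) * strKer v := by
  obtain ⟨n, rfl⟩ := Nat.exists_eq_succ_of_ne_zero hn.ne'
  rw [Nat.succ_sub_one, M_string hc hβγ d v x hv, prod_zpow_string d v x _ hv]
  rfl

lemma PP_strVal {c γ β : Fin 3} (hc : γ ≠ c) (hβγ : fcol F c * fcol F γ * fcol F β = 1)
    {a : ℕ} {b : ℤ} (ha : 0 < a) {t : ℕ} (ht : 0 < t) (v : Fin (a * t) → Fˣ) (x : Fˣ)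
    (hv : ∀ i, v i = x * fcol F γ ^ (i : ℕ)) :
    PP c a b t v univ * (1 - (fcol F β : F)) ^ (a * t) =
      (strVal x (fcol F γ) (a * t) (slopeExp a b) : F) * strKer v * (1 - (fcol F β : F) ^ t) := by
  have hn : 0 < a * t := Nat.mul_pos ha ht
  have h : PP c a b t v univ * (1 - (fcol F β : F)) ^ (a * t - 1) =
      (strVal x (fcol F γ) (a * t) (slopeExp a b) : F) * strKer v *
        ∑ s ∈ range t, (fcol F β : F) ^ s := by
    rw [PP, Tw.sum_apply, Finset.sum_mul, Finset.mul_sum]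
    refine Finset.sum_congr rfl fun s hs => ?_
    rw [Tw.smul_apply, mul_assoc, M_strVal hc hβγ hn _ v x hv, strVal_jumps _ _ ha (mem_range.1 hs)]
    have h1 : (fcol F β : F) = (fcol F c : F)⁻¹ * (fcol F γ : F)⁻¹ := by
      have := congrArg Units.val hβγ
      simp only [Units.val_mul, Units.val_one] at this
      rw [← mul_inv]
      exact (inv_eq_of_mul_eq_one_right this).symm
    rw [h1, mul_pow]
    push_cast
    ring
  have hpow : (1 - (fcol F β : F)) ^ (a * t) =
      (1 - (fcol F β : F)) ^ (a * t - 1) * (1 - (fcol F β : F)) := by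
    rw [← pow_succ, Nat.sub_add_cancel hn]
  rw [hpow, ← mul_assoc, h, mul_assoc, mul_comm (∑ s ∈ _, _), mul_neg_geom_sum]

/-- The part of the value of `PP` at a string that depends on the exponents. -/
def strPP (c γ : Fin 3) (a : ℕ) (b : ℤ) (x : Fˣ) (t : ℕ) : F :=
  ∑ s ∈ range t, (fcol F c : F)⁻¹ ^ s * (strVal x (fcol F γ) (a * t)
    (slopeExp a b + ∑ r ∈ Ico (t - s) t, jump (a * r)) : Fˣ)

/-- The value of a product of two `PP`s at a string is symmetric in the factors, since the factors
have the same slope. -/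
lemma PP_mul_PP_strVal {c γ β : Fin 3} (hc : γ ≠ c) (hβγ : fcol F c * fcol F γ * fcol F β = 1)
    {a : ℕ} {b : ℤ} (ha : 0 < a) {t s n : ℕ} (ht : 0 < t) (hs : 0 < s) (hn : n = a * t + a * s)
    (v : Fin n → Fˣ) (x : Fˣ) (hv : ∀ i, v i = x * fcol F γ ^ (i : ℕ)) :
    (PP c a b t v * PP c a b s v) univ * (1 - (fcol F β : F)) ^ (n - 1) =
      strPP c γ a b x t * strPP c γ a b x s * ((fcol F γ ^ (a * b * t * s) : Fˣ) : F) *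
        (1 - (fcol F c : F)⁻¹ * (fcol F γ : F)⁻¹) * strKer v := by
  have h1 : 0 < a * t := Nat.mul_pos ha ht
  have h2 : 0 < a * s := Nat.mul_pos ha hs
  have hn0 : 0 < n := by omega
  rw [PP, PP, Finset.sum_mul_sum, Tw.sum_apply, strPP, strPP, Finset.sum_mul_sum, Finset.sum_mul,
    Finset.sum_mul, Finset.sum_mul, Finset.sum_mul]
  refine Finset.sum_congr rfl fun i hi => ?_
  rw [Tw.sum_apply, Finset.sum_mul, Finset.sum_mul, Finset.sum_mul, Finset.sum_mul]
  refine Finset.sum_congr rfl fun j hj => ?_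
  rw [Tw.smul_mul', Tw.mul_smul', Tw.smul_apply, Tw.smul_apply, M_mul_M c h1.ne' h2.ne',
    Tw.sub_apply, Tw.smul_apply, ← hn, mul_assoc, mul_assoc, sub_mul, mul_assoc,
    M_strVal hc hβγ hn0 _ v x hv, M_strVal hc hβγ hn0 _ v x hv,
    strVal_add_jump _ _ h1 (by omega)]
  have e : ((a * s : ℕ) : ℤ) * (b * t) = a * b * t * s := by push_cast; ring
  have happ : ∀ d d' : ℕ → ℤ, ∑ i ∈ range (a * t), d i = b * t →
      strVal x (fcol F γ) n (app (a * t) d d') = strVal x (fcol F γ) (a * t) d *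
        strVal x (fcol F γ) (a * s) d' * fcol F γ ^ (a * b * t * s) := by
    intro d d' hd
    rw [hn, strVal_app, hd, e]
  rw [happ _ _ (sum_slopeExp_jumps ha (mem_range.1 hi))]
  push_cast
  ring

end PP

section Consequences

lemma IsComb.eq_zero {c : Fin 3} {n : ℕ} {f : Fam} (hf : IsComb c n f)
    (h : ∀ (F : Type) [Field F] [Algebra Kq F] (v : Fin n → Fˣ), Function.Injective v →
      f (Fin n) F v univ = 0) {I F : Type} [Fintype I] [DecidableEq I] [Field F] [Algebra Kq F]
    {v : I → Fˣ} (hv : Function.Injective v) : f I F v = 0 := by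
  ext S
  by_cases hS : #S = n
  · obtain ⟨g, hg⟩ := IsComb.exists_map_univ hS
    rw [← hg, ← hf.map v g univ]
    exact h F (v ∘ g) (hv.comp g.injective)
  · exact hf.of_card_ne v hS

lemma Lead.of_natCast_mul {F : Type} [Field F] {f : LaurentSeries F} {w : ℤ} {k : ℕ}
    (hk : (k : F) ≠ 0) (h : Lead ((k : LaurentSeries F) * f) w 0) : Lead f w 0 := by
  have h1 := (Lead.C ((k : F)⁻¹)).mul h
  have h2 : (HahnSeries.C ((k : F)⁻¹) : LaurentSeries F) * ((k : LaurentSeries F) * f) = f := by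
    rw [← map_natCast (HahnSeries.C : F →+* LaurentSeries F), ← mul_assoc, ← map_mul,
      inv_mul_cancel₀ hk, map_one, one_mul]
  rwa [h2, zero_add, mul_zero] at h1

lemma charZero_of_algebra (F : Type) [Field F] [Algebra Kq F] : CharZero F :=
  charZero_of_injective_algebraMap (algebraMap Kq F).injective

lemma fcol_mul_ne {F : Type} [Field F] [Algebra Kq F] {α β : Fin 3} (h : α ≠ β) :
    fcol F α ≠ 1 ∧ fcol F α * fcol F β ≠ 1 := by
  constructor
  · intro h1
    have := (fcol_indep (F := F) h 1 0 (by simp [h1])).1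
    omega
  · intro h1
    have := (fcol_indep (F := F) h 1 1 (by simpa using h1)).1
    omega

lemma one_sub_fcol_ne_zero {F : Type} [Field F] [Algebra Kq F] (c : Fin 3) :
    1 - (fcol F c : F) ≠ 0 := by
  intro h
  have := fcol_pow_ne_one (F := F) c one_ne_zero
  rw [pow_one] at this
  exact this (sub_eq_zero.1 h).symm

lemma wheel_ne {F : Type} [Field F] [Algebra Kq F] {I : Type} {v : I → Fˣ} {α β : Fin 3}
    (h : α ≠ β) {A B C : I} (hB : v B = fcol F α * v A) (hC : v C = fcol F β * v B) :
    A ≠ B ∧ B ≠ C ∧ A ≠ C := by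
  refine ⟨?_, ?_, ?_⟩
  · rintro rfl
    exact (fcol_mul_ne h).1 (mul_eq_right.1 hB.symm)
  · rintro rfl
    exact (fcol_mul_ne h.symm).1 (mul_eq_right.1 hC.symm)
  · rintro rfl
    rw [hB, ← mul_assoc] at hC
    exact (fcol_mul_ne h.symm).2 (mul_eq_right.1 hC.symm)

lemma injective_of_string {F : Type} [Field F] [Algebra Kq F] {n : ℕ} {v : Fin n → Fˣ} {x : Fˣ}
    {γ : Fin 3} {s : Fin n ↪ Fin n} (hs : ∀ i, v (s i) = x * fcol F γ ^ (i : ℕ)) :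
    Function.Injective v := by
  have h3 : Function.Injective (v ∘ s) := by
    intro i j h
    rw [Function.comp_apply, Function.comp_apply, hs, hs] at h
    have h4 : fcol F γ ^ ((i : ℕ) : ℤ) = fcol F γ ^ ((j : ℕ) : ℤ) := by
      simpa using mul_left_cancel h
    exact Fin.ext (by exact_mod_cast fcol_zpow_inj _ h4)
  have hbij : Function.Bijective s := Finite.injective_iff_bijective.1 s.injective
  intro i j h
  obtain ⟨i, rfl⟩ := hbij.2 i
  obtain ⟨j, rfl⟩ := hbij.2 j
  rw [h3 h]

/-- The elements `P_{at,bt}` of a given slope commute: `eq_zero_of_vanishing` applies to their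
commutator. -/
theorem PP_comm {a : ℕ} {b : ℤ} (ha : 0 < a) (hab : IsCoprime (a : ℤ) b) (c : Fin 3) (t s : ℕ)
    {I F : Type} [Fintype I] [DecidableEq I] [Field F] [Algebra Kq F] {v : I → Fˣ}
    (hv : Function.Injective v) : PP c a b t v * PP c a b s v = PP c a b s v * PP c a b t v := by
  rcases Nat.eq_zero_or_pos t with rfl | ht
  · simp [PP]
  rcases Nat.eq_zero_or_pos s with rfl | hs
  · simp [PP]
  obtain ⟨n, hn⟩ : ∃ n, n = a * t + a * s := ⟨_, rfl⟩
  have hn' : n = a * s + a * t := by omega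
  have h1 := (isComb_PP c a b t).mul (isComb_PP c a b s)
  have h2 := (isComb_PP c a b s).mul (isComb_PP c a b t)
  rw [← hn] at h1
  rw [← hn'] at h2
  have hD := h1.sub h2
  beta_reduce at hD
  rw [← sub_eq_zero]
  refine hD.eq_zero ?_ hv
  clear hv v
  obtain ⟨R, hR⟩ := hD.rep
  have hR0 : R = 0 := by
    refine eq_zero_of_vanishing (b := b) (t := t + s) ha (by rw [hn, mul_add])
      (by rw [hn]; have := Nat.mul_pos ha ht; omega) (c + 1) R ?_ ?_ ?_ ?_
    · intro F _ _ v x hv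
      have hv' : Function.Injective fun i => x * v i := fun i j h => hv (mul_left_cancel h)
      rw [hR F v hv, hR F _ hv', Tw.sub_apply, Tw.sub_apply,
        mul_homogeneous (PP_homogeneous ha c b t v x) (PP_homogeneous ha c b s v x),
        mul_homogeneous (PP_homogeneous ha c b s v x) (PP_homogeneous ha c b t v x)]
      push_cast
      rw [mul_add, zpow_add₀ (Units.ne_zero x)]
      ring
    · intro F _ _ v hv α β A B C hαβ hB hC
      rw [hR F v hv]
      obtain ⟨h1, h2, h3⟩ := wheel_ne hαβ hB hC
      exact hD.wheel v hαβ hB hC (mem_univ _) (mem_univ _) (mem_univ _) h1 h2 h3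
    · intro F _ _ v hv T hT0 hT1
      have := charZero_of_algebra F
      rw [hR _ _ (scaled_injective hv T)]
      have h := lead_commutator_dlog (T := T) (v := v) ha hab c (a * t) (a * s) (S := univ)
        (fun h => hT1 (univ_subset_iff.1 h))
        (fun h => hT0 (compl_eq_univ_iff T |>.1 (univ_subset_iff.1 h)))
      rw [part_dlog ha, part_dlog ha, Tw.smul_mul', Tw.mul_smul', Tw.smul_mul', Tw.mul_smul',
        ← smul_sub, ← smul_sub, Tw.smul_apply, Tw.smul_apply] at h
      have ha' : (a : F) ≠ 0 := by rw [Nat.cast_ne_zero]; omega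
      exact (h.of_natCast_mul ha').of_natCast_mul ha'
    · intro F _ _ v x s' hs'
      have hvs : ∀ i, (v ∘ s') i = x * fcol F (c + 1) ^ (i : ℕ) := hs'
      have hv : Function.Injective v := injective_of_string hs'
      have huniv : univ.map s' = univ := by
        apply eq_univ_of_card; rw [card_map, card_univ]
      rw [hR F v hv]
      have h3 := hD.map v s' univ
      rw [huniv] at h3
      rw [← h3]
      have hc : c + 1 ≠ c := (by decide : ∀ c : Fin 3, c + 1 ≠ c) c
      have h4 := PP_mul_PP_strVal hc (fcol_prod (F := F) c) (b := b) ha ht hs hn (v ∘ s') x hvs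
      have h5 := PP_mul_PP_strVal hc (fcol_prod (F := F) c) (b := b) ha hs ht hn' (v ∘ s') x hvs
      have h6 : (1 - (fcol F (c + 2) : F)) ^ (n - 1) ≠ 0 := pow_ne_zero _ (one_sub_fcol_ne_zero _)
      apply mul_right_cancel₀ h6
      rw [Tw.sub_apply, sub_mul, h4, h5, zero_mul, show (a : ℤ) * b * s * t = a * b * t * s by ring]
      ring
  intro F _ _ v hv
  rw [← hR F v hv, hR0, map_zero]

/-- The elements `P_{at,bt}` for different colours are proportional: `eq_zero_of_vanishing` applies to
the difference of the two sides, and the values at the strings of the third colour are known for both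
of them. -/
theorem PP_color {a : ℕ} {b : ℤ} (ha : 0 < a) (hab : IsCoprime (a : ℤ) b) {α β : Fin 3}
    (hαβ : α ≠ β) {t : ℕ} (ht : 0 < t)
    {I F : Type} [Fintype I] [DecidableEq I] [Field F] [Algebra Kq F] {v : I → Fˣ}
    (hv : Function.Injective v) :
    ((1 - (fcol F β : F)) ^ (a * t) * (1 - (fcol F α : F) ^ t)) • PP α a b t v =
      ((1 - (fcol F α : F)) ^ (a * t) * (1 - (fcol F β : F) ^ t)) • PP β a b t v := by
  obtain ⟨R₁, hR₁⟩ := (isComb_PP α a b t).rep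
  obtain ⟨R₂, hR₂⟩ := (isComb_PP β a b t).rep
  set R : Laurent Zq (Fin (a * t)) :=
    lC ((1 - (zcol β : Zq)) ^ (a * t) * (1 - (zcol α : Zq) ^ t)) * R₁ -
      lC ((1 - (zcol α : Zq)) ^ (a * t) * (1 - (zcol β : Zq) ^ t)) * R₂ with hRd
  have hR : ∀ (F : Type) [Field F] [Algebra Kq F] (v : Fin (a * t) → Fˣ), Function.Injective v →
      ev v R = (1 - (fcol F β : F)) ^ (a * t) * (1 - (fcol F α : F) ^ t) * PP α a b t v univ -
        (1 - (fcol F α : F)) ^ (a * t) * (1 - (fcol F β : F) ^ t) * PP β a b t v univ := by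
    intro F _ _ v hv
    rw [hRd, map_sub, map_mul (ev v) (lC _) R₁, map_mul (ev v) (lC _) R₂, ev_lC, ev_lC, hR₁ F v hv,
      hR₂ F v hv]
    simp only [map_mul, map_pow, map_sub, map_one, coefHom_zcol]
  have hn0 : 0 < a * t := Nat.mul_pos ha ht
  obtain ⟨γ, hγα, hγβ, hγ⟩ := fcol_third (F := Kq) hαβ
  have hprod : ∀ (F : Type) [Field F] [Algebra Kq F],
      fcol F α * fcol F γ * fcol F β = 1 ∧ fcol F β * fcol F γ * fcol F α = 1 := by
    intro F _ _
    have h := congrArg (Units.map (algebraMap Kq F : Kq →* F)) hγ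
    rw [map_mul, map_mul, ← fcol_eq_map, ← fcol_eq_map, ← fcol_eq_map, map_one] at h
    constructor
    · rw [← h]; ac_rfl
    · rw [← h]; ac_rfl
  have hR0 : R = 0 := by
    refine eq_zero_of_vanishing (b := b) (t := t) ha rfl hn0 γ R ?_ ?_ ?_ ?_
    · intro F _ _ v x hv
      have hv' : Function.Injective fun i => x * v i := fun i j h => hv (mul_left_cancel h)
      rw [hR F v hv, hR F _ hv', PP_homogeneous ha, PP_homogeneous ha]
      ring
    · intro F _ _ v hv δ ε A B C hδε hB hC
      rw [hR F v hv]
      obtain ⟨h1, h2, h3⟩ := wheel_ne hδε hB hC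
      rw [(isComb_PP α a b t).wheel v hδε hB hC (mem_univ _) (mem_univ _) (mem_univ _) h1 h2 h3,
        (isComb_PP β a b t).wheel v hδε hB hC (mem_univ _) (mem_univ _) (mem_univ _) h1 h2 h3]
      ring
    · intro F _ _ v hv T hT0 hT1
      have := charZero_of_algebra F
      have ha' : (a : F) ≠ 0 := by rw [Nat.cast_ne_zero]; omega
      rw [hR _ _ (scaled_injective hv T)]
      have h : ∀ c, Lead (PP c a b t (scaled (a : ℤ) T v) univ) (slopeWt a b T univ) 0 := by
        intro c
        have h := lead_part_dlog (T := T) (v := v) ha hab c (a * t) (S := univ)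
          (fun h => hT1 (univ_subset_iff.1 h))
          (fun h => hT0 (compl_eq_univ_iff T |>.1 (univ_subset_iff.1 h)))
        rw [part_dlog ha, Tw.smul_apply] at h
        exact h.of_natCast_mul ha'
      have hC : ∀ c c' : Fin 3, (1 - ((fcol (LaurentSeries F) c : (LaurentSeries F)ˣ) :
          LaurentSeries F)) ^ (a * t) * (1 - ((fcol (LaurentSeries F) c' : (LaurentSeries F)ˣ) :
          LaurentSeries F) ^ t) =
          HahnSeries.C ((1 - (fcol F c : F)) ^ (a * t) * (1 - (fcol F c' : F) ^ t)) := by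
        intro c c'
        simp only [coe_fcol_laurentSeries, map_mul, map_pow, map_sub, map_one]
      rw [hC, hC]
      have h1 := ((Lead.C ((1 - (fcol F β : F)) ^ (a * t) * (1 - (fcol F α : F) ^ t))).mul (h α)).sub
        ((Lead.C ((1 - (fcol F α : F)) ^ (a * t) * (1 - (fcol F β : F) ^ t))).mul (h β))
      rwa [zero_add, mul_zero, mul_zero, sub_zero] at h1
    · intro F _ _ v x s' hs'
      have hvs : ∀ i, (v ∘ s') i = x * fcol F γ ^ (i : ℕ) := hs'
      have hv : Function.Injective v := injective_of_string hs'
      have huniv : univ.map s' = univ := by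
        apply eq_univ_of_card; rw [card_map, card_univ]
      rw [hR F v hv]
      have h3 := (isComb_PP α a b t).map v s' univ
      have h4 := (isComb_PP β a b t).map v s' univ
      rw [huniv] at h3 h4
      rw [← h3, ← h4]
      have h5 := PP_strVal hγα (hprod F).1 (b := b) ha ht (v ∘ s') x hvs
      have h6 := PP_strVal hγβ (hprod F).2 (b := b) ha ht (v ∘ s') x hvs
      linear_combination (1 - (fcol F α : F) ^ t) * h5 - (1 - (fcol F β : F) ^ t) * h6
  rw [← sub_eq_zero]
  ext S
  rw [Tw.sub_apply, Tw.smul_apply, Tw.smul_apply, Tw.zero_apply]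
  by_cases hS : #S = a * t
  · obtain ⟨g, hg⟩ := IsComb.exists_map_univ hS
    have h3 := (isComb_PP α a b t).map v g univ
    have h4 := (isComb_PP β a b t).map v g univ
    rw [hg] at h3 h4
    rw [← h3, ← h4, ← hR F (v ∘ g) (hv.comp g.injective), hR0, map_zero]
  · rw [PP_of_card_ne α a b v hS, PP_of_card_ne β a b v hS]; ring

end Consequences

/-! ### The exponential -/

section Exp

variable {I F : Type} [Fintype I] [DecidableEq I] [Field F] {κ : I → I → F}

namespace Tw

lemma exp_empty [CharZero F] {f : Tw κ} (hf : f ∅ = 0) : IsNilpotent.exp f ∅ = 1 := by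
  rw [IsNilpotent.exp_eq_sum (isNilpotent_of_empty hf), Finset.sum_range_succ', add_apply,
    sum_apply, Finset.sum_eq_zero]
  · rw [rat_smul_apply, pow_zero, one_apply, if_pos rfl]; simp
  · intro k _
    rw [rat_smul_apply, pow_apply_of_card_lt hf _ _ (by simp), mul_zero]

lemma pow_supp {a : ℕ} {f : Tw κ} (hf : ∀ S, ¬ a ∣ #S → f S = 0) (k : ℕ) (S : Finset I)
    (hS : ¬ a ∣ #S) : (f ^ k) S = 0 := by
  induction k generalizing S with
  | zero =>
    rw [pow_zero, one_apply, if_neg]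
    rintro rfl
    exact hS (by simp)
  | succ k ih => rw [pow_succ]; exact mul_supp ih hf S hS

lemma exp_supp [CharZero F] {a : ℕ} {f : Tw κ} (hf : ∀ S, ¬ a ∣ #S → f S = 0) (h0 : f ∅ = 0)
    (S : Finset I) (hS : ¬ a ∣ #S) : IsNilpotent.exp f S = 0 := by
  rw [IsNilpotent.exp_eq_sum (isNilpotent_of_empty h0), sum_apply]
  exact Finset.sum_eq_zero fun k _ => by rw [rat_smul_apply, pow_supp hf k S hS, mul_zero]

lemma scale_comm (w w' : ℕ → F) (f : Tw κ) : scale w (scale w' f) = scale w' (scale w f) := by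
  ext S; simp only [scale_apply]; ring

lemma eq_total_part {a : ℕ} (ha : 0 < a) {f : Tw κ} (hf : ∀ S, ¬ a ∣ #S → f S = 0) :
    f = total a fun t => part (a * t) f := by
  ext S
  by_cases h : a ∣ #S
  · obtain ⟨t, ht⟩ := h
    rw [total_apply ha _ ht, part_apply, if_pos ht]
  · rw [total_of_not_dvd _ h, hf S h]

end Tw

end Exp

section Combo

variable {I F : Type} [Fintype I] [DecidableEq I] [Field F] [Algebra Kq F]

/-- The set function of `∑_t r_t P_{at,bt}`. -/
def combo (c : Fin 3) (a : ℕ) (b : ℤ) (r : ℕ → F) (v : I → Fˣ) : Tw (kap v) :=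
  Tw.total a fun t => r t • PP c a b t v

variable {c : Fin 3} {a : ℕ} {b : ℤ} {v : I → Fˣ}

lemma combo_apply (ha : 0 < a) (r : ℕ → F) {S : Finset I} {t : ℕ} (h : #S = a * t) :
    combo c a b r v S = r t * PP c a b t v S := by
  rw [combo, Tw.total_apply ha _ h, Tw.smul_apply]

lemma combo_supp (r : ℕ → F) (S : Finset I) (h : ¬ a ∣ #S) : combo c a b r v S = 0 :=
  Tw.total_of_not_dvd _ h

lemma combo_empty (ha : 0 < a) (r : ℕ → F) : combo c a b r v ∅ = 0 := by
  rw [combo_apply ha r (t := 0) (by simp)]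
  simp [PP, Tw.zero_apply]

lemma combo_congr (ha : 0 < a) {r r' : ℕ → F} (h : ∀ t, 0 < t → r t = r' t) :
    combo c a b r v = combo c a b r' v := by
  ext S
  by_cases hd : a ∣ #S
  · obtain ⟨t, ht⟩ := hd
    rw [combo_apply ha _ ht, combo_apply ha _ ht]
    rcases Nat.eq_zero_or_pos t with rfl | h0
    · simp [PP, Tw.zero_apply]
    · rw [h t h0]
  · rw [combo_supp _ S hd, combo_supp _ S hd]

lemma combo_add (ha : 0 < a) (r r' : ℕ → F) :
    combo c a b (fun t => r t + r' t) v = combo c a b r v + combo c a b r' v := by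
  ext S
  by_cases hd : a ∣ #S
  · obtain ⟨t, ht⟩ := hd
    rw [Tw.add_apply, combo_apply ha _ ht, combo_apply ha _ ht, combo_apply ha _ ht, add_mul]
  · rw [Tw.add_apply, combo_supp _ S hd, combo_supp _ S hd, combo_supp _ S hd, add_zero]

lemma scale_combo (ha : 0 < a) (w r : ℕ → F) :
    Tw.scale w (combo c a b r v) = combo c a b (fun t => w (a * t) * r t) v := by
  ext S
  rw [Tw.scale_apply]
  by_cases hd : a ∣ #S
  · obtain ⟨t, ht⟩ := hd
    rw [combo_apply ha _ ht, combo_apply ha _ ht, ht, mul_assoc]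
  · rw [combo_supp _ S hd, combo_supp _ S hd, mul_zero]

lemma dlog_eq_combo : dlog c a b v = combo c a b (fun _ => (a : F)) v := by
  rw [dlog, combo]
  ext S
  rw [Tw.smul_apply, Tw.total, Tw.total]
  split_ifs
  · rw [Tw.smul_apply]
  · rw [mul_zero]

lemma combo_commute (ha : 0 < a) (hab : IsCoprime (a : ℤ) b) (hv : Function.Injective v)
    (r r' : ℕ → F) : Commute (combo c a b r v) (combo c a b r' v) := by
  have hs : ∀ (r : ℕ → F) (t : ℕ) (S : Finset I), #S ≠ a * t → (r t • PP c a b t v) S = 0 :=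
    fun r t S h => by rw [Tw.smul_apply, PP_of_card_ne c a b v h, mul_zero]
  rw [Commute, SemiconjBy, combo, combo, Tw.total_mul ha _ _ (hs r), Tw.total_mul ha _ _ (hs r')]
  congr 1
  ext1 t
  rw [← Finset.Nat.sum_antidiagonal_swap]
  refine Finset.sum_congr rfl fun p _ => ?_
  rw [Tw.smul_mul', Tw.mul_smul', Tw.smul_mul', Tw.mul_smul', PP_comm ha hab c _ _ hv, smul_comm]
  rfl

/-- Multiplication of the values on sets of size `a t` by `x ^ t`. -/
def gradeScale (a : ℕ) (x : F) (f : Tw (kap v)) : Tw (kap v) := Tw.scale (fun m => x ^ (m / a)) f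

lemma gradeScale_empty (x : F) (f : Tw (kap v)) : gradeScale a x f ∅ = f ∅ := by
  rw [gradeScale, Tw.scale_apply]; simp

lemma scale_gradeScale (w : ℕ → F) (x : F) (f : Tw (kap v)) :
    Tw.scale w (gradeScale a x f) = gradeScale a x (Tw.scale w f) := Tw.scale_comm _ _ _

lemma gradeScale_mul (ha : 0 < a) (x : F) {f g : Tw (kap v)} (hf : ∀ S, ¬ a ∣ #S → f S = 0)
    (hg : ∀ S, ¬ a ∣ #S → g S = 0) :
    gradeScale a x (f * g) = gradeScale a x f * gradeScale a x g := by
  refine Tw.scale_mul (fun m => x ^ (m / a)) a ?_ f g hf hg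
  rintro _ _ ⟨i, rfl⟩ ⟨j, rfl⟩
  rw [← mul_add, Nat.mul_div_cancel_left _ ha, Nat.mul_div_cancel_left _ ha,
    Nat.mul_div_cancel_left _ ha, pow_add]

lemma X_supp (S : Finset I) (h : ¬ a ∣ #S) : X c a b v S = 0 := if_neg h

/-- `X` is an exponential of the elements `P`, up to rescaling. -/
lemma exp_combo_eq (ha : 0 < a) (hab : IsCoprime (a : ℤ) b) (hv : Function.Injective v) (x : F)
    [CharZero F] :
    IsNilpotent.exp (combo c a b (fun t => x ^ t / t) v) = gradeScale a x (X c a b v) := by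
  have hN : Tw.scale (fun m => (m : F)) (combo c a b (fun t => x ^ t / t) v) =
      gradeScale a x (dlog c a b v) := by
    rw [dlog_eq_combo, scale_combo ha, gradeScale, scale_combo ha]
    refine combo_congr ha fun t ht => ?_
    have : (t : F) ≠ 0 := Nat.cast_ne_zero.2 ht.ne'
    rw [Nat.mul_div_cancel_left _ ha]
    push_cast
    field_simp
  refine Tw.eq_of_scale_eq_mul (g := Tw.scale (fun m => (m : F)) (combo c a b _ v)) ?_ ?_
    (Tw.scale_exp (combo_empty ha _) ?_) ?_
  · rw [Tw.scale_apply]; simp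
  · rw [Tw.exp_empty (combo_empty ha _), gradeScale_empty, X_empty]
  · rw [scale_combo ha]
    exact combo_commute ha hab hv _ _
  · rw [hN, scale_gradeScale, ← dlog_mul_X ha, gradeScale_mul ha]
    · rw [dlog_eq_combo]; exact combo_supp _
    · exact X_supp

/-- The difference equation of the quantum exponential of the elements `P`. -/
lemma gradeScale_exp (ha : 0 < a) (hab : IsCoprime (a : ℤ) b) (hv : Function.Injective v)
    (x p : F) (hp : ∀ t, 0 < t → p ^ t ≠ 1) [CharZero F] :
    gradeScale a p (IsNilpotent.exp (combo c a b (fun t => x ^ t / (t * (p ^ t - 1))) v)) =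
      gradeScale a x (X c a b v) *
        IsNilpotent.exp (combo c a b (fun t => x ^ t / (t * (p ^ t - 1))) v) := by
  set r : ℕ → F := fun t => x ^ t / (t * (p ^ t - 1)) with hr
  have hadd : combo c a b (fun t => p ^ t * r t) v =
      combo c a b (fun t => x ^ t / t) v + combo c a b r v := by
    rw [← combo_add ha]
    refine combo_congr ha fun t ht => ?_
    have h1 : (t : F) ≠ 0 := Nat.cast_ne_zero.2 ht.ne'
    have h2 : p ^ t - 1 ≠ 0 := sub_ne_zero.2 (hp t ht)
    simp only [hr]
    field_simp
    ring
  rw [← exp_combo_eq ha hab hv, ← IsNilpotent.exp_add_of_commute (combo_commute ha hab hv _ _)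
    ⟨_, Tw.isNilpotent_of_empty (combo_empty ha _)⟩
    ⟨_, Tw.isNilpotent_of_empty (combo_empty ha _)⟩, ← hadd]
  have hs : gradeScale a p (combo c a b r v) = combo c a b (fun t => p ^ t * r t) v := by
    rw [gradeScale, scale_combo ha]
    simp only [Nat.mul_div_cancel_left _ ha]
  have hc : ∀ s s' : ℕ → F, Commute (Tw.scale (fun m => (m : F)) (combo c a b s v))
      (combo c a b s' v) := by
    intro s s'
    rw [scale_combo ha]
    exact combo_commute ha hab hv _ _
  refine Tw.eq_of_scale_eq_mul
    (g := Tw.scale (fun m => (m : F)) (combo c a b (fun t => p ^ t * r t) v)) ?_ ?_ ?_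
    (Tw.scale_exp (combo_empty ha _) (hc _ _))
  · rw [Tw.scale_apply]; simp
  · rw [Tw.exp_empty (combo_empty ha _), gradeScale_empty, Tw.exp_empty (combo_empty ha _)]
  · rw [scale_gradeScale, Tw.scale_exp (combo_empty ha _) (hc _ _), gradeScale_mul ha,
      ← scale_gradeScale, hs]
    · rw [scale_combo ha]; exact combo_supp _
    · exact Tw.exp_supp (combo_supp _) (combo_empty ha _)

/-- The recursion for the homogeneous parts of the quantum exponential. -/
lemma part_exp_recursion (ha : 0 < a) (hab : IsCoprime (a : ℤ) b) (hv : Function.Injective v)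
    (x p : F) (hp : ∀ t, 0 < t → p ^ t ≠ 1) [CharZero F] (t : ℕ) {G : Tw (kap v)}
    (hG : G = IsNilpotent.exp (combo c a b (fun t => x ^ t / (t * (p ^ t - 1))) v)) :
    (p ^ (t + 1) - 1) • Tw.part (a * (t + 1)) G = ∑ s ∈ range (t + 1),
      x ^ (s + 1) • (M c (a * (s + 1)) (slopeExp a b) v * Tw.part (a * (t - s)) G) := by
  have h := gradeScale_exp (c := c) ha hab hv x p hp
  rw [← hG] at h
  have hGs : ∀ S, ¬ a ∣ #S → G S = 0 := by
    rw [hG]; exact Tw.exp_supp (combo_supp _) (combo_empty ha _)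
  have hX : gradeScale a x (X c a b v) =
      Tw.total a fun t => x ^ t • M c (a * t) (slopeExp a b) v := by
    ext S
    rw [gradeScale, Tw.scale_apply, X_eq_total]
    by_cases hd : a ∣ #S
    · obtain ⟨t, ht⟩ := hd
      rw [Tw.total_apply ha _ ht, Tw.total_apply ha _ ht, Tw.smul_apply, ht,
        Nat.mul_div_cancel_left _ ha]
    · rw [Tw.total_of_not_dvd _ hd, Tw.total_of_not_dvd _ hd, mul_zero]
  have hMs : ∀ (t : ℕ) (S : Finset I), #S ≠ a * t →
      (x ^ t • M c (a * t) (slopeExp a b) v) S = 0 :=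
    fun t S h => by rw [Tw.smul_apply, M_of_card_ne c _ v h, mul_zero]
  ext S
  by_cases hS : #S = a * (t + 1)
  · have h1 := congrFun h S
    rw [hX] at h1
    conv_rhs at h1 => rw [Tw.eq_total_part ha hGs]
    rw [Tw.total_mul ha _ _ hMs, Tw.total_apply ha _ hS, gradeScale, Tw.scale_apply, hS,
      Nat.mul_div_cancel_left _ ha, Finset.Nat.sum_antidiagonal_eq_sum_range_succ
      (fun i j => x ^ i • M c (a * i) (slopeExp a b) v * Tw.part (a * j) G),
      Finset.sum_range_succ', Tw.add_apply, mul_zero, M_zero, pow_zero, one_smul, one_mul,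
      Nat.sub_zero, Tw.part_apply, if_pos hS] at h1
    rw [Tw.smul_apply, Tw.part_apply, if_pos hS, sub_mul, h1, one_mul, add_sub_cancel_right]
    rw [Tw.sum_apply, Tw.sum_apply]
    refine Finset.sum_congr rfl fun s _ => ?_
    rw [Tw.smul_mul', Nat.add_sub_add_right]
  · rw [Tw.smul_apply, Tw.part_apply, if_neg hS, mul_zero, Tw.sum_apply]
    symm
    refine Finset.sum_eq_zero fun s hs => ?_
    rw [mem_range] at hs
    rw [Tw.smul_apply, Tw.mul_apply, Finset.sum_eq_zero, mul_zero]
    intro U hU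
    by_cases h1 : #U = a * (s + 1)
    · rw [Tw.part_apply, if_neg, mul_zero, zero_mul]
      intro h2
      apply hS
      rw [← Tw.card_add (mem_powerset.1 hU), h1, h2, ← mul_add]
      congr 1
      omega
    · rw [M_of_card_ne c _ v h1, zero_mul, zero_mul]

end Combo

/-- Up to the denominators `∏ (p^i - 1)`, the quantum exponential of the elements `P` is
integral. -/
theorem exists_isComb_exp (c δ : Fin 3) {a : ℕ} {b : ℤ} (ha : 0 < a) (hab : IsCoprime (a : ℤ) b)
    (x : Zq) (t : ℕ) : ∃ h : Fam, IsComb c (a * t) h ∧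
      ∀ (I F : Type) [Fintype I] [DecidableEq I] [Field F] [Algebra Kq F] [CharZero F] (v : I → Fˣ),
        Function.Injective v →
        (∏ i ∈ range t, ((fcol F δ : F) ^ (i + 1) - 1)) • Tw.part (a * t) (IsNilpotent.exp
          (combo c a b (fun t => coefHom F x ^ t / (t * ((fcol F δ : F) ^ t - 1))) v)) =
        coefHom F x ^ t • h I F v := by
  induction t using Nat.strong_induction_on with
  | _ t ih =>
  rcases t with _ | t
  · refine ⟨_, IsComb.M 0, ?_⟩
    intro I F _ _ _ _ _ v hv
    rw [range_zero, prod_empty, one_smul, pow_zero, one_smul, mul_zero, M_zero]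
    ext S
    rw [Tw.part_apply, Tw.one_apply]
    by_cases hS : S = ∅
    · rw [if_pos (by rw [hS, card_empty]), if_pos hS, hS, Tw.exp_empty (combo_empty ha _)]
    · rw [if_neg (by rwa [card_eq_zero]), if_neg hS]
  · have : Nonempty Fam := ⟨fun _ _ _ _ _ _ _ => 0⟩
    choose! h hc hh using ih
    refine ⟨fun I F _ _ _ _ v => ∑ s ∈ range (t + 1),
      coefHom F (∏ i ∈ Ico (t - s) t, ((zcol δ : Zq) ^ (i + 1) - 1)) •
        (M c (a * (s + 1)) (slopeExp a b) v * h (t - s) I F v), ?_, ?_⟩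
    · refine IsComb.sum (range (t + 1)) fun s hs => IsComb.smul _ ?_
      rw [mem_range] at hs
      have e : a * (t + 1) = a * (s + 1) + a * (t - s) := by rw [← mul_add]; congr 1; omega
      rw [e]
      exact (IsComb.M _).mul (hc (t - s) (by omega))
    · intro I F _ _ _ _ _ v hv
      have hp : ∀ t, 0 < t → (fcol F δ : F) ^ t ≠ 1 := fun t ht => fcol_pow_ne_one δ ht.ne'
      set p : F := (fcol F δ : F) with hpdef
      set x' : F := coefHom F x with hx'
      rw [prod_range_succ, mul_smul, part_exp_recursion ha hab hv x' p hp t rfl, Finset.smul_sum,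
        Finset.smul_sum]
      refine Finset.sum_congr rfl fun s hs => ?_
      rw [mem_range] at hs
      have e := hh (t - s) (by omega) I F v hv
      rw [map_prod, ← Finset.prod_range_mul_prod_Ico _ (Nat.sub_le t s)]
      have e2 : ∏ i ∈ Ico (t - s) t, coefHom F ((zcol δ : Zq) ^ (i + 1) - 1) =
          ∏ i ∈ Ico (t - s) t, (p ^ (i + 1) - 1) := by
        refine Finset.prod_congr rfl fun i _ => ?_
        rw [map_sub, map_pow, map_one, coefHom_zcol]
      rw [e2, smul_comm _ (x' ^ (s + 1)), mul_comm (∏ i ∈ range (t - s), _), mul_smul,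
        ← Tw.mul_smul' _ _ (Tw.part _ _), e, Tw.mul_smul', smul_comm _ (x' ^ (t - s)), smul_smul,
        ← pow_add]
      congr 2
      omega

/-! ### Divisibility of the specializations -/

section LinearFactors

variable {k : ℕ}

lemma zcol_prod {c δ : Fin 3} (hc : c ≠ 1) (hδ : δ ≠ 1) (hcδ : c ≠ δ) :
    zcol c * zcol 1 * zcol δ = 1 := by
  have h : ∀ c δ : Fin 3, c ≠ 1 → δ ≠ 1 → c ≠ δ →
      (c = 0 ∧ δ = 2) ∨ (c = 2 ∧ δ = 0) := by decide
  have h0 := col_prod 0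
  ext1
  apply qHom_injective
  simp only [Units.val_mul, map_mul, qHom_zcol, Units.val_one, map_one]
  rcases h c δ hc hδ hcδ with ⟨rfl, rfl⟩ | ⟨rfl, rfl⟩
  · exact h0
  · rw [← h0]; simp only [zero_add]; ring

lemma lcol_prod {c δ : Fin 3} (hc : c ≠ 1) (hδ : δ ≠ 1) (hcδ : c ≠ δ) :
    (lcol c * lcol 1 * lcol δ : (Laurent Zq (Fin k))ˣ) = 1 := by
  rw [lcol, lcol, lcol, ← map_mul, ← map_mul, zcol_prod hc hδ hcδ, map_one]

variable {c δ γ : Fin 3} {i j : ℕ} (x y : (Laurent Zq (Fin k))ˣ)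

lemma lin_dvd_numLink (h : γ ≠ c) : lin γ x y ∣ numLink c i j x y := by
  have h' : γ = c + 1 ∨ γ = c + 2 := by revert γ c; decide
  rw [numLink]
  split_ifs
  · apply Dvd.dvd.mul_left
    rcases h' with rfl | rfl
    · exact dvd_mul_right _ _
    · exact dvd_mul_left _ _
  · apply Dvd.dvd.mul_left
    rcases h' with rfl | rfl
    · exact (dvd_mul_left _ _).mul_right _
    · exact dvd_mul_left _ _

lemma lin_mul_lin_dvd_numLink (h : δ ≠ c) (hij : i + 1 ≠ j) :
    lin c x y * lin δ x y ∣ numLink c i j x y := by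
  have h' : δ = c + 1 ∨ δ = c + 2 := by revert δ c; decide
  rw [numLink, if_neg hij]
  apply Dvd.dvd.mul_left
  rcases h' with rfl | rfl
  · exact dvd_mul_right _ _
  · rw [mul_assoc]; exact mul_dvd_mul_left _ (dvd_mul_left _ _)

lemma lin_shift_dvd (h : (lcol c * lcol 1 * lcol δ : (Laurent Zq (Fin k))ˣ) = 1) :
    lin c (x * lcol 1) y ∣ lin δ y x := by
  refine ⟨-((lcol δ : (Laurent Zq (Fin k))ˣ) : Laurent Zq (Fin k)), ?_⟩
  have h' := congrArg Units.val h
  simp only [Units.val_mul, Units.val_one] at h'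
  rw [lin, lin]
  simp only [Units.val_mul]
  linear_combination (-(x : Laurent Zq (Fin k))) * h'

/-- If `num a` provides two factors indexed by `a`, or the two factors indexed by `a + 1`, according
to the side of a threshold `m` on which `a` lies, and next to the threshold one factor may be
missing, then all factors of positive index are provided. -/
lemma prod_dvd_of_threshold {A : Type*} [CommMonoid A] {α β num : ℕ → A} {N m : ℕ} (hm : m ≤ N)
    (h1 : ∀ a < N, m < a → α a * β a ∣ num a) (h2 : m < N → β m ∣ num m)
    (h3 : ∀ a < N, a + 1 < m → α (a + 1) * β (a + 1) ∣ num a)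
    (h4 : ∀ a < N, a + 1 = m → α m ∣ num a) :
    ∏ a ∈ Ico 1 N, α a * β a ∣ ∏ a ∈ range N, num a := by
  have low : ∀ r, r < m → ∏ a ∈ Ico 1 (r + 1), α a * β a ∣ ∏ a ∈ range r, num a := by
    intro r hr
    rw [Finset.prod_Ico_eq_prod_range, Nat.add_sub_cancel]
    refine Finset.prod_dvd_prod_of_dvd _ _ fun a ha => ?_
    rw [mem_range] at ha
    rw [add_comm 1 a]
    exact h3 a (by omega) (by omega)
  have high : ∀ r, m < r → ∏ a ∈ Ico r N, α a * β a ∣ ∏ a ∈ Ico r N, num a := by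
    intro r hr
    refine Finset.prod_dvd_prod_of_dvd _ _ fun a ha => ?_
    rw [mem_Ico] at ha
    exact h1 a ha.2 (by omega)
  rcases Nat.eq_zero_or_pos m with rfl | h0
  · rcases Nat.eq_zero_or_pos N with rfl | hN
    · simp
    · rw [range_eq_Ico, Finset.prod_eq_prod_Ico_succ_bot hN]
      exact (high 1 one_pos).mul_left _
  obtain ⟨r, rfl⟩ : ∃ r, m = r + 1 := ⟨m - 1, by omega⟩
  rcases hm.eq_or_lt with rfl | hlt
  · rw [Finset.prod_range_succ]
    exact (low r (by omega)).mul_right _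
  · rw [← Finset.prod_Ico_consecutive _ (show 1 ≤ r + 1 by omega) hlt.le,
      Finset.prod_eq_prod_Ico_succ_bot hlt, range_eq_Ico,
      ← Finset.prod_Ico_consecutive num (Nat.zero_le (r + 1)) hlt.le,
      Finset.prod_eq_prod_Ico_succ_bot hlt, ← range_eq_Ico, Finset.prod_range_succ,
      mul_assoc (∏ a ∈ range r, num a)]
    refine mul_dvd_mul (low r (by omega)) ?_
    rw [← mul_assoc (num r)]
    exact mul_dvd_mul (mul_dvd_mul (h4 r (by omega) rfl) (h2 hlt)) (high _ (by omega))

/-- The numerator of the kernel between two points at the positions `p` and `p'` of an ordering. -/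
def pairNum (c : Fin 3) (p p' : ℕ) (x y : (Laurent Zq (Fin k))ˣ) : Laurent Zq (Fin k) :=
  if p < p' then numLink c p p' x y else -numLink c p' p y x

/-- The kernels between a point and the points of a `q₂`-string, which is met in decreasing
order. -/
lemma prod_lin_dvd_prod_pairNum (hc : c ≠ 1) (hδ : δ ≠ 1) (hcδ : c ≠ δ) {N : ℕ} {P : ℕ → ℕ}
    (hP : ∀ a b, a < b → b < N → P b < P a) {p : ℕ} (hp : ∀ a < N, P a ≠ p) :
    ∏ a ∈ Ico 1 N, (lin c (x * lcol 1 ^ a) y * lin δ (x * lcol 1 ^ a) y) ∣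
      ∏ a ∈ range N, pairNum c (P a) p (x * lcol 1 ^ a) y := by
  have h1 := lcol_prod (k := k) hc hδ hcδ
  have h2 := lcol_prod (k := k) hδ hc hcδ.symm
  obtain ⟨m, hmN, hm⟩ : ∃ m ≤ N, ∀ a < N, P a < p ↔ m ≤ a := by
    by_cases h : ∃ a, a < N ∧ P a < p
    · classical
      refine ⟨Nat.find h, (Nat.find_spec h).1.le, fun a ha => ⟨fun h' => Nat.find_min' h ⟨ha, h'⟩,
        fun h' => ?_⟩⟩
      rcases h'.eq_or_lt with rfl | h'
      · exact (Nat.find_spec h).2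
      · exact (hP _ _ h' ha).trans (Nat.find_spec h).2
    · push Not at h
      exact ⟨N, le_rfl, fun a ha => ⟨fun h' => absurd h' (h a ha).not_gt, fun h' => by omega⟩⟩
  have hpos : ∀ a < N, m ≤ a → pairNum c (P a) p (x * lcol 1 ^ a) y =
      numLink c (P a) p (x * lcol 1 ^ a) y := fun a ha h => if_pos ((hm a ha).2 h)
  have hneg : ∀ a < N, a < m → pairNum c (P a) p (x * lcol 1 ^ a) y =
      -numLink c p (P a) y (x * lcol 1 ^ a) := fun a ha h => if_neg fun h' => by
    have := (hm a ha).1 h'; omega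
  refine prod_dvd_of_threshold (m := m) (α := fun a => lin c (x * lcol 1 ^ a) y)
    (β := fun a => lin δ (x * lcol 1 ^ a) y) hmN ?_ ?_ ?_ ?_
  · intro a ha hma
    rw [hpos a ha hma.le]
    apply lin_mul_lin_dvd_numLink _ _ hcδ.symm
    have h3 := hP m a hma ha
    have h4 := (hm m (hma.trans ha)).2 le_rfl
    omega
  · intro h
    rw [hpos m h le_rfl]
    exact lin_dvd_numLink _ _ hcδ.symm
  · intro a ha ham
    rw [hneg a ha (by omega), dvd_neg]
    have h3 : p < P (a + 1) := by
      have h5 := hp (a + 1) (by omega)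
      have h6 : ¬ P (a + 1) < p := fun h => by
        have := (hm (a + 1) (by omega)).1 h; omega
      omega
    have h4 := hP a (a + 1) (by omega) (by omega)
    refine dvd_trans ?_ (lin_mul_lin_dvd_numLink y (x * lcol 1 ^ a) (c := c) hcδ.symm (by omega))
    rw [mul_comm]
    simp only [pow_succ, ← mul_assoc]
    exact mul_dvd_mul (lin_shift_dvd _ _ h2) (lin_shift_dvd _ _ h1)
  · rintro a ha rfl
    rw [hneg a ha (by omega), dvd_neg]
    refine dvd_trans ?_ (lin_dvd_numLink y (x * lcol 1 ^ a) hcδ.symm)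
    simp only [pow_succ, ← mul_assoc]
    exact lin_shift_dvd _ _ h1

end LinearFactors

section Strings

variable {F : Type} [Field F] [Algebra Kq F]

lemma prod_triangle {A : Type*} [CommMonoid A] (g : ℕ → A) (N : ℕ) :
    ∏ a ∈ range N, ∏ b ∈ range a, g (a - b) = ∏ s ∈ Ico 1 N, g s ^ (N - s) := by
  induction N with
  | zero => simp
  | succ N ih =>
    rw [Finset.prod_range_succ, ih]
    have h1 : ∏ b ∈ range N, g (N - b) = ∏ s ∈ Ico 1 (N + 1), g s := by
      rw [Finset.prod_Ico_eq_prod_range, Nat.add_sub_cancel, ← Finset.prod_range_reflect]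
      refine Finset.prod_congr rfl fun b hb => ?_
      rw [mem_range] at hb
      congr 1; omega
    have h2 : ∏ s ∈ Ico 1 N, g s ^ (N - s) = ∏ s ∈ Ico 1 (N + 1), g s ^ (N - s) := by
      rcases Nat.eq_zero_or_pos N with rfl | hN
      · simp
      · rw [Finset.prod_Ico_succ_top hN]; simp
    rw [h1, h2, ← Finset.prod_mul_distrib]
    refine Finset.prod_congr rfl fun s hs => ?_
    rw [mem_Ico] at hs
    rw [← pow_succ]; congr 1; omega

lemma one_sub_mul_zred {c δ : Fin 3} (hc : c ≠ 1) (hδ : δ ≠ 1) (hcδ : c ≠ δ) :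
    (1 - (fcol F δ : F)) * zred c (fcol F 1 : F) = zeta (fcol F 1 : F) := by
  rw [zeta_eq_zred c (fcol F 1).ne_zero, mul_comm]
  congr 2
  have := congrArg (coefHom F) (congrArg Units.val (zcol_prod hc hδ hcδ))
  simp only [Units.val_mul, map_mul, coefHom_zcol, Units.val_one, map_one] at this
  rw [mul_comm (fcol F 1 : F)]
  exact (inv_eq_of_mul_eq_one_right this).symm

/-- The kernels between the points of a `q₂`-string, which is met in decreasing order. -/
lemma prod_link_string {c δ : Fin 3} (hc : c ≠ 1) (hδ : δ ≠ 1) (hcδ : c ≠ δ) {N : ℕ} {P : ℕ → ℕ}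
    (hP : ∀ a b, a < b → b < N → P b < P a) (x : Fˣ) :
    ∃ e : ℕ, (1 - (fcol F δ : F)) ^ N * (∏ a ∈ range N, ∏ b ∈ range N,
      if P a < P b then link c (P a) (P b) ((x * fcol F 1 ^ a / (x * fcol F 1 ^ b) : Fˣ) : F)
        else 1) =
      (1 - (fcol F δ : F)) ^ e * ∏ s ∈ Ico 1 N, zeta ((fcol F 1 : F) ^ s) ^ (N - s) := by
  have hlt : ∀ a < N, ∀ b < N, (P a < P b ↔ b < a) := by
    intro a ha b hb
    rcases lt_trichotomy a b with h | rfl | h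
    · have := hP a b h hb; omega
    · simp
    · have := hP b a h ha; omega
  have key : ∀ a < N, ∃ e : ℕ, (1 - (fcol F δ : F)) * (∏ b ∈ range N,
      if P a < P b then link c (P a) (P b) ((x * fcol F 1 ^ a / (x * fcol F 1 ^ b) : Fˣ) : F)
        else 1) =
      (1 - (fcol F δ : F)) ^ e * ∏ b ∈ range a, zeta ((fcol F 1 : F) ^ (a - b)) := by
    intro a ha
    have h1 : (∏ b ∈ range N,
        if P a < P b then link c (P a) (P b) ((x * fcol F 1 ^ a / (x * fcol F 1 ^ b) : Fˣ) : F)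
          else 1) = ∏ b ∈ range a, link c (P a) (P b) ((fcol F 1 : F) ^ (a - b)) := by
      rw [← Finset.prod_subset (range_subset_range.2 ha.le)]
      · refine Finset.prod_congr rfl fun b hb => ?_
        rw [mem_range] at hb
        rw [if_pos ((hlt a ha b (hb.trans ha)).2 hb), mul_div_mul_left_eq_div]
        congr 1
        rw [← Units.val_pow_eq_pow_val]
        congr 1
        rw [div_eq_iff_eq_mul, ← pow_add]
        congr 1; omega
      · intro b hb hb'
        rw [mem_range] at hb hb'
        rw [if_neg (fun h => hb' ((hlt a ha b hb).1 h))]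
    rw [h1]
    rcases a with _ | a
    · exact ⟨1, by simp⟩
    · have h2 : ∏ b ∈ range a, link c (P (a + 1)) (P b) ((fcol F 1 : F) ^ (a + 1 - b)) =
          ∏ b ∈ range a, zeta ((fcol F 1 : F) ^ (a + 1 - b)) := by
        refine Finset.prod_congr rfl fun b hb => ?_
        rw [mem_range] at hb
        rw [link, if_neg]
        have h3 := hP b a hb (by omega)
        have h4 := hP a (a + 1) (by omega) ha
        omega
      rw [Finset.prod_range_succ, Finset.prod_range_succ, h2, Nat.add_sub_cancel_left, pow_one, link]
      split_ifs
      · refine ⟨0, ?_⟩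
        rw [← one_sub_mul_zred hc hδ hcδ]; ring
      · exact ⟨1, by ring⟩
  choose! e he using key
  refine ⟨∑ a ∈ range N, e a, ?_⟩
  rw [← prod_triangle (fun s => zeta ((fcol F 1 : F) ^ s)), ← Finset.prod_pow_eq_pow_sum,
    ← Finset.prod_mul_distrib]
  conv_lhs => rw [← card_range N, ← Finset.prod_const, card_range, ← Finset.prod_mul_distrib]
  exact Finset.prod_congr rfl fun a ha => he a (mem_range.1 ha)

end Strings

section Blocks

variable {k : ℕ}

lemma prod_prod_eq_prod_Ioi {A : Type*} [CommMonoid A] (f : Fin k → Fin k → A) :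
    ∏ i, ∏ j, f i j = ∏ i, (f i i * ∏ j ∈ Ioi i, (f i j * f j i)) := by
  rw [Finset.prod_mul_distrib]
  have h := Finset.prod_prod_Ioi_mul_eq_prod_prod_off_diag (fun i j => f j i)
  rw [h, ← Finset.prod_mul_distrib]
  exact Finset.prod_congr rfl fun i _ => Fintype.prod_eq_mul_prod_compl i _

/-- The point `x_i q₂^a`. -/
def blockPt (i : Fin k) (a : ℕ) : (Laurent Zq (Fin k))ˣ := lvar i * lcol 1 ^ a

/-- The point `x_i q₂^a`, as a rational function. -/
def blockVal (i : Fin k) (a : ℕ) : (RatFun k)ˣ := uvar k i * fcol (RatFun k) 1 ^ a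

lemma map_toRat_lcol (c : Fin 3) :
    Units.map (toRat k : Laurent Zq (Fin k) →* RatFun k) (lcol c) = fcol (RatFun k) c :=
  map_ev_lcol _ _

lemma map_toRat_lvar (i : Fin k) :
    Units.map (toRat k : Laurent Zq (Fin k) →* RatFun k) (lvar i) = uvar k i :=
  map_ev_lvar _ _

lemma toRat_unit (x : (Laurent Zq (Fin k))ˣ) : toRat k (x : Laurent Zq (Fin k)) =
    Units.map (toRat k : Laurent Zq (Fin k) →* RatFun k) x := rfl

lemma toRat_lC (r : Zq) : toRat k (lC r) = coefHom (RatFun k) r := ev_lC _ _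

lemma map_toRat_blockPt (i : Fin k) (a : ℕ) :
    Units.map (toRat k : Laurent Zq (Fin k) →* RatFun k) (blockPt i a) = blockVal i a := by
  rw [blockPt, blockVal, map_mul, map_pow, map_toRat_lcol, map_toRat_lvar]

lemma blockVal_inj {i j : Fin k} {a b : ℕ} (h : blockVal i a = blockVal j b) : i = j ∧ a = b := by
  rw [blockVal, blockVal, fcol_eq_map, ← map_pow, ← map_pow] at h
  obtain ⟨h1, h2⟩ := uvar_indep h
  refine ⟨h1, ?_⟩
  have : fcol Kq 1 ^ (a : ℤ) = fcol Kq 1 ^ (b : ℤ) := by simpa using h2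
  exact_mod_cast fcol_zpow_inj 1 this

lemma ev_pairNum {F : Type} [Field F] [Algebra Kq F] (v : Fin k → Fˣ) (c : Fin 3) {p p' : ℕ}
    (hp : p ≠ p') (x y : (Laurent Zq (Fin k))ˣ) {X Y : Fˣ}
    (hX : Units.map (ev v : Laurent Zq (Fin k) →* F) x = X)
    (hY : Units.map (ev v : Laurent Zq (Fin k) →* F) y = Y) (h : X ≠ Y) :
    ev v (pairNum c p p' x y) = (if p < p' then link c p p' ((X / Y : Fˣ) : F) else 1) *
      (if p' < p then link c p' p ((Y / X : Fˣ) : F) else 1) * ((Y : F) - X) := by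
  rw [pairNum]
  rcases hp.lt_or_gt with h1 | h1
  · rw [if_pos h1, if_pos h1, if_neg h1.not_gt, ev_numLink v c p p' x y hX hY h, mul_one]
  · rw [if_neg h1.not_gt, if_neg h1.not_gt, if_pos h1, map_neg,
      ev_numLink v c p' p y x hY hX h.symm]
    ring

variable (N : Fin k → ℕ)

/-- The differences between the points of different blocks. -/
def blockDiff : Laurent Zq (Fin k) := ∏ i, ∏ j ∈ Ioi i, ∏ b ∈ range (N j), ∏ a ∈ range (N i),
  ((blockPt j b : Laurent Zq (Fin k)) - (blockPt i a : Laurent Zq (Fin k)))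

/-- The factors of `divisor` for pairs of different blocks, up to units. -/
def blockDiv (c δ : Fin 3) : Laurent Zq (Fin k) :=
  ∏ i, ∏ j ∈ Ioi i, ∏ b ∈ range (N j), ∏ a ∈ Ico 1 (N i),
    (lin c (blockPt i a) (blockPt j b) * lin δ (blockPt i a) (blockPt j b))

/-- The factors of `divisor` for single blocks. -/
def blockConst : RatFun k := ∏ i, ((1 - (fcol (RatFun k) 1 : RatFun k)) ^ N i *
  ∏ s ∈ Ico 1 (N i), zeta ((fcol (RatFun k) 1 : RatFun k) ^ s) ^ (N i - s))

variable {N} {n : ℕ}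

/-- The contribution of one ordering to the specialization of a sum over orderings. -/
lemma exists_wt_eq {c δ : Fin 3} (hc : c ≠ 1) (hδ : δ ≠ 1) (hcδ : c ≠ δ) (hn : ∑ i, N i = n)
    (d : ℕ → ℤ) (o : Fin n ≃ Σ i, Fin (N i)) : ∃ y : Laurent Zq (Fin k),
      ((1 - (fcol (RatFun k) 1 : RatFun k)) * (1 - (fcol (RatFun k) δ : RatFun k))) ^ n *
        wt c d (fun e : Σ i, Fin (N i) => blockVal e.1 e.2) o * toRat k (blockDiff N) =
      blockConst N * toRat k (blockDiv N c δ * y) := by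
  by_cases h0 : wt c d (fun e : Σ i, Fin (N i) => blockVal e.1 e.2) o = 0
  · exact ⟨0, by rw [h0]; simp⟩
  -- The place of the point `x_i q₂^a` in the ordering.
  let P : Fin k → ℕ → ℕ := fun i a => if h : a < N i then (o.symm ⟨i, ⟨a, h⟩⟩ : ℕ) else 0
  have hPo : ∀ e : Σ i, Fin (N i), P e.1 e.2 = o.symm e := by
    rintro ⟨i, a⟩
    simp only [P, dif_pos a.2]
  have hPinj : ∀ i j a b, a < N i → b < N j → P i a = P j b → i = j ∧ a = b := by
    intro i j a b ha hb h
    have h1 : o.symm ⟨i, ⟨a, ha⟩⟩ = o.symm ⟨j, ⟨b, hb⟩⟩ := by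
      ext; simpa only [P, dif_pos ha, dif_pos hb] using h
    have h2 := o.symm.injective h1
    rw [Sigma.mk.injEq] at h2
    obtain ⟨rfl, h3⟩ := h2
    exact ⟨rfl, by simpa using h3⟩
  -- An ordering of non-zero weight meets every string in decreasing order.
  have hstep : ∀ i a, a + 1 < N i → P i (a + 1) < P i a := by
    intro i a ha
    by_contra hlt
    apply h0
    have ha' : a < N i := by omega
    have h1 : P i a ≠ P i (a + 1) := fun h => by have := (hPinj i i _ _ ha' ha h).2; omega
    refine wt_eq_zero (c' := 1) (i := o.symm ⟨i, ⟨a, ha'⟩⟩) (j := o.symm ⟨i, ⟨a + 1, ha⟩⟩) ?_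
      (fun h => absurd h.symm hc) ?_
    · rw [Fin.lt_def, ← hPo, ← hPo]
      simp only
      omega
    · rw [Equiv.apply_symm_apply, Equiv.apply_symm_apply]
      simp only [blockVal]
      rw [pow_succ, ← mul_assoc, mul_comm]
  have hP : ∀ i a b, a < b → b < N i → P i b < P i a := by
    intro i a b hab
    induction b, hab using Nat.le_induction with
    | base => exact hstep i a
    | succ b hab ih => exact fun hb => (hstep i b hb).trans (ih (by omega))
  set L : Fin k → Fin k → ℕ → ℕ → RatFun k := fun i j a b => if P i a < P j b then
    link c (P i a) (P j b) ((blockVal i a / blockVal j b : (RatFun k)ˣ) : RatFun k) else 1 with hL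
  have hker : (∏ i : Fin n, ∏ j : Fin n, if i < j then link c i j
      ((blockVal (o i).1 (o i).2 / blockVal (o j).1 (o j).2 : (RatFun k)ˣ) : RatFun k) else 1) =
      ∏ i, ∏ j, ∏ b ∈ range (N j), ∏ a ∈ range (N i), L i j a b := by
    have h1 : (∏ i : Fin n, ∏ j : Fin n, if i < j then link c i j
      ((blockVal (o i).1 (o i).2 / blockVal (o j).1 (o j).2 : (RatFun k)ˣ) : RatFun k) else 1) =
        ∏ e : Σ i, Fin (N i), ∏ f : Σ i, Fin (N i), L e.1 f.1 e.2 f.2 := by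
      rw [← Equiv.prod_comp o]
      refine Finset.prod_congr rfl fun i _ => ?_
      rw [← Equiv.prod_comp o]
      refine Finset.prod_congr rfl fun j _ => ?_
      simp only [hL, hPo, Equiv.symm_apply_apply, Fin.lt_def]
    rw [h1, Fintype.prod_sigma]
    refine Finset.prod_congr rfl fun i _ => ?_
    simp only [Fintype.prod_sigma]
    rw [Finset.prod_comm]
    refine Finset.prod_congr rfl fun j _ => ?_
    rw [Finset.prod_comm, ← Fin.prod_univ_eq_prod_range
      (fun b => ∏ a ∈ range (N i), L i j a b) (N j)]
    refine Finset.prod_congr rfl fun b _ => ?_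
    exact Fin.prod_univ_eq_prod_range (fun a => L i j a b) (N i)
  -- The kernels between the points of one string.
  have hdiag : ∀ i, ∃ e : ℕ, (1 - (fcol (RatFun k) δ : RatFun k)) ^ N i *
      (∏ b ∈ range (N i), ∏ a ∈ range (N i), L i i a b) =
      (1 - (fcol (RatFun k) δ : RatFun k)) ^ e *
        ∏ s ∈ Ico 1 (N i), zeta ((fcol (RatFun k) 1 : RatFun k) ^ s) ^ (N i - s) := by
    intro i
    rw [Finset.prod_comm]
    exact prod_link_string hc hδ hcδ (hP i) (uvar k i)
  choose e he using hdiag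
  -- The kernels between the points of two strings, multiplied by the differences of the points.
  have hoff : ∀ i j, i ≠ j → ∃ y : Laurent Zq (Fin k),
      (∏ b ∈ range (N j), ∏ a ∈ range (N i), L i j a b) *
        (∏ b ∈ range (N i), ∏ a ∈ range (N j), L j i a b) *
        (∏ b ∈ range (N j), ∏ a ∈ range (N i), toRat k ((blockPt j b : Laurent Zq (Fin k)) -
          (blockPt i a : Laurent Zq (Fin k)))) =
      toRat k ((∏ b ∈ range (N j), ∏ a ∈ Ico 1 (N i),
        (lin c (blockPt i a) (blockPt j b) * lin δ (blockPt i a) (blockPt j b))) * y) := by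
    intro i j hij
    have hd : (∏ b ∈ range (N j), ∏ a ∈ Ico 1 (N i),
        (lin c (blockPt i a) (blockPt j b) * lin δ (blockPt i a) (blockPt j b))) ∣
        ∏ b ∈ range (N j), ∏ a ∈ range (N i),
          pairNum c (P i a) (P j b) (blockPt i a) (blockPt j b) := by
      refine Finset.prod_dvd_prod_of_dvd _ _ fun b hb => ?_
      refine prod_lin_dvd_prod_pairNum (lvar i) (blockPt j b) hc hδ hcδ (hP i) fun a ha h => ?_
      exact hij (hPinj i j a b ha (mem_range.1 hb) h).1
    obtain ⟨y, hy⟩ := hd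
    refine ⟨y, ?_⟩
    rw [← hy, Finset.prod_comm (s := range (N i)), ← Finset.prod_mul_distrib,
      ← Finset.prod_mul_distrib, map_prod]
    refine Finset.prod_congr rfl fun b hb => ?_
    rw [← Finset.prod_mul_distrib, ← Finset.prod_mul_distrib, map_prod]
    refine Finset.prod_congr rfl fun a ha => ?_
    rw [mem_range] at ha hb
    rw [toRat_eq_ev, ev_pairNum (X := blockVal i a) (Y := blockVal j b) _ c
      (fun h => hij (hPinj i j a b ha hb h).1) _ _ (map_toRat_blockPt i a) (map_toRat_blockPt j b)
      (fun h => hij (blockVal_inj h).1), ← toRat_eq_ev, map_sub, toRat_unit, toRat_unit,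
      map_toRat_blockPt, map_toRat_blockPt]
  choose! y hy using hoff
  refine ⟨((∏ i, blockPt (o i).1 (o i).2 ^ d i : (Laurent Zq (Fin k))ˣ) : Laurent Zq (Fin k)) *
    ∏ i, (lC ((1 - (zcol δ : Zq)) ^ e i) * ∏ j ∈ Ioi i, y i j), ?_⟩
  have hmon : ((∏ i, blockVal (o i).1 (o i).2 ^ d i : (RatFun k)ˣ) : RatFun k) =
      toRat k ((∏ i, blockPt (o i).1 (o i).2 ^ d i : (Laurent Zq (Fin k))ˣ) :
        Laurent Zq (Fin k)) := by
    rw [toRat_unit, map_prod]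
    simp only [map_zpow, map_toRat_blockPt]
  have hpow : ((1 - (fcol (RatFun k) 1 : RatFun k)) * (1 - (fcol (RatFun k) δ : RatFun k))) ^ n =
      ∏ i, ((1 - (fcol (RatFun k) 1 : RatFun k)) ^ N i *
        (1 - (fcol (RatFun k) δ : RatFun k)) ^ N i) := by
    rw [← hn, ← Finset.prod_pow_eq_pow_sum]
    exact Finset.prod_congr rfl fun i _ => mul_pow _ _ _
  have hC : ∀ m : ℕ, toRat k (lC ((1 - (zcol δ : Zq)) ^ m)) =
      (1 - (fcol (RatFun k) δ : RatFun k)) ^ m := by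
    intro m
    rw [toRat_lC, map_pow, map_sub, map_one, coefHom_zcol]
  rw [wt, hmon, hker, prod_prod_eq_prod_Ioi, hpow, blockConst, blockDiff, blockDiv]
  simp only [map_mul, map_prod, hC]
  rw [mul_left_comm, mul_assoc, mul_left_comm _ (toRat k _), mul_left_comm _ (toRat k _)]
  congr 1
  rw [← mul_assoc, ← Finset.prod_mul_distrib, ← Finset.prod_mul_distrib, ← Finset.prod_mul_distrib,
    ← Finset.prod_mul_distrib]
  refine Finset.prod_congr rfl fun i _ => ?_
  have h1 : (∏ j ∈ Ioi i, ((∏ b ∈ range (N j), ∏ a ∈ range (N i), L i j a b) *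
      (∏ b ∈ range (N i), ∏ a ∈ range (N j), L j i a b))) *
      (∏ j ∈ Ioi i, ∏ b ∈ range (N j), ∏ a ∈ range (N i), toRat k
        ((blockPt j b : Laurent Zq (Fin k)) - (blockPt i a : Laurent Zq (Fin k)))) =
      (∏ j ∈ Ioi i, ∏ b ∈ range (N j), ∏ a ∈ Ico 1 (N i),
        toRat k (lin c (blockPt i a) (blockPt j b)) *
          toRat k (lin δ (blockPt i a) (blockPt j b))) * ∏ j ∈ Ioi i, toRat k (y i j) := by
    rw [← Finset.prod_mul_distrib, ← Finset.prod_mul_distrib]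
    refine Finset.prod_congr rfl fun j hj => ?_
    have := hy i j (mem_Ioi.1 hj).ne
    simp only [map_mul, map_prod] at this
    exact this
  have h2 := congrArg₂ (· * ·) (he i) h1
  linear_combination (1 - (fcol (RatFun k) 1 : RatFun k)) ^ N i * h2

lemma dvd_of_dvd_prod_mul {ι A : Type*} [CommRing A] (s : Finset ι) (w : ι → A) {δ : A}
    (h : ∀ i ∈ s, ∀ x, δ ∣ w i * x → δ ∣ x) (x : A) (hd : δ ∣ (∏ i ∈ s, w i) * x) : δ ∣ x := by
  classical
  induction s using Finset.induction_on generalizing x with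
  | empty => simpa using hd
  | insert i s hi ih =>
    rw [Finset.prod_insert hi, mul_assoc] at hd
    exact ih (fun j hj => h j (mem_insert_of_mem hj)) x (h i (mem_insert_self _ _) _ hd)

variable (N) in
/-- `blockDiv` does not vanish if all variables are specialized to powers of `q₂`. -/
lemma map_blockDiv_ne_zero {c δ : Fin 3} (hc : c ≠ 1) (hδ : δ ≠ 1)
    (θ : Laurent Zq (Fin k) →+* Kq) (hC : ∀ r, θ (lC r) = coefHom Kq r)
    (hv : ∀ i, ∃ e : ℤ, Units.map (θ : Laurent Zq (Fin k) →* Kq) (lvar i) = fcol Kq 1 ^ e) :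
    θ (blockDiv N c δ) ≠ 0 := by
  choose e he using hv
  have hcol : ∀ c, Units.map (θ : Laurent Zq (Fin k) →* Kq) (lcol c) = fcol Kq c := by
    intro c; ext1; exact (hC _).trans (coefHom_zcol c)
  have key : ∀ (γ : Fin 3) (i j : Fin k) (a b : ℕ), γ ≠ 1 →
      θ (lin γ (blockPt i a) (blockPt j b)) ≠ 0 := by
    intro γ i j a b hγ h
    rw [lin, map_sub, sub_eq_zero] at h
    have h1 : Units.map (θ : Laurent Zq (Fin k) →* Kq) (blockPt j b) =
        Units.map (θ : Laurent Zq (Fin k) →* Kq) (blockPt i a * lcol γ) := Units.ext h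
    simp only [blockPt, map_mul, map_pow, hcol, he] at h1
    have h2 := fcol_indep (F := Kq) hγ 1 (e i + a - (e j + b)) (by
      rw [zpow_one, zpow_sub, zpow_add, zpow_add, zpow_natCast, zpow_natCast, h1, ← div_eq_mul_inv,
        mul_comm (fcol Kq γ), div_mul_eq_div_div, div_self', one_div, inv_mul_cancel])
    exact absurd h2.1 one_ne_zero
  simp only [blockDiv, map_prod, map_mul, Finset.prod_ne_zero_iff]
  exact fun i _ j _ b _ a _ => mul_ne_zero (key c i j a b hc) (key δ i j a b hδ)

lemma blockPt_sub_ne_zero {i j : Fin k} (hij : i ≠ j) (a b : ℕ) :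
    (blockPt j b : Laurent Zq (Fin k)) - (blockPt i a : Laurent Zq (Fin k)) ≠ 0 := by
  intro h
  rw [sub_eq_zero] at h
  have h1 := congrArg (Units.map (toRat k : Laurent Zq (Fin k) →* RatFun k)) (Units.ext h)
  rw [map_toRat_blockPt, map_toRat_blockPt] at h1
  exact hij (blockVal_inj h1).1.symm

lemma blockDiff_ne_zero : blockDiff N ≠ 0 := by
  simp only [blockDiff, Finset.prod_ne_zero_iff]
  exact fun i _ j hj b _ a _ => blockPt_sub_ne_zero (mem_Ioi.1 hj).ne a b

/-- `blockDiv` is prime to the differences between the points of different blocks. -/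
lemma dvd_of_dvd_blockDiff_mul {c δ : Fin 3} (hc : c ≠ 1) (hδ : δ ≠ 1) {A : Zq} (hA : A ≠ 0)
    {x : Laurent Zq (Fin k)} (h : lC A * blockDiv N c δ ∣ blockDiff N * x) :
    lC A * blockDiv N c δ ∣ x := by
  refine dvd_of_dvd_prod_mul _ _ (fun i _ => dvd_of_dvd_prod_mul _ _ fun j hj =>
    dvd_of_dvd_prod_mul _ _ fun b _ => dvd_of_dvd_prod_mul _ _ fun a _ x hx => ?_) x h
  have hij : i ≠ j := (mem_Ioi.1 hj).ne
  set u : (Laurent Zq (Fin k))ˣ := lvar i * lcol 1 ^ ((a : ℤ) - b) with hu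
  have hcol : ∀ c, Units.map (subst j u : Laurent Zq (Fin k) →* Laurent Zq (Fin k)) (lcol c) =
      lcol c := by
    intro c; ext1; exact subst_lC _ _ _
  have hpt : (blockPt i a : (Laurent Zq (Fin k))ˣ) = u * lcol 1 ^ b := by
    rw [hu, blockPt, mul_assoc, ← zpow_natCast, ← zpow_natCast, ← zpow_add, sub_add_cancel]
  refine dvd_of_dvd_mul_of_subst (subst j u) (blockPt_sub_ne_zero hij a b) ?_ ?_ ?_ hx
  · have h1 : Units.map (subst j u : Laurent Zq (Fin k) →* Laurent Zq (Fin k)) (blockPt j b) =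
        Units.map (subst j u : Laurent Zq (Fin k) →* Laurent Zq (Fin k)) (blockPt i a) := by
      conv_rhs => rw [blockPt]
      rw [blockPt, map_mul, map_mul, map_pow, map_pow, hcol, map_subst_lvar, map_subst_lvar,
        Function.update_self, Function.update_of_ne hij, ← hpt, blockPt]
    rw [map_sub, sub_eq_zero]
    exact congrArg Units.val h1
  · intro s
    refine dvd_trans ⟨((lcol 1 ^ b)⁻¹ : (Laurent Zq (Fin k))ˣ), ?_⟩ (dvd_sub_subst' j u s)
    rw [hpt, blockPt, sub_mul, ← Units.val_mul, ← Units.val_mul, mul_inv_cancel_right,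
      mul_inv_cancel_right]
  · intro h0
    set θ : Laurent Zq (Fin k) →+* Kq := (ev fun _ => (1 : Kqˣ)).comp (subst j u) with hθ
    have hC : ∀ r, θ (lC r) = coefHom Kq r := by
      intro r; rw [hθ, RingHom.comp_apply, subst_lC, ev_lC]
    have h1 : θ (lC A * blockDiv N c δ) = 0 := by rw [hθ, RingHom.comp_apply, h0, map_zero]
    rw [map_mul, hC] at h1
    refine mul_ne_zero ((map_ne_zero_iff _ coefHom_injective).2 hA)
      (map_blockDiv_ne_zero N hc hδ θ hC fun l => ?_) h1
    have h2 : Units.map (θ : Laurent Zq (Fin k) →* Kq) (lvar l) =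
        Units.map ((ev fun _ : Fin k => (1 : Kqˣ) : Laurent Zq (Fin k) →+* Kq) :
          Laurent Zq (Fin k) →* Kq)
          (Units.map (subst j u : Laurent Zq (Fin k) →* Laurent Zq (Fin k)) (lvar l)) := rfl
    rw [h2, map_subst_lvar]
    by_cases hl : l = j
    · refine ⟨(a : ℤ) - b, ?_⟩
      rw [hl, Function.update_self, hu, map_mul, map_zpow, map_ev_lcol, map_ev_lvar, one_mul]
    · refine ⟨0, ?_⟩
      rw [Function.update_of_ne hl, map_ev_lvar, zpow_zero]

lemma algebraMap_zeta (F : Type) [Field F] [Algebra Kq F] (x : Kq) :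
    algebraMap Kq F (zeta x) = zeta (algebraMap Kq F x) := by
  simp [zeta]

lemma exists_qHom_eq (x : Kq) : ∃ A B : Zq, B ≠ 0 ∧ qHom B * x = qHom A := by
  obtain ⟨p, q, hq, rfl⟩ := IsFractionRing.div_surjective (A := MvPolynomial (Fin 2) ℤ) x
  let ι : MvPolynomial (Fin 2) ℤ →+* Zq :=
    MvPolynomial.eval₂Hom (Int.castRingHom Zq) fun i => (lvar i : Zqˣ)
  have hι : ∀ p, qHom (ι p) = algebraMap (MvPolynomial (Fin 2) ℤ) Kq p := by
    intro p
    have : qHom.comp ι = algebraMap (MvPolynomial (Fin 2) ℤ) Kq := by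
      apply MvPolynomial.ringHom_ext
      · intro r; simp
      · intro i
        rw [RingHom.comp_apply, MvPolynomial.eval₂Hom_X', qHom, laurentHom_lvar]
        fin_cases i <;> rfl
    exact congrArg (fun f => f p) this
  have hq0 : algebraMap (MvPolynomial (Fin 2) ℤ) Kq q ≠ 0 :=
    IsFractionRing.to_map_ne_zero_of_mem_nonZeroDivisors hq
  refine ⟨ι p, ι q, fun h => hq0 (by rw [← hι, h, map_zero]), ?_⟩
  rw [hι, hι, mul_div_cancel₀ _ hq0]

lemma exists_blockConst_eq : ∃ A B : Zq, B ≠ 0 ∧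
    toRat k (lC B) * blockConst N = toRat k (lC A) := by
  obtain ⟨A, B, hB, h⟩ := exists_qHom_eq (∏ i, ((1 - (fcol Kq 1 : Kq)) ^ N i *
    ∏ s ∈ Ico 1 (N i), zeta ((fcol Kq 1 : Kq) ^ s) ^ (N i - s)))
  refine ⟨A, B, hB, ?_⟩
  have h1 := congrArg (algebraMap Kq (RatFun k)) h
  rw [map_mul] at h1
  rw [toRat_lC, toRat_lC]
  refine Eq.trans ?_ h1
  congr 1
  have h2 : algebraMap Kq (RatFun k) (fcol Kq 1 : Kq) = fcol (RatFun k) 1 := by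
    rw [coe_fcol, coe_fcol]; rfl
  rw [blockConst, map_prod]
  refine Finset.prod_congr rfl fun i _ => ?_
  rw [map_mul, map_pow, map_sub, map_one, h2, map_prod]
  congr 1
  refine Finset.prod_congr rfl fun s _ => ?_
  rw [map_pow, algebraMap_zeta, map_pow, h2]

/-- Divisibility of the specialization of a sum over orderings. -/
lemma exists_M_eq {c δ : Fin 3} (hc : c ≠ 1) (hδ : δ ≠ 1) (hcδ : c ≠ δ) (hn : ∑ i, N i = n)
    (d : ℕ → ℤ) (ε : Fin n ≃ Σ i, Fin (N i)) : ∃ y : Laurent Zq (Fin k),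
      ((1 - (fcol (RatFun k) 1 : RatFun k)) * (1 - (fcol (RatFun k) δ : RatFun k))) ^ n *
        M c n d (fun j => blockVal (ε j).1 (ε j).2) univ =
      blockConst N * toRat k (blockDiv N c δ * y) := by
  set K : RatFun k :=
    ((1 - (fcol (RatFun k) 1 : RatFun k)) * (1 - (fcol (RatFun k) δ : RatFun k))) ^ n with hK
  obtain ⟨R, hR⟩ := exists_rep c n d
  have hinj : Function.Injective fun j => (blockVal (ε j).1 (ε j).2 : (RatFun k)ˣ) := by
    intro j j' h
    obtain ⟨h1, h2⟩ := blockVal_inj h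
    apply ε.injective
    generalize ε j = e at h1 h2
    generalize ε j' = e' at h1 h2
    obtain ⟨i, a⟩ := e
    obtain ⟨i', a'⟩ := e'
    simp only at h1 h2
    subst h1
    congr 1
    exact Fin.ext h2
  set r : Laurent Zq (Fin k) := lC (((1 - (zcol 1 : Zq)) * (1 - (zcol δ : Zq))) ^ n) *
    laurentHom lC (fun j => blockPt (ε j).1 (ε j).2) R with hr
  have hr1 : toRat k r = K * M c n d (fun j => blockVal (ε j).1 (ε j).2) univ := by
    rw [hr, map_mul, toRat_lC, map_pow, map_mul, map_sub, map_sub, map_one, coefHom_zcol,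
      coefHom_zcol, ← hK, comp_laurentHom, ← hR _ _ hinj]
    congr 1
    have h1 : (toRat k).comp lC = coefHom (RatFun k) := RingHom.ext toRat_lC
    simp only [h1, map_toRat_blockPt]
    rfl
  clear_value r
  -- The assertion multiplied by the differences between the points, which is clear for every
  -- ordering.
  have hsum : ∃ y : Laurent Zq (Fin k), toRat k r * toRat k (blockDiff N) =
      blockConst N * toRat k (blockDiv N c δ * y) := by
    have h1 : M c n d (fun j => blockVal (ε j).1 (ε j).2) univ =
        M c n d (fun e : Σ i, Fin (N i) => (blockVal e.1 e.2 : (RatFun k)ˣ)) univ := by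
      have := M_map c n d (fun e : Σ i, Fin (N i) => (blockVal e.1 e.2 : (RatFun k)ˣ))
        ε.toEmbedding univ
      rw [map_univ_equiv] at this
      exact this
    have h2 : ∀ o ∈ ords n (univ : Finset (Σ i, Fin (N i))), ∃ y : Laurent Zq (Fin k),
        K * wt c d (fun e : Σ i, Fin (N i) => blockVal e.1 e.2) o * toRat k (blockDiff N) =
          blockConst N * toRat k (blockDiv N c δ * y) := by
      intro o ho
      have hb : Function.Bijective o := by
        refine ⟨o.injective, fun x => ?_⟩
        have : x ∈ univ.map o := by rw [mem_ords.1 ho]; exact mem_univ x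
        obtain ⟨i, _, hi⟩ := mem_map.1 this
        exact ⟨i, hi⟩
      exact exists_wt_eq hc hδ hcδ hn d (Equiv.ofBijective o hb)
    choose! y hy using h2
    refine ⟨∑ o ∈ ords n univ, y o, ?_⟩
    rw [hr1, h1, M_apply, Finset.mul_sum, Finset.sum_mul, Finset.mul_sum, map_sum, Finset.mul_sum]
    exact Finset.sum_congr rfl hy
  obtain ⟨Y, hY⟩ := hsum
  obtain ⟨A, B, hB, hAB⟩ := exists_blockConst_eq (N := N)
  have hlC : Function.Injective (lC : Zq →+* Laurent Zq (Fin k)) :=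
    AddMonoidAlgebra.single_right_injective
  -- Clear the denominators of `blockConst`; this gives a divisibility of Laurent polynomials, in
  -- which the differences can be cancelled.
  have e1 : blockDiff N * (lC B * r) = lC A * blockDiv N c δ * Y := by
    apply toRat_injective
    rw [map_mul] at hY
    rw [map_mul, map_mul, map_mul, map_mul, ← hAB]
    linear_combination toRat k (lC B) * hY
  have hB' : toRat k (lC B) ≠ 0 :=
    (map_ne_zero_iff _ (toRat_injective k)).2 ((map_ne_zero_iff _ hlC).2 hB)
  rw [← hr1]
  by_cases hA : A = 0
  · refine ⟨0, ?_⟩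
    rw [hA, map_zero, zero_mul, zero_mul] at e1
    have h1 := (mul_eq_zero.1 e1).resolve_left blockDiff_ne_zero
    have h2 := (mul_eq_zero.1 h1).resolve_left ((map_ne_zero_iff _ hlC).2 hB)
    rw [h2, mul_zero, map_zero, mul_zero]
  · obtain ⟨y, hy⟩ := dvd_of_dvd_blockDiff_mul hc hδ hA ⟨Y, e1⟩
    refine ⟨y, mul_left_cancel₀ hB' ?_⟩
    rw [← mul_assoc, hAB, ← map_mul, hy, ← map_mul, mul_assoc]

end Blocks

section Composition

variable {n : ℕ}

/-- The point of the specialization attached to a composition. -/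
def specPt (cc : Composition n) (j : Fin n) : (RatFun cc.length)ˣ :=
  blockVal (cc.index j) (cc.invEmbedding j)

lemma specialize_eq_ev (cc : Composition n) (R : Laurent Zq (Fin n)) :
    specialize cc R = ev (specPt cc) R := rfl

lemma specPt_injective (cc : Composition n) : Function.Injective (specPt cc) := by
  intro j j' h
  obtain ⟨h1, h2⟩ := blockVal_inj h
  rw [← cc.embedding_comp_inv j, ← cc.embedding_comp_inv j']
  generalize cc.invEmbedding j = e at h2
  generalize cc.invEmbedding j' = e' at h2
  generalize cc.index j = i at h1 e
  generalize cc.index j' = i' at h1 e'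
  subst h1
  rw [Fin.ext h2]

lemma blockDiv_comm {k : ℕ} (N : Fin k → ℕ) (c δ : Fin 3) :
    blockDiv N c δ = blockDiv N δ c := by
  simp only [blockDiv, mul_comm]

/-- The expression `divisor`, up to a unit. -/
lemma exists_divisor_eq (cc : Composition n) : ∃ U : (Laurent Zq (Fin cc.length))ˣ,
    divisor cc = blockConst cc.blocksFun *
      toRat _ ((U : Laurent Zq (Fin cc.length)) * blockDiv cc.blocksFun 0 2) := by
  set k := cc.length with hk
  have f1 : ∀ (i j : Fin k) (a b : ℕ), var k i * Q1 k - var k j * Q2 k ^ ((b : ℤ) - (a : ℤ)) =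
      toRat k ((-(lcol 1 ^ (-(a : ℤ))) : (Laurent Zq (Fin k))ˣ) : Laurent Zq (Fin k)) *
        toRat k (lin 0 (blockPt i a) (blockPt j b)) := by
    intro i j a b
    rw [lin, map_sub, toRat_unit (blockPt j b), toRat_unit (_ * _), map_mul, map_toRat_blockPt,
      map_toRat_blockPt, map_toRat_lcol, Units.val_neg, map_neg, toRat_unit, map_zpow,
      map_toRat_lcol, blockVal, blockVal]
    change (uvar k i : RatFun k) * (fcol (RatFun k) 0 : RatFun k) -
      (uvar k j : RatFun k) * (fcol (RatFun k) 1 : RatFun k) ^ ((b : ℤ) - (a : ℤ)) = _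
    have h1 := (fcol (RatFun k) 1).ne_zero
    simp only [Units.val_mul, Units.val_pow_eq_pow_val, Units.val_inv_eq_inv_val,
      zpow_sub₀ h1, zpow_neg, zpow_natCast]
    field_simp
    ring
  have f2 : ∀ (i j : Fin k) (a b : ℕ), var k j * Q1 k - var k i * Q2 k ^ ((a : ℤ) - (b : ℤ) - 1) =
      toRat k ((lcol 0 * lcol 1 ^ (-(b : ℤ)) : (Laurent Zq (Fin k))ˣ) : Laurent Zq (Fin k)) *
        toRat k (lin 2 (blockPt i a) (blockPt j b)) := by
    intro i j a b
    rw [lin, map_sub, toRat_unit (blockPt j b), toRat_unit (blockPt i a * _), map_mul,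
      map_toRat_blockPt, map_toRat_blockPt, map_toRat_lcol, toRat_unit, map_mul, map_zpow,
      map_toRat_lcol, map_toRat_lcol, blockVal, blockVal]
    change (uvar k j : RatFun k) * (fcol (RatFun k) 0 : RatFun k) -
      (uvar k i : RatFun k) * (fcol (RatFun k) 1 : RatFun k) ^ ((a : ℤ) - (b : ℤ) - 1) = _
    have h0 := (fcol (RatFun k) 0).ne_zero
    have h1 := (fcol (RatFun k) 1).ne_zero
    have h2 : fcol (RatFun k) 2 = (fcol (RatFun k) 0 * fcol (RatFun k) 1)⁻¹ :=
      eq_inv_of_mul_eq_one_right (fcol_prod 0)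
    simp only [h2, Units.val_mul, Units.val_pow_eq_pow_val, Units.val_inv_eq_inv_val, zpow_sub₀ h1, zpow_neg, zpow_natCast, zpow_one]
    field_simp
  refine ⟨∏ i, ∏ j ∈ Ioi i, ∏ a ∈ Ico 1 (cc.blocksFun i), ∏ b ∈ range (cc.blocksFun j),
    (-(lcol 1 ^ (-(a : ℤ))) * (lcol 0 * lcol 1 ^ (-(b : ℤ)))), ?_⟩
  have hI : ∀ m : ℕ, Icc 1 (m - 1) = Ico 1 m := by
    intro m; ext x; simp only [mem_Icc, mem_Ico]; omega
  rw [divisor, blockConst]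
  simp only [hI]
  congr 1
  rw [blockDiv, Units.coe_prod, ← Finset.prod_mul_distrib, map_prod]
  refine Finset.prod_congr rfl fun i _ => ?_
  rw [Units.coe_prod, ← Finset.prod_mul_distrib, map_prod]
  refine Finset.prod_congr rfl fun j _ => ?_
  rw [← Finset.prod_mul_distrib, Finset.prod_comm (s := range _), Units.coe_prod,
    ← Finset.prod_mul_distrib, map_prod]
  refine Finset.prod_congr rfl fun a _ => ?_
  rw [← Finset.prod_mul_distrib, Units.coe_prod, ← Finset.prod_mul_distrib, map_prod]
  refine Finset.prod_congr rfl fun b _ => ?_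
  rw [f1, f2]
  simp only [Units.val_mul, map_mul]
  ring

/-- The wheel-type divisibility of integral combinations of sums over orderings. -/
theorem IsComb.exists_eq_divisor_mul {c δ : Fin 3} (hc : c ≠ 1) (hδ : δ ≠ 1) (hcδ : c ≠ δ) {f : Fam}
    (hf : IsComb c n f) (cc : Composition n) : ∃ T : Laurent Zq (Fin cc.length),
      ((1 - (fcol (RatFun cc.length) 1 : RatFun cc.length)) *
        (1 - (fcol (RatFun cc.length) δ : RatFun cc.length))) ^ n *
        f (Fin n) (RatFun cc.length) (specPt cc) univ = divisor cc * toRat _ T := by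
  induction hf with
  | M d =>
    obtain ⟨y, hy⟩ := exists_M_eq (N := cc.blocksFun) hc hδ hcδ cc.sum_blocksFun d
      cc.blocksFinEquiv.symm
    obtain ⟨U, hU⟩ := exists_divisor_eq cc
    have hsymm : blockDiv cc.blocksFun c δ = blockDiv cc.blocksFun 0 2 := by
      have h : ∀ c δ : Fin 3, c ≠ 1 → δ ≠ 1 → c ≠ δ →
        (c = 0 ∧ δ = 2) ∨ (c = 2 ∧ δ = 0) := by decide
      rcases h c δ hc hδ hcδ with ⟨rfl, rfl⟩ | ⟨rfl, rfl⟩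
      · rfl
      · exact blockDiv_comm _ _ _
    refine ⟨((U⁻¹ : (Laurent Zq (Fin cc.length))ˣ) : Laurent Zq (Fin cc.length)) * y, ?_⟩
    refine Eq.trans hy ?_
    rw [hU, mul_assoc, ← map_mul, hsymm]
    congr 2
    rw [mul_mul_mul_comm, Units.mul_inv, one_mul]
  | zero => exact ⟨0, by beta_reduce; rw [Tw.zero_apply, map_zero, mul_zero, mul_zero]⟩
  | add _ _ ih1 ih2 =>
    obtain ⟨T, hT⟩ := ih1
    obtain ⟨T', hT'⟩ := ih2
    exact ⟨T + T', by beta_reduce; rw [Tw.add_apply, mul_add, hT, hT', map_add, mul_add]⟩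
  | smul r _ ih =>
    obtain ⟨T, hT⟩ := ih
    exact ⟨lC r * T, by
      beta_reduce; rw [Tw.smul_apply, mul_left_comm, hT, map_mul, toRat_lC, mul_left_comm]⟩

end Composition

/-! ### From the ambient algebra to set functions -/

lemma relabel_relabel {l m n : ℕ} (f : Fin l → Fin m) (hf : Function.Injective f)
    (g : Fin m → Fin n) (hg : Function.Injective g) (R : RatFun l) :
    relabel g hg (relabel f hf R) = relabel (g ∘ f) (hg.comp hf) R := by
  have : (relabel g hg).comp (relabel f hf) = relabel (g ∘ f) (hg.comp hf) := by
    apply AlgHom.coe_ringHom_injective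
    apply IsLocalization.ringHom_ext (nonZeroDivisors (MvPolynomial (Fin l) Kq))
    apply MvPolynomial.ringHom_ext
    · intro r
      have h : algebraMap (MvPolynomial (Fin l) Kq) (RatFun l) (MvPolynomial.C r) =
          algebraMap Kq (RatFun l) r := by
        rw [IsScalarTower.algebraMap_apply Kq (MvPolynomial (Fin l) Kq) (RatFun l)]; rfl
      simp only [RingHom.comp_apply, h]
      simp
    · intro i
      change relabel g hg (relabel f hf (var l i)) = relabel (g ∘ f) (hg.comp hf) (var l i)
      rw [relabel_var, relabel_var, relabel_var]; rfl
  exact DFunLike.congr_fun this R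

/-- A sum over permutations and orderings counts every ordering `n!` times. -/
lemma sum_ords_perm {I : Type} {A : Type*} [Fintype I] [DecidableEq I] [AddCommMonoid A] {m : ℕ}
    (S : Finset I) (f : (Fin m ↪ I) → A) : ∑ o ∈ ords m S, ∑ σ : Equiv.Perm (Fin m),
      f (σ.toEmbedding.trans o) = m.factorial • ∑ o ∈ ords m S, f o := by
  rw [Finset.sum_comm]
  have : ∀ σ : Equiv.Perm (Fin m), ∑ o ∈ ords m S, f (σ.toEmbedding.trans o) =
      ∑ o ∈ ords m S, f o := by
    intro σ
    refine Finset.sum_bij' (fun o _ => σ.toEmbedding.trans o)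
      (fun o _ => σ.symm.toEmbedding.trans o) ?_ ?_ ?_ ?_ ?_
    · intro o ho
      rw [mem_ords] at ho ⊢
      rw [← Finset.map_map, map_univ_equiv, ho]
    · intro o ho
      rw [mem_ords] at ho ⊢
      rw [← Finset.map_map, map_univ_equiv, ho]
    · intro o _; ext i; simp
    · intro o _; ext i; simp
    · intro o _; rfl
  simp only [this]
  rw [Finset.sum_const, card_univ, Fintype.card_perm, Fintype.card_fin]

variable {n : ℕ}

/-- The set function of a rational function of degree `m`: its average over all orderings of a
set of variables. -/
def setFun (n m : ℕ) : RatFun m →+ Tw (kap (uvar n)) where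
  toFun R S := (m.factorial : RatFun n)⁻¹ * ∑ o ∈ ords m S, relabel o o.injective R
  map_zero' := by ext S; simp [Tw.zero_apply]
  map_add' R R' := by
    ext S
    simp only [map_add, Finset.sum_add_distrib, mul_add]
    rfl

lemma setFun_apply {m : ℕ} (R : RatFun m) (S : Finset (Fin n)) : setFun n m R S =
    (m.factorial : RatFun n)⁻¹ * ∑ o ∈ ords m S, relabel o o.injective R := rfl

lemma factorial_ne_zero_ratFun (n m : ℕ) : (m.factorial : RatFun n) ≠ 0 := by
  have := charZero_of_algebra (RatFun n)
  exact Nat.cast_ne_zero.2 m.factorial_ne_zero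

lemma setFun_symmetrize {m : ℕ} (f : RatFun m) (S : Finset (Fin n)) :
    setFun n m (symmetrize m f) S = ∑ o ∈ ords m S, relabel o o.injective f := by
  have h := sum_ords_perm S fun o : Fin m ↪ Fin n => relabel o o.injective f
  rw [setFun_apply, inv_mul_eq_iff_eq_mul₀ (factorial_ne_zero_ratFun n m), ← nsmul_eq_mul, ← h]
  refine Finset.sum_congr rfl fun o _ => ?_
  rw [symmetrize, map_sum]
  exact Finset.sum_congr rfl fun σ _ => relabel_relabel _ _ _ _ _

lemma setFun_of_card_ne {m : ℕ} (R : RatFun m) {S : Finset (Fin n)} (h : #S ≠ m) :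
    setFun n m R S = 0 := by
  rw [setFun_apply, ords_card h, Finset.sum_empty, mul_zero]

lemma map_zeta {F F' : Type} [Field F] [Algebra Kq F] [Field F'] [Algebra Kq F']
    (φ : F →ₐ[Kq] F') (x : F) : φ (zeta x) = zeta (φ x) := by
  simp only [zeta, map_div₀, map_mul, map_sub, map_one, AlgHom.commutes]

/-- The shuffle product becomes the twisted convolution. -/
lemma setFun_shuffle {m l : ℕ} (R : RatFun m) (R' : RatFun l) :
    setFun n (m + l) (shuffle R R') = setFun n m R * setFun n l R' := by
  ext S
  rw [shuffle, setFun_symmetrize, Tw.mul_apply]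
  have h := sum_ords_split m l S (fun o₁ o₂ : _ ↪ Fin n => (m.factorial : RatFun n)⁻¹ *
    (l.factorial : RatFun n)⁻¹ * (relabel o₁ o₁.injective R * relabel o₂ o₂.injective R' *
      cross (kap (uvar n)) (univ.map o₁) (univ.map o₂)))
  refine Eq.trans ?_ (h.symm.trans ?_)
  · refine Finset.sum_congr rfl fun o _ => ?_
    rw [map_mul, map_div₀, map_mul, map_mul, relabel_relabel, relabel_relabel, map_natCast,
      map_natCast, map_prod, cross, Finset.prod_map]
    have : ∀ i : Fin m, relabel o o.injective
        (∏ j : Fin l, zeta (var (m + l) (Fin.castAdd l i) / var (m + l) (Fin.natAdd m j))) =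
        ∏ j ∈ univ.map ((Fin.natAddEmb m).trans o),
          kap (uvar n) (((Fin.castAddEmb l).trans o) i) j := by
      intro i
      rw [Finset.prod_map, map_prod]
      refine Finset.prod_congr rfl fun j _ => ?_
      rw [map_zeta, map_div₀, relabel_var, relabel_var, kap, Units.val_div_eq_div_val]
      rfl
    simp only [this]
    have e1 : relabel (o ∘ Fin.castAdd l) (o.injective.comp (Fin.castAdd_injective m l)) R =
      relabel ((Fin.castAddEmb l).trans o) ((Fin.castAddEmb l).trans o).injective R := rfl
    have e2 : relabel (o ∘ Fin.natAdd m) (o.injective.comp (Fin.natAdd_injective l m)) R' =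
      relabel ((Fin.natAddEmb m).trans o) ((Fin.natAddEmb m).trans o).injective R' := rfl
    rw [e1, e2, div_eq_mul_inv, mul_inv]
    ring
  · refine Finset.sum_congr rfl fun U _ => ?_
    rw [setFun_apply, setFun_apply, Finset.mul_sum, Finset.mul_sum, Finset.sum_mul_sum,
      Finset.sum_mul]
    refine Finset.sum_congr rfl fun o₁ h1 => ?_
    rw [Finset.sum_mul]
    refine Finset.sum_congr rfl fun o₂ h2 => ?_
    rw [mem_ords.1 h1, mem_ords.1 h2]
    ring

variable (n) in
/-- The set function of an element of the ambient algebra, at `n` variables. -/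
def toTw : Ambient →+ Tw (kap (uvar n)) := DirectSum.toAddMonoid (setFun n)

lemma toTw_of (m : ℕ) (R : RatFun m) : toTw n (DirectSum.of RatFun m R) = setFun n m R :=
  DirectSum.toAddMonoid_of _ _ _

lemma toTw_mul (x y : Ambient) : toTw n (x * y) = toTw n x * toTw n y := by
  induction x using DirectSum.induction_on with
  | zero => rw [zero_mul, map_zero, zero_mul]
  | add x x' h h' => rw [add_mul, map_add, h, h', map_add, add_mul]
  | of m R =>
    induction y using DirectSum.induction_on with
    | zero => rw [mul_zero, map_zero, mul_zero]
    | add y y' h h' => rw [mul_add, map_add, h, h', map_add, mul_add]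
    | of l R' =>
      rw [DirectSum.of_mul_of, toTw_of, toTw_of, toTw_of]
      exact setFun_shuffle R R'

lemma toTw_smul (r : Kq) (x : Ambient) :
    toTw n (r • x) = algebraMap Kq (RatFun n) r • toTw n x := by
  induction x using DirectSum.induction_on with
  | zero => rw [smul_zero, map_zero, smul_zero]
  | add x x' h h' => rw [smul_add, map_add, h, h', map_add, smul_add]
  | of m R =>
    have h1 : r • DirectSum.of RatFun m R = DirectSum.of RatFun m (r • R) :=
      (DirectSum.of_smul Kq m r R).symm
    rw [h1, toTw_of, toTw_of]
    ext S
    rw [Tw.smul_apply, setFun_apply, setFun_apply, mul_left_comm,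
      Finset.mul_sum _ _ (algebraMap Kq (RatFun n) r)]
    congr 1
    refine Finset.sum_congr rfl fun o _ => ?_
    rw [Algebra.smul_def, map_mul, AlgHom.commutes]

lemma toTw_one : toTw n (DirectSum.of RatFun 0 1) = 1 := by
  rw [toTw_of]
  ext S
  rw [setFun_apply, Tw.one_apply]
  split_ifs with h
  · have : ords 0 S = univ := by
      ext o
      simp only [mem_ords, h, mem_univ, iff_true]
      rfl
    rw [this, Fintype.sum_unique]
    simp
  · rw [ords_card, Finset.sum_empty, mul_zero]
    rw [Ne, card_eq_zero]; exact h

/-- Elements of the ambient algebra with symmetric components. -/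
def IsSymm (x : Ambient) : Prop :=
  ∀ (m : ℕ) (σ : Equiv.Perm (Fin m)), relabel σ σ.injective (x m) = x m

lemma relabel_symmetrize {m : ℕ} (σ : Equiv.Perm (Fin m)) (f : RatFun m) :
    relabel σ σ.injective (symmetrize m f) = symmetrize m f := by
  conv_lhs => rw [symmetrize, map_sum]
  rw [symmetrize, ← Equiv.sum_comp (Equiv.mulLeft σ) fun τ : Equiv.Perm (Fin m) =>
    relabel τ τ.injective f]
  exact Finset.sum_congr rfl fun τ _ => relabel_relabel τ τ.injective σ σ.injective f

namespace IsSymm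

variable {x y : Ambient}

lemma zero : IsSymm 0 := fun m σ => by simp

lemma add (hx : IsSymm x) (hy : IsSymm y) : IsSymm (x + y) := fun m σ => by
  rw [DirectSum.add_apply, map_add, hx, hy]

lemma smul (r : Kq) (hx : IsSymm x) : IsSymm (r • x) := fun m σ => by
  rw [DirectSum.smul_apply, Algebra.smul_def, map_mul, AlgHom.commutes, hx]

lemma sum {ι : Type*} (s : Finset ι) {f : ι → Ambient} (h : ∀ i ∈ s, IsSymm (f i)) :
    IsSymm (∑ i ∈ s, f i) := by
  classical
  induction s using Finset.induction_on with
  | empty => exact zero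
  | insert i s hi ih =>
    rw [Finset.sum_insert hi]
    exact (h i (mem_insert_self _ _)).add (ih fun j hj => h j (mem_insert_of_mem hj))

lemma of {m : ℕ} {R : RatFun m}
    (h : ∀ σ : Equiv.Perm (Fin m), relabel σ σ.injective R = R) :
    IsSymm (DirectSum.of RatFun m R) := by
  intro k σ
  by_cases hk : k = m
  · subst hk
    rw [DirectSum.of_eq_same, h]
  · rw [DirectSum.of_eq_of_ne _ _ _ hk, map_zero]

lemma mul (x y : Ambient) : IsSymm (x * y) := by
  induction x using DirectSum.induction_on with
  | zero => rw [zero_mul]; exact zero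
  | add x x' h h' => rw [add_mul]; exact h.add h'
  | of m R =>
    induction y using DirectSum.induction_on with
    | zero => rw [mul_zero]; exact zero
    | add y y' h h' => rw [mul_add]; exact h.add h'
    | of l R' =>
      rw [DirectSum.of_mul_of]
      exact of fun σ => relabel_symmetrize σ _

end IsSymm

/-- A symmetric element is determined by its set functions. -/
lemma toTw_univ {x : Ambient} (hx : IsSymm x) : toTw n x univ = x n := by
  have h1 : ∀ x : Ambient, toTw n x univ = setFun n n (x n) univ := by
    intro x
    induction x using DirectSum.induction_on with
    | zero => rw [map_zero, DirectSum.zero_apply, map_zero]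
    | add x x' h h' => rw [map_add, Tw.add_apply, h, h', DirectSum.add_apply, map_add, Tw.add_apply]
    | of m R =>
      rw [toTw_of]
      by_cases hm : n = m
      · subst hm; rw [DirectSum.of_eq_same]
      · rw [DirectSum.of_eq_of_ne _ _ _ hm, map_zero, Tw.zero_apply, setFun_of_card_ne]
        rwa [card_univ, Fintype.card_fin]
  rw [h1, setFun_apply, inv_mul_eq_iff_eq_mul₀ (factorial_ne_zero_ratFun n n)]
  have h2 : ∀ o ∈ ords n (univ : Finset (Fin n)), relabel o o.injective (x n) = x n := by
    intro o _
    exact hx n (Equiv.ofBijective o (Finite.injective_iff_bijective.1 o.injective))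
  rw [Finset.sum_congr rfl h2, Finset.sum_const, nsmul_eq_mul]
  have h3 : #(ords n (univ : Finset (Fin n))) = n.factorial := by
    have h4 := sum_ords_univ (n := n) (fun _ => (1 : ℕ))
    simpa [Fintype.card_perm] using h4
  rw [h3]

/-! ### The elements `P` as set functions -/

section KernelP

lemma wt_map {F F' : Type} [Field F] [Algebra Kq F] [Field F'] [Algebra Kq F'] {I : Type} {m : ℕ}
    [Fintype I] [DecidableEq I]
    (φ : F →ₐ[Kq] F') (c : Fin 3) (d : ℕ → ℤ) (v : I → Fˣ) (o : Fin m → I) :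
    φ (wt c d v o) = wt c d (fun i => Units.map (φ : F →* F') (v i)) o := by
  have hcol : ∀ c, φ (fcol F c) = fcol F' c := fun c => φ.commutes _
  have hlink : ∀ (i j : ℕ) (x : F), φ (link c i j x) = link c i j (φ x) := by
    intro i j x
    rw [link, link]
    split_ifs
    · simp only [zred, map_div₀, map_mul, map_inv₀, map_sub, map_one, hcol]
    · exact map_zeta φ x
  have hu : ∀ u : Fˣ, φ (u : F) = (Units.map (φ : F →* F') u : F'ˣ) := fun _ => rfl
  rw [wt, wt, map_mul, hu, map_prod, map_prod]
  simp only [map_zpow, map_prod]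
  congr 1
  refine Finset.prod_congr rfl fun i _ => Finset.prod_congr rfl fun j _ => ?_
  split_ifs
  · rw [hlink, hu, map_div]
  · exact map_one φ

lemma relabel_wt {m n : ℕ} (o : Fin m ↪ Fin n) (c : Fin 3) (d : ℕ → ℤ) :
    relabel o o.injective (wt c d (uvar m) id) = wt c d (uvar n) o := by
  rw [wt_map]
  have : ∀ i, Units.map (relabel o o.injective : RatFun m →* RatFun n) (uvar m i) =
      uvar n (o i) := by
    intro i; ext1; exact relabel_var o o.injective i
  simp only [this]
  rfl

lemma z_succ {m i : ℕ} (h : i < m) : z m (i + 1) = uvar m ⟨i, h⟩ := by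
  rw [z, dif_pos ⟨by omega, by omega⟩]; rfl

lemma prod_Icc_one {A : Type*} [CommMonoid A] (f : ℕ → A) (m : ℕ) :
    ∏ i ∈ Icc 1 m, f i = ∏ i ∈ range m, f (i + 1) := by
  rw [range_eq_Ico, Finset.prod_Ico_add' f 0 m 1]
  rfl

lemma one_sub_ne_zero_of_ne {m : ℕ} {i j : Fin m} (h : i ≠ j) :
    1 - (uvar m j : RatFun m) / ((uvar m i : RatFun m) * Q2 m) ≠ 0 := by
  intro h0
  have h1 : (uvar m j : RatFun m) = (uvar m i : RatFun m) * Q2 m := by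
    have h2 : (uvar m i : RatFun m) * Q2 m ≠ 0 := mul_ne_zero (uvar m i).ne_zero (Q2_ne_zero m)
    rw [sub_eq_zero, eq_div_iff h2, one_mul] at h0
    exact h0.symm
  have h3 : uvar m j * Units.map (algebraMap Kq (RatFun m) : Kq →* RatFun m) 1 =
      uvar m i * Units.map (algebraMap Kq (RatFun m) : Kq →* RatFun m) (fcol Kq 1) := by
    rw [← fcol_eq_map, map_one, mul_one]
    ext1
    exact h1
  exact h (uvar_indep h3).1.symm

/-- The kernel of `P`, in terms of the reduced kernels between neighbours. -/
lemma prod_zeta_div_eq (m : ℕ) :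
    (∏ i ∈ Icc 1 m, ∏ j ∈ Ioc i m, zeta (z m i / z m j)) /
      (∏ i ∈ Icc 1 (m - 1), (1 - z m (i + 1) / (z m i * Q2 m))) =
    ∏ i : Fin m, ∏ j : Fin m, if i < j then
      link 1 i j ((uvar m i / uvar m j : (RatFun m)ˣ) : RatFun m) else 1 := by
  set E : ℕ → RatFun m := fun i => 1 - z m (i + 1 + 1) / (z m (i + 1) * Q2 m) with hE
  set L : ℕ → ℕ → RatFun m := fun i j => if i < j then
    link 1 i j (z m (i + 1) / z m (j + 1)) else 1 with hL
  have h1 : (∏ i : Fin m, ∏ j : Fin m, if i < j then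
      link 1 i j ((uvar m i / uvar m j : (RatFun m)ˣ) : RatFun m) else 1) =
      ∏ i ∈ range m, ∏ j ∈ range m, L i j := by
    rw [← Fin.prod_univ_eq_prod_range (fun i => ∏ j ∈ range m, L i j) m]
    refine Finset.prod_congr rfl fun i _ => ?_
    rw [← Fin.prod_univ_eq_prod_range (fun j => L i j) m]
    refine Finset.prod_congr rfl fun j _ => ?_
    rw [hL, Units.val_div_eq_div_val]
    simp only [z_succ i.2, z_succ j.2, Fin.eta, Fin.lt_def]
  have hE0 : ∀ i, i + 1 < m → E i ≠ 0 := by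
    intro i hi
    rw [hE]
    simp only [z_succ hi, z_succ (show i < m by omega)]
    exact one_sub_ne_zero_of_ne (by rw [Ne, Fin.mk.injEq]; omega)
  have h2 : ∏ i ∈ Icc 1 (m - 1), (1 - z m (i + 1) / (z m i * Q2 m)) =
      ∏ i ∈ range m, ∏ j ∈ range m, if j = i + 1 then E i else 1 := by
    rw [prod_Icc_one]
    simp only [Finset.prod_ite_eq', mem_range]
    rw [← Finset.prod_filter]
    refine Finset.prod_congr ?_ fun i _ => rfl
    ext i; simp only [mem_range, mem_filter]; omega
  rw [h1, div_eq_iff]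
  · rw [h2, ← Finset.prod_mul_distrib, prod_Icc_one]
    refine Finset.prod_congr rfl fun i hi => ?_
    rw [mem_range] at hi
    rw [← Finset.prod_mul_distrib]
    have h3 : ∏ j ∈ Ioc (i + 1) m, zeta (z m (i + 1) / z m j) =
        ∏ j ∈ range m, if i < j then zeta (z m (i + 1) / z m (j + 1)) else 1 := by
      rw [← Finset.prod_filter]
      have : Ioc (i + 1) m = ((range m).filter fun j => i < j).map (addRightEmbedding 1) := by
        ext j
        simp only [mem_Ioc, mem_map, mem_filter, mem_range, addRightEmbedding_apply]
        constructor
        · rintro ⟨h, h'⟩; exact ⟨j - 1, by omega, by omega⟩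
        · rintro ⟨l, h, rfl⟩; omega
      rw [this, Finset.prod_map]
      rfl
    rw [h3]
    refine Finset.prod_congr rfl fun j hj => ?_
    rw [mem_range] at hj
    rw [hL]
    simp only
    by_cases hij : i < j
    · rw [if_pos hij, if_pos hij, link]
      by_cases hij' : i + 1 = j
      · subst hij'
        rw [if_pos rfl, if_pos rfl, hE, zeta_eq_zred 1]
        · congr 2
          rw [div_mul_eq_mul_div, inv_div]
          rfl
        · rw [z_succ hi, z_succ hj]
          exact div_ne_zero (Units.ne_zero _) (Units.ne_zero _)
      · rw [if_neg hij', if_neg (Ne.symm hij'), mul_one]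
    · rw [if_neg hij, if_neg hij, if_neg (by omega), mul_one]
  · rw [prod_Icc_one, Finset.prod_ne_zero_iff]
    intro i hi
    rw [mem_range] at hi
    exact hE0 i (by omega)

lemma prod_uvar_jump {m p : ℕ} (h0 : 0 < p) (hp : p < m) :
    ((∏ i : Fin m, uvar m i ^ jump p i : (RatFun m)ˣ) : RatFun m) = z m (p + 1) / z m p := by
  obtain ⟨p, rfl⟩ : ∃ q, p = q + 1 := ⟨p - 1, by omega⟩
  rw [z_succ hp, z_succ (show p < m by omega), ← Units.val_div_eq_div_val]
  congr 1
  simp only [jump, zpow_sub, Finset.prod_mul_distrib, div_eq_mul_inv]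
  rw [Finset.prod_inv_distrib, Finset.prod_eq_single (⟨p + 1, hp⟩ : Fin m),
    Finset.prod_eq_single (⟨p, by omega⟩ : Fin m)]
  · simp
  · intro i _ hi
    rw [if_neg, zpow_zero]
    intro h; apply hi; ext; simp only; omega
  · simp
  · intro i _ hi
    rw [if_neg, zpow_zero]
    intro h; apply hi; ext; simpa using h
  · simp

lemma prod_z_eq {a t m : ℕ} (ha : 0 < a) (hm : m = a * t) {s : ℕ} (hs : s < t) :
    ∏ r ∈ Icc 1 s, z m (a * (t - r) + 1) / z m (a * (t - r)) =
      ((∏ i : Fin m, uvar m i ^ (∑ r ∈ Ico (t - s) t, jump (a * r)) (i : ℕ) : (RatFun m)ˣ) :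
        RatFun m) := by
  induction s with
  | zero => simp
  | succ s ih =>
    rw [Finset.prod_Icc_succ_top (by omega), ih (by omega),
      Finset.sum_eq_sum_Ico_succ_bot (show t - (s + 1) < t by omega),
      show t - (s + 1) + 1 = t - s by omega, mul_comm,
      ← prod_uvar_jump (m := m) (Nat.mul_pos ha (by omega))
        (by rw [hm]; exact Nat.mul_lt_mul_of_pos_left (by omega) ha), ← Units.val_mul,
      ← Finset.prod_mul_distrib]
    congr 1
    refine Finset.prod_congr rfl fun i _ => ?_
    rw [Pi.add_apply, zpow_add]

/-- The set function of `P_{at,bt}`. -/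
lemma setFun_P {a t m : ℕ} {b d : ℤ} (ha : 0 < a) (hab : IsCoprime (a : ℤ) b) (ht : 0 < t)
    (hm : m = a * t) (hd : d = b * t) (n : ℕ) : setFun n m (P m d) = PP 1 a b t (uvar n) := by
  have hg : Int.gcd m d = t := by
    rw [hm, hd]
    push_cast
    rw [Int.gcd_mul_right, Int.isCoprime_iff_gcd_eq_one.1 hab, one_mul, Int.natAbs_natCast]
  have hat : m / t = a := by rw [hm, Nat.mul_div_cancel _ ht]
  have hexp : ∀ i : ℕ, ⌊((i + 1 : ℕ) : ℚ) * d / m⌋ - ⌊(((i + 1 : ℕ) : ℚ) - 1) * d / m⌋ =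
      slopeExp a b i := by
    have h : ∀ i : ℕ, ⌊(i : ℚ) * d / m⌋ = (i * b) / a := by
      intro i
      have h1 := Rat.floor_intCast_div_natCast (i * d) m
      push_cast at h1
      rw [h1, hd, hm]
      push_cast
      rw [← mul_assoc, Int.mul_ediv_mul_of_pos_left _ _ (by omega)]
    intro i
    rw [h, slopeExp, show (((i + 1 : ℕ) : ℚ) - 1) = (i : ℚ) by push_cast; ring, h]
  have hf : P m d = symmetrize m (∑ s ∈ range t, ((fcol (RatFun m) 1 : RatFun m)⁻¹ ^ s) *
      wt 1 (slopeExp a b + ∑ r ∈ Ico (t - s) t, jump (a * r)) (uvar m) id) := by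
    rw [P]
    simp only [hg, hat]
    congr 1
    rw [div_mul_eq_mul_div, mul_div_assoc, prod_zeta_div_eq, Finset.mul_sum, Finset.sum_mul]
    refine Finset.sum_congr rfl fun s hs => ?_
    rw [mem_range] at hs
    rw [prod_z_eq ha hm hs, prod_Icc_one]
    simp only [hexp]
    have h1 : ∏ i ∈ range m, z m (i + 1) ^ slopeExp a b i =
        ((∏ i : Fin m, uvar m i ^ slopeExp a b i : (RatFun m)ˣ) : RatFun m) := by
      rw [← Fin.prod_univ_eq_prod_range (fun i => z m (i + 1) ^ slopeExp a b i) m, Units.coe_prod]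
      refine Finset.prod_congr rfl fun i _ => ?_
      rw [z_succ i.2, Fin.eta, Units.val_zpow_eq_zpow_val]
    rw [h1, wt]
    simp only [Pi.add_apply, zpow_add, Finset.prod_mul_distrib, Units.val_mul, id]
    rw [inv_pow]
    change _ * (_ / (fcol (RatFun m) 1 : RatFun m) ^ s) * _ = _
    ring
  ext S
  rw [hf, setFun_symmetrize, PP, Tw.sum_apply]
  simp only [map_sum, map_mul, relabel_wt]
  rw [Finset.sum_comm]
  refine Finset.sum_congr rfl fun s _ => ?_
  rw [Tw.smul_apply, ← hm, M_apply, Finset.mul_sum]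
  refine Finset.sum_congr rfl fun o _ => ?_
  congr 1
  rw [map_pow, map_inv₀]
  congr 2
  exact (relabel o o.injective).commutes _

end KernelP

/-! ### The exponential series in the ambient algebra -/

lemma Tw.pow_apply_of_card_lt_mul {I F : Type} [DecidableEq I] [Field F] {κ : I → I → F}
    {f : Tw κ} {a : ℕ} (hf : ∀ S, #S < a → f S = 0) (k : ℕ) (S : Finset I) (h : #S < a * k) :
    (f ^ k) S = 0 := by
  induction k generalizing S with
  | zero => omega
  | succ k ih =>
    rw [pow_succ, Tw.mul_apply]
    refine Finset.sum_eq_zero fun U hU => ?_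
    have h1 := Tw.card_add (mem_powerset.1 hU)
    by_cases h2 : #(S \ U) < a
    · rw [hf _ h2]; ring
    · rw [ih U (by rw [mul_add, mul_one] at h; omega)]; ring

section Series

variable {a : ℕ} {A : ℕ → Ambient}

lemma toTw_seriesMul (B : ℕ → Ambient) (n t : ℕ) : toTw n (seriesMul A B t) =
    ∑ p ∈ antidiagonal t, toTw n (A p.1) * toTw n (B p.2) := by
  rw [seriesMul, map_sum]
  exact Finset.sum_congr rfl fun p _ => toTw_mul _ _

lemma toTw_seriesPow_supp (hA : ∀ n t (S : Finset (Fin n)), #S ≠ a * t → toTw n (A t) S = 0)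
    (k n t : ℕ) (S : Finset (Fin n)) (hS : #S ≠ a * t) : toTw n (seriesPow A k t) S = 0 := by
  induction k generalizing t S with
  | zero =>
    rw [seriesPow]
    beta_reduce
    split_ifs with h
    · rw [toTw_one, Tw.one_apply, if_neg]
      rintro rfl
      exact hS (by simp [h])
    · rw [map_zero, Tw.zero_apply]
  | succ k ih =>
    rw [seriesPow, toTw_seriesMul, Tw.sum_apply]
    refine Finset.sum_eq_zero fun p hp => ?_
    rw [HasAntidiagonal.mem_antidiagonal] at hp
    rw [Tw.mul_apply]
    refine Finset.sum_eq_zero fun U hU => ?_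
    by_cases h1 : #U = a * p.1
    · rw [hA n p.2, mul_zero, zero_mul]
      intro h2
      apply hS
      rw [← Tw.card_add (mem_powerset.1 hU), h1, h2, ← mul_add, hp]
    · rw [ih p.1 U h1, zero_mul, zero_mul]

lemma total_seriesPow (ha : 0 < a)
    (hA : ∀ n t (S : Finset (Fin n)), #S ≠ a * t → toTw n (A t) S = 0) (k n : ℕ) :
    Tw.total a (fun t => toTw n (seriesPow A k t)) =
      (Tw.total a fun t => toTw n (A t)) ^ k := by
  induction k with
  | zero =>
    ext S
    rw [pow_zero, Tw.one_apply]
    by_cases hd : a ∣ #S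
    · obtain ⟨t, ht⟩ := hd
      rw [Tw.total_apply ha _ ht, seriesPow]
      beta_reduce
      by_cases h : t = 0
      · rw [if_pos h, toTw_one, Tw.one_apply]
      · rw [if_neg h, map_zero, Tw.zero_apply, if_neg]
        rintro rfl
        rw [card_empty, zero_eq_mul] at ht
        omega
    · rw [Tw.total_of_not_dvd _ hd, if_neg]
      rintro rfl
      exact hd (by simp)
  | succ k ih =>
    rw [pow_succ, ← ih, Tw.total_mul ha _ _ fun t S => toTw_seriesPow_supp hA k n t S]
    simp only [seriesPow, toTw_seriesMul]

/-- The exponential of a series becomes the exponential of its set function. -/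
lemma toTw_seriesExp (ha : 0 < a)
    (hA : ∀ n t (S : Finset (Fin n)), #S ≠ a * t → toTw n (A t) S = 0) (hA0 : A 0 = 0)
    {n t : ℕ} (hn : n = a * t) [CharZero (RatFun n)] : toTw n (seriesExp A t) univ =
      IsNilpotent.exp (Tw.total a fun t => toTw n (A t)) univ := by
  set C : Tw (kap (uvar n)) := Tw.total a fun t => toTw n (A t) with hC
  have hcard : #(univ : Finset (Fin n)) = a * t := by rw [card_univ, Fintype.card_fin, hn]
  have hC0 : ∀ S : Finset (Fin n), #S < a → C S = 0 := by
    intro S hS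
    by_cases hd : a ∣ #S
    · have h0 : #S = a * 0 := by rw [Nat.eq_zero_of_dvd_of_lt hd hS, mul_zero]
      rw [hC, Tw.total_apply ha _ h0, hA0, map_zero, Tw.zero_apply]
    · exact Tw.total_of_not_dvd _ hd
  have hpow : ∀ k, toTw n (seriesPow A k t) univ = (C ^ k) univ := by
    intro k
    rw [hC, ← total_seriesPow ha hA, Tw.total_apply ha _ hcard]
  rw [IsNilpotent.exp_eq_sum (Tw.isNilpotent_of_empty (hC0 ∅ (by simpa using ha))), Tw.sum_apply,
    seriesExp, map_sum, Tw.sum_apply, Fintype.card_fin]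
  have hsub : range (t + 1) ⊆ range (n + 1) := by
    rw [range_subset_range, hn]
    exact Nat.succ_le_succ (Nat.le_mul_of_pos_left t ha)
  rw [← Finset.sum_subset hsub]
  · refine Finset.sum_congr rfl fun k _ => ?_
    rw [toTw_smul, Tw.smul_apply, hpow, Tw.rat_smul_apply]
    congr 1
    simp
  · intro k _ hk
    rw [mem_range, not_lt] at hk
    rw [Tw.rat_smul_apply, Tw.pow_apply_of_card_lt_mul hC0, mul_zero]
    rw [hcard]
    exact Nat.mul_lt_mul_of_pos_left hk ha

lemma toTw_seriesExp_of_ne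
    (hA : ∀ n t (S : Finset (Fin n)), #S ≠ a * t → toTw n (A t) S = 0)
    {n t : ℕ} (hn : n ≠ a * t) : toTw n (seriesExp A t) univ = 0 := by
  rw [seriesExp, map_sum, Tw.sum_apply]
  refine Finset.sum_eq_zero fun k _ => ?_
  rw [toTw_smul, Tw.smul_apply, toTw_seriesPow_supp hA, mul_zero]
  rwa [card_univ, Fintype.card_fin]

lemma isSymm_seriesExp (A : ℕ → Ambient) (t : ℕ) : IsSymm (seriesExp A t) := by
  refine IsSymm.sum _ fun k _ => IsSymm.smul _ ?_
  rcases k with _ | k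
  · rw [seriesPow]
    beta_reduce
    split_ifs
    · exact IsSymm.of fun σ => map_one _
    · exact IsSymm.zero
  · exact IsSymm.sum _ fun p _ => IsSymm.mul _ _

end Series

section Hbar

/-- The logarithm of the series of the elements `H`. -/
def logSeries (a : ℕ) (b : ℤ) (t : ℕ) : Ambient :=
  if t = 0 then 0 else (1 / (t : Kq)) • Pbar (a * t) (b * t)

variable {a : ℕ} {b : ℤ}

lemma toTw_logSeries (ha : 0 < a) (hab : IsCoprime (a : ℤ) b) {t : ℕ} (ht : 0 < t) (n : ℕ) :
    toTw n (logSeries a b t) =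
      algebraMap Kq (RatFun n) (1 / (t : Kq) * gamma (a * t) (b * t)) • PP 1 a b t (uvar n) := by
  have h1 : Pbar (a * t) (b * t) =
      gamma (a * t) (b * t) • DirectSum.of RatFun (a * t) (P (a * t) (b * t)) :=
    DirectSum.of_smul Kq _ _ _
  rw [logSeries, if_neg ht.ne', h1, smul_smul, toTw_smul, toTw_of, setFun_P ha hab ht rfl rfl]

lemma toTw_logSeries_supp (ha : 0 < a) (hab : IsCoprime (a : ℤ) b) (n t : ℕ)
    (S : Finset (Fin n)) (hS : #S ≠ a * t) : toTw n (logSeries a b t) S = 0 := by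
  rcases Nat.eq_zero_or_pos t with rfl | ht
  · rw [logSeries, if_pos rfl, map_zero, Tw.zero_apply]
  · rw [toTw_logSeries ha hab ht, Tw.smul_apply, PP_of_card_ne _ _ _ _ hS, mul_zero]

/-- The number `(q₂ - 1)^a (q_δ - 1)^a`. -/
def factorZq (δ : Fin 3) (a : ℕ) : Zq := (((zcol 1 : Zq) - 1) * ((zcol δ : Zq) - 1)) ^ a

lemma coefHom_factorZq (F : Type) [Field F] [Algebra Kq F] (δ : Fin 3) (a : ℕ) :
    coefHom F (factorZq δ a) = (((fcol F 1 : F) - 1) * ((fcol F δ : F) - 1)) ^ a := by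
  rw [factorZq, map_pow, map_mul, map_sub, map_sub, map_one, coefHom_zcol, coefHom_zcol]

/-- The colour `q₂` in the definition of the logarithm can be exchanged for `q₁` or `q₃`, by `PP_color`.
The scalar `γ_{n,d}` is such that only the denominators `q_δ^t - 1` remain. -/
lemma total_logSeries (ha : 0 < a) (hab : IsCoprime (a : ℤ) b) {c δ : Fin 3} (hc : c ≠ 1)
    (hδ : δ ≠ 1) (hcδ : c ≠ δ) (n : ℕ) :
    Tw.total a (fun t => toTw n (logSeries a b t)) =
      combo c a b (fun t => coefHom (RatFun n) (factorZq δ a) ^ t /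
        (t * ((fcol (RatFun n) δ : RatFun n) ^ t - 1))) (uvar n) := by
  ext S
  by_cases hd : a ∣ #S
  · obtain ⟨t, hS⟩ := hd
    rw [Tw.total_apply ha _ hS, combo_apply ha _ hS]
    rcases Nat.eq_zero_or_pos t with rfl | ht
    · simp [logSeries, PP, Tw.zero_apply]
    rw [toTw_logSeries ha hab ht, Tw.smul_apply]
    have hcol := congrFun (PP_color ha hab hc.symm ht (uvar_injective n)) S
    rw [Tw.smul_apply, Tw.smul_apply] at hcol
    have hg : Int.gcd (a * t : ℕ) (b * t) = t := by
      push_cast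
      rw [Int.gcd_mul_right, Int.isCoprime_iff_gcd_eq_one.1 hab, one_mul, Int.natAbs_natCast]
    have hcolor : ∀ c : Fin 3, algebraMap Kq (RatFun n) (col c) = fcol (RatFun n) c := fun _ => rfl
    have hgam : algebraMap Kq (RatFun n) (gamma (a * t) (b * t)) =
        ((fcol (RatFun n) 1 : RatFun n) ^ t - 1) / (((fcol (RatFun n) c : RatFun n) ^ t - 1) *
          ((fcol (RatFun n) δ : RatFun n) ^ t - 1)) *
          (((fcol (RatFun n) c : RatFun n) - 1) ^ (a * t) *
            ((fcol (RatFun n) δ : RatFun n) - 1) ^ (a * t)) := by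
      have h0 : algebraMap Kq (RatFun n) (gamma (a * t) (b * t)) =
          ((fcol (RatFun n) 1 : RatFun n) ^ t - 1) / (((fcol (RatFun n) 0 : RatFun n) ^ t - 1) *
            ((fcol (RatFun n) 2 : RatFun n) ^ t - 1)) *
            (((fcol (RatFun n) 0 : RatFun n) - 1) ^ (a * t) *
              ((fcol (RatFun n) 2 : RatFun n) - 1) ^ (a * t)) := by
        rw [gamma]
        simp only [hg, map_mul, map_div₀, map_sub, map_pow, map_one]
        rfl
      have h : ∀ c δ : Fin 3, c ≠ 1 → δ ≠ 1 → c ≠ δ →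
        (c = 0 ∧ δ = 2) ∨ (c = 2 ∧ δ = 0) := by decide
      rcases h c δ hc hδ hcδ with ⟨rfl, rfl⟩ | ⟨rfl, rfl⟩
      · exact h0
      · rw [h0, mul_comm ((fcol (RatFun n) 0 : RatFun n) ^ t - 1),
          mul_comm (((fcol (RatFun n) 0 : RatFun n) - 1) ^ (a * t))]
    have hne : ∀ c : Fin 3, (fcol (RatFun n) c : RatFun n) ^ t - 1 ≠ 0 := fun c =>
      sub_ne_zero.2 (fcol_pow_ne_one c ht.ne')
    have ht0 : (t : RatFun n) ≠ 0 := by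
      have := charZero_of_algebra (RatFun n)
      exact Nat.cast_ne_zero.2 ht.ne'
    have hneg : ∀ x : RatFun n, (1 - x) ^ (a * t) = (-1) ^ (a * t) * (x - 1) ^ (a * t) := by
      intro x; rw [← mul_pow]; congr 1; ring
    have hm1 : ((-1 : RatFun n) ^ (a * t)) ≠ 0 := pow_ne_zero _ (neg_ne_zero.2 one_ne_zero)
    rw [hneg, hneg] at hcol
    have hn1 := hne c
    have hn2 := hne δ
    rw [map_mul, hgam, map_div₀, map_one, map_natCast, coefHom_factorZq, ← pow_mul, mul_pow]
    generalize (fcol (RatFun n) c : RatFun n) = x at *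
    generalize (fcol (RatFun n) δ : RatFun n) = y at *
    generalize (fcol (RatFun n) 1 : RatFun n) = w at *
    generalize PP 1 a b t (uvar n) S = u at *
    generalize PP c a b t (uvar n) S = u' at *
    have key : (x - 1) ^ (a * t) * (w ^ t - 1) * u = (w - 1) ^ (a * t) * (x ^ t - 1) * u' := by
      apply mul_left_cancel₀ hm1
      linear_combination -hcol
    field_simp
    linear_combination (y - 1) ^ (a * t) * key
  · rw [Tw.total_of_not_dvd _ hd, combo_supp _ S hd]

/-- Up to the denominators `∏ (q_δ^i - 1)`, the element `H` is an integral combination of sums over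
orderings. -/
lemma exists_isComb_Hbar (ha : 0 < a) (hab : IsCoprime (a : ℤ) b) {c δ : Fin 3} (hc : c ≠ 1)
    (hδ : δ ≠ 1) (hcδ : c ≠ δ) {n t : ℕ} (hn : n = a * t) : ∃ h : Fam, IsComb c n h ∧
      (∏ i ∈ range t, ((fcol (RatFun n) δ : RatFun n) ^ (i + 1) - 1)) *
          seriesExp (logSeries a b) t n =
        (((fcol (RatFun n) 1 : RatFun n) - 1) * ((fcol (RatFun n) δ : RatFun n) - 1)) ^ n *
          h (Fin n) (RatFun n) (uvar n) univ := by
  have := charZero_of_algebra (RatFun n)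
  obtain ⟨h, hc', hh⟩ := exists_isComb_exp c δ ha hab (factorZq δ a) t
  rw [← hn] at hc'
  refine ⟨h, hc', ?_⟩
  have h1 := congrFun (hh (Fin n) (RatFun n) (uvar n) (uvar_injective n)) univ
  rw [Tw.smul_apply, Tw.smul_apply, Tw.part_apply,
    if_pos (by rw [card_univ, Fintype.card_fin, hn]), ← total_logSeries ha hab hc hδ hcδ,
    ← toTw_seriesExp ha (toTw_logSeries_supp ha hab) (if_pos rfl) hn,
    toTw_univ (isSymm_seriesExp _ _), coefHom_factorZq, ← pow_mul, ← hn] at h1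
  exact h1

end Hbar

section Integral

lemma coeff_comp_of_relabel {n : ℕ} {R : Laurent Zq (Fin n)} (σ : Equiv.Perm (Fin n))
    (h : relabel σ σ.injective (toRat n R) = toRat n R) (e : Fin n → ℤ) :
    R.coeff (e ∘ σ) = R.coeff e := by
  let s : (Fin n → ℤ) ≃+ (Fin n → ℤ) :=
    { toFun := fun e => e ∘ σ.symm
      invFun := fun e => e ∘ σ
      left_inv := fun e => by ext i; simp
      right_inv := fun e => by ext i; simp
      map_add' := fun _ _ => rfl }
  let ρ := AddMonoidAlgebra.mapDomainRingEquiv Zq s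
  have hρ : ((toRat n).comp (ρ : Laurent Zq (Fin n) →+* Laurent Zq (Fin n))) =
      ((relabel σ σ.injective : RatFun n →+* RatFun n)).comp (toRat n) := by
    have hs : ∀ e r, ρ (AddMonoidAlgebra.single e r) = AddMonoidAlgebra.single (s e) r := by
      intro e r
      exact AddMonoidAlgebra.mapDomain_single
    apply laurent_hom_ext
    · intro r
      have h1 : ρ (lC r) = lC r := by rw [lC_apply, hs, map_zero]
      change toRat n (ρ (lC r)) = relabel σ σ.injective (toRat n (lC r))
      rw [h1, toRat_lC]
      exact ((relabel σ σ.injective).commutes _).symm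
    · intro i
      have h1 : ρ (lvar i : (Laurent Zq (Fin n))ˣ) = (lvar (σ i) : (Laurent Zq (Fin n))ˣ) := by
        change ρ (AddMonoidAlgebra.single _ _) = AddMonoidAlgebra.single _ _
        rw [hs]
        congr 1
        ext j
        change (Pi.single i (1 : ℤ) : Fin n → ℤ) (σ.symm j) = _
        rw [Pi.single_apply, Pi.single_apply]
        congr 1
        rw [Equiv.symm_apply_eq]
      change toRat n (ρ _) = relabel σ σ.injective (toRat n _)
      rw [h1, toRat_unit, toRat_unit, map_toRat_lvar, map_toRat_lvar]
      exact (relabel_var _ _ _).symm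
  have h1 : ρ R = R := by
    apply toRat_injective
    exact (congrArg (fun f => f R) hρ).trans h
  have h2 := AddMonoidAlgebra.coeff_mapDomainRingEquiv s R
  conv_rhs => rw [← h1]
  rw [h2]
  rfl

lemma zero_mem_shufflePart (n : ℕ) : (0 : Laurent Zq (Fin n)) ∈ shufflePart n :=
  ⟨fun _ _ => rfl, fun c _ => ⟨0, by rw [map_zero, map_zero, mul_zero]⟩⟩

/-- An element of the fraction field is integral, and satisfies the divisibility conditions, if
this holds for its multiples by `∏ (q₃^i - 1)` and by `∏ (q₁^i - 1)`. -/
lemma exists_mem_shufflePart {n t : ℕ} {H : RatFun n}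
    (hH : ∀ σ : Equiv.Perm (Fin n), relabel σ σ.injective H = H)
    (h : ∀ δ : Fin 3, δ ≠ 1 → ∃ r : Laurent Zq (Fin n),
      toRat n (lC (∏ i ∈ range t, ((zcol δ : Zq) ^ (i + 1) - 1))) * H = toRat n r ∧
      ∀ cc : Composition n, ∃ T : Laurent Zq (Fin cc.length),
        specialize cc r = divisor cc * toRat _ T) :
    ∃ R ∈ shufflePart n, toRat n R = H := by
  obtain ⟨r₂, h2, hT2⟩ := h 2 (by decide)
  obtain ⟨r₀, h0, hT0⟩ := h 0 (by decide)
  set α : Fin 3 → Zq := fun δ => ∏ i ∈ range t, ((zcol δ : Zq) ^ (i + 1) - 1) with hα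
  have hα0 : ∀ δ, α δ ≠ 0 := by
    intro δ
    rw [hα, Finset.prod_ne_zero_iff]
    intro i _ hi
    have h1 := congrArg (coefHom Kq) hi
    rw [map_sub, map_pow, coefHom_zcol, map_one, map_zero, sub_eq_zero] at h1
    exact fcol_pow_ne_one δ (Nat.succ_ne_zero i) h1
  have hα' : ∀ (k : ℕ) (δ : Fin 3), toRat k (lC (α δ)) ≠ 0 := fun k δ =>
    (map_ne_zero_iff _ (toRat_injective k)).2 ((map_ne_zero_iff _
      (show Function.Injective (lC : Zq →+* Laurent Zq (Fin k)) from
        AddMonoidAlgebra.single_right_injective)).2 (hα0 δ))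
  -- Both sides are `∏ (q₃^i - 1) ∏ (q₁^i - 1) H`.
  have e : lC (α 2) * r₀ = lC (α 0) * r₂ := by
    apply toRat_injective
    rw [map_mul, map_mul, ← h0, ← h2]; ring
  obtain ⟨R, rfl⟩ := prod_col_dvd_of_dvd_mul t t ⟨r₀, e.symm⟩
  have hR : toRat n R = H := by
    apply mul_left_cancel₀ (hα' n 2)
    rw [h2, map_mul]
  refine ⟨R, ⟨fun σ e => coeff_comp_of_relabel σ (by rw [hR, hH]) e, fun cc _ => ?_⟩, hR⟩
  have hr₀ : r₀ = lC (α 0) * R := by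
    apply toRat_injective
    rw [← h0, map_mul, hR]
  obtain ⟨T₂, hT2⟩ := hT2 cc
  obtain ⟨T₀, hT0⟩ := hT0 cc
  have hs : ∀ r, specialize cc (lC r) = toRat cc.length (lC r) := fun r => by
    rw [specialize_eq_ev, ev_lC, toRat_lC]
  rw [hr₀] at hT0
  rw [map_mul, hs] at hT0 hT2
  by_cases hd : divisor cc = 0
  · refine ⟨0, ?_⟩
    rw [hd, zero_mul] at hT0 ⊢
    exact (mul_eq_zero.1 hT0).resolve_left (hα' _ 0)
  · have e' : lC (α 2) * T₀ = lC (α 0) * T₂ := by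
      apply toRat_injective
      apply mul_left_cancel₀ hd
      rw [map_mul, map_mul]
      linear_combination toRat _ (lC (α 0)) * hT2 - toRat _ (lC (α 2)) * hT0
    obtain ⟨T, rfl⟩ := prod_col_dvd_of_dvd_mul t t ⟨T₀, e'.symm⟩
    refine ⟨T, mul_left_cancel₀ (hα' _ 2) ?_⟩
    rw [hT2, map_mul]; ring

end Integral

end

end ShuffleKHA

open ShuffleKHA in
theorem proposition4p3 (n : ℕ) (hn : 1 ≤ n) (d : ℤ) :
    ShuffleKHA.Hbar n d ∈ ShuffleKHA.integralShuffleAlgebra := by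
  set t := Int.gcd n d with ht
  have ht0 : 0 < t := Int.gcd_pos_of_ne_zero_left _ (by omega)
  obtain ⟨a, ha⟩ : t ∣ n := by exact_mod_cast Int.gcd_dvd_left n d
  obtain ⟨b, hb⟩ : (t : ℤ) ∣ d := Int.gcd_dvd_right n d
  have hat : n / t = a := by rw [ha, Nat.mul_div_cancel_left _ ht0]
  have hbt : d / (t : ℤ) = b := by rw [hb, Int.mul_ediv_cancel_left _ (by omega)]
  have ha0 : 0 < a := Nat.pos_of_ne_zero fun h => by rw [h, mul_zero] at ha; omega
  have hab : IsCoprime (a : ℤ) b := by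
    rw [Int.isCoprime_iff_gcd_eq_one]
    have h1 : Int.gcd (t * a) (t * b) = t := by rw [← hb]; exact_mod_cast ha ▸ ht.symm
    rw [Int.gcd_mul_left, Int.natAbs_natCast] at h1
    exact Nat.eq_of_mul_eq_mul_left ht0 (by rw [h1, mul_one])
  have hH : ShuffleKHA.Hbar n d = seriesExp (logSeries a b) t := by
    rw [Hbar, ← ht, hat, hbt]; rfl
  rw [hH]
  have hsymm := isSymm_seriesExp (logSeries a b) t
  intro m
  by_cases hm : m = a * t
  -- The component of degree `n`. All others vanish.
  · refine exists_mem_shufflePart (t := t) (hsymm m) fun δ hδ => ?_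
    -- The denominators involve the colour `δ`, the sums over orderings the third colour `c`.
    obtain ⟨c, hc, hcδ⟩ : ∃ c : Fin 3, c ≠ 1 ∧ c ≠ δ := by clear * - hδ; revert δ; decide
    obtain ⟨h, hcomb, hh⟩ := exists_isComb_Hbar ha0 hab hc hδ hcδ hm
    obtain ⟨R, hR⟩ := hcomb.rep
    refine ⟨lC (((1 - (zcol 1 : Zq)) * (1 - (zcol δ : Zq))) ^ m) * R, ?_, fun cc => ?_⟩
    · have hRm : toRat m R = h (Fin m) (RatFun m) (uvar m) Finset.univ := hR _ _ (uvar_injective m)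
      have hsq : ∀ x y : RatFun m, (1 - x) * (1 - y) = (x - 1) * (y - 1) := fun x y => by ring
      rw [map_mul, toRat_lC, toRat_lC, map_prod, map_pow, map_mul, map_sub, map_sub, map_one,
        coefHom_zcol, coefHom_zcol, hsq, hRm]
      simp only [map_sub, map_pow, map_one, coefHom_zcol]
      exact hh
    · obtain ⟨T, hT⟩ := hcomb.exists_eq_divisor_mul hc hδ hcδ cc
      refine ⟨T, ?_⟩
      rw [specialize_eq_ev, map_mul, ev_lC, map_pow, map_mul, map_sub, map_sub, map_one,
        coefHom_zcol, coefHom_zcol, hR _ _ (specPt_injective cc)]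
      exact hT
  · refine ⟨0, zero_mem_shufflePart m, ?_⟩
    rw [map_zero, ← toTw_univ hsymm, toTw_seriesExp_of_ne (toTw_logSeries_supp ha0 hab) hm]
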